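/- Let $q\in\mathbb{C}$ be a root of unity with $q^2\neq 1$, let $l\ge 2$ be the least positive integer with $q^{2l}=1$, and let $\delta=q+q^{-1}$ (so $\delta=0$ exactly when $l=2$). Let $TL_n=TL_n(\delta)$ be the Temperley–Lieb algebra with generators $e_1,\dots,e_{n-1}$ and relations $e_i^2=\delta e_i$, $e_ie_{i\pm1}e_i=e_i$, $e_ie_j=e_je_i$ for $|i-j|>1$, and let $TL_\infty=\bigcup_n TL_n$. For $0\le 2i\le n$ let $V_{n,i}$ be the standard representation, with basis the $(n,i)$-link states, and $t_{n,i}$ its (unnormalized) trace. Let $L_{n,i}$ be the irreducible quotient of $V_{n,i}$ and $l_{n,i}$ its trace; when $\delta=0$ there is, by convention, no $L_{n,i}$ with $n=2i$. Let $\chi$ be a normalized trace on $TL_\infty$, i.e. a linear functional with $\chi(ab)=\chi(ba)$ and $\chi(1)=1$. Its standard coefficients are numbers $c_{n,i}$ $(0\le 2i\le n)$ with $\chi|_{TL_n}=\sum_i c_{n,i}\,t_{n,i}$ for all $n$ and $c_{n,i}=c_{n+1,i}+c_{n+1,i+1}$ (where $c_{n,i}=0$ for $2i>n$). Call $\chi$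 *extremal* if it is an extreme point of the convex set of normalized traces with standard coefficients $c_{n,i}\ge 0$, and *multiplicative* if its standard coefficients exist and satisfy $$c_{n,i}\,c_{m,j}=\sum_{k=0}^{\min(n-2i,\,m-2j)}c_{n+m,\,i+j+k}.$$ Suppose that $\chi$ is extremal or multiplicative. Then its standard coefficients are unique, and there is a unique family $\lambda_{n,i}$ $(0\le 2i\le n)$ with $\chi|_{TL_n}=\sum_i\lambda_{n,i}\,l_{n,i}$ for all $n$ (when $\delta=0$: for all $n\ge1$, with the convention $\lambda_{2i,i}=0$). Put $\gamma=c_{2,1}$. Either $\gamma=0$ and $c_{n,0}=1$ for all $n$, or there is $r\in\mathbb{C}^\times$ with $[2]_r\ne0$ such that $$\gamma=[2]_r^{-2},\qquad c_{n,0}=\frac{[n+1]_r}{[2]_r^{\,n}}\quad(n\ge 0),$$ where $[0]_r=0$, $[1]_r=1$, $[2]_r=r+r^{-1}$ and $[n]_r=[2]_r[n-1]_r-[n-2]_r$. Moreover $$\lambda_{0,0}=\begin{cases}0& l=2\\1&\text{otherwise,}\end{cases}\qquad \lambda_{1,0}=1,\qquad \lambda_{n,i}=\gamma^i\lambda_{n-2i,0}\quad(0\le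 2i\le n),$$ and for all $n\ge1$, with $j=(n+1)\bmod l$, $$\lambda_{n,0}=\begin{cases}c_{n,0}& \text{if }(n,0)\text{ is critical, i.e. } n+1=kl\text{ for some integer }k>0,\\ c_{n,0}+\gamma^{j}c_{n-2j,0}&\text{otherwise,}\end{cases}$$ where $c_{m,0}$ is read as $0$ for $m<0$. -/

import Mathlib

namespace TemperleyLieb

/-! ### Temperley–Lieb algebras -/

/-- The Temperley–Lieb relations on generators `e i`, `i ∈ S`, where `e i` connects the
strands `i` and `i + 1` (strands are numbered from `0`). -/
inductive Rel (δ : ℂ) (S : Set ℕ) : FreeAlgebra ℂ S → FreeAlgebra ℂ S → Prop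
  | sq (i : S) :
      Rel δ S (FreeAlgebra.ι ℂ i * FreeAlgebra.ι ℂ i) (δ • FreeAlgebra.ι ℂ i)
  | zigzag (i j : S) (h : (i : ℕ) + 1 = j ∨ (j : ℕ) + 1 = i) :
      Rel δ S (FreeAlgebra.ι ℂ i * FreeAlgebra.ι ℂ j * FreeAlgebra.ι ℂ i) (FreeAlgebra.ι ℂ i)
  | comm (i j : S) (h : (i : ℕ) + 1 < j ∨ (j : ℕ) + 1 < i) :
      Rel δ S (FreeAlgebra.ι ℂ i * FreeAlgebra.ι ℂ j) (FreeAlgebra.ι ℂ j * FreeAlgebra.ι ℂ i)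

/-- The unital algebra generated by `e i`, `i ∈ S`, with the Temperley–Lieb relations. -/
abbrev Alg (δ : ℂ) (S : Set ℕ) : Type := RingQuot (Rel δ S)

/-- The generator `e i`. -/
noncomputable def gen (δ : ℂ) (S : Set ℕ) (i : S) : Alg δ S :=
  RingQuot.mkAlgHom ℂ (Rel δ S) (FreeAlgebra.ι ℂ i)

/-- The universal property: a family satisfying the relations defines an algebra map. -/
noncomputable def liftHom {δ : ℂ} {S : Set ℕ} {A : Type*} [Ring A] [Algebra ℂ A] (f : S → A)
    (hsq : ∀ i, f i * f i = δ • f i)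
    (hzig : ∀ i j : S, ((i : ℕ) + 1 = j ∨ (j : ℕ) + 1 = i) → f i * f j * f i = f i)
    (hcomm : ∀ i j : S, ((i : ℕ) + 1 < j ∨ (j : ℕ) + 1 < i) → f i * f j = f j * f i) :
    Alg δ S →ₐ[ℂ] A :=
  RingQuot.liftAlgHom ℂ ⟨FreeAlgebra.lift ℂ f, by
    intro x y h
    cases h with
    | sq i => simpa using hsq i
    | zigzag i j h => simpa using hzig i j h
    | comm i j h => simpa using hcomm i j h⟩

theorem gen_sq (δ : ℂ) (S : Set ℕ) (i : S) :
    gen δ S i * gen δ S i = δ • gen δ S i := by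
  have := RingQuot.mkAlgHom_rel ℂ (Rel.sq (δ := δ) i)
  simpa [gen] using this

theorem gen_zigzag (δ : ℂ) (S : Set ℕ) (i j : S) (h : (i : ℕ) + 1 = j ∨ (j : ℕ) + 1 = i) :
    gen δ S i * gen δ S j * gen δ S i = gen δ S i := by
  have := RingQuot.mkAlgHom_rel ℂ (Rel.zigzag (δ := δ) i j h)
  simpa [gen] using this

theorem gen_comm (δ : ℂ) (S : Set ℕ) (i j : S) (h : (i : ℕ) + 1 < j ∨ (j : ℕ) + 1 < i) :
    gen δ S i * gen δ S j = gen δ S j * gen δ S i := by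
  have := RingQuot.mkAlgHom_rel ℂ (Rel.comm (δ := δ) i j h)
  simpa [gen] using this

/-- `TL_n(δ)`: generators `e i` with `i + 1 < n`, that is `n - 1` generators on `n` strands. -/
abbrev TL (δ : ℂ) (n : ℕ) : Type := Alg δ {i : ℕ | i + 1 < n}

/-- `TL_∞(δ)`, the union of all `TL_n(δ)`: one generator `e i` for every `i : ℕ`. -/
abbrev TLInf (δ : ℂ) : Type := Alg δ Set.univ

/-- The canonical map `TL_n → TL_∞`, `e i ↦ e i`. -/
noncomputable def toInf (δ : ℂ) (n : ℕ) : TL δ n →ₐ[ℂ] TLInf δ :=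
  liftHom (fun i => gen δ Set.univ ⟨i, trivial⟩)
    (fun _ => gen_sq _ _ _) (fun _ _ h => gen_zigzag _ _ _ _ h) (fun _ _ h => gen_comm _ _ _ _ h)

/-! ### Link states and standard representations -/

/-- An `(n, p)`-link state: `n` points on a line, joined in pairs by `p` non-crossing cups, the
remaining `n - 2 p` points being the ends of through strands, which no cup may enclose. The point
`mate x` is the other end of the cup at `x`, and `mate x = x` if a through strand ends at `x`. -/
@[ext]
structure LinkState (n p : ℕ) where
  mate : Fin n → Fin n
  mate_mate : ∀ x, mate (mate x) = x
  noncrossing : ∀ a b, a < b → b < mate a → a < mate b ∧ mate b < mate a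
  exposed : ∀ a b, a < b → b < mate a → mate b ≠ b
  card_through : (Finset.univ.filter fun x => mate x = x).card + 2 * p = n

instance (n p : ℕ) : Finite (LinkState n p) :=
  Finite.of_injective LinkState.mate fun _ _ h => LinkState.ext h

/-- The effect on mates of putting the cup-cap diagram on the points `i`, `j` on top: `i` and `j`
become joined by a cup, and the strands that ended at `i` and at `j` are connected. -/
def joinMate {α : Type} [DecidableEq α] (m : α → α) (i j x : α) : α :=
  if x = i then j
  else if x = j then i
  else if x = m i then (if m j = j then x else m j)
  else if x = m j then (if m i = i then x else m i)
  else m x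

theorem joinMate_card {n : ℕ} (m : Fin n → Fin n) (hm : ∀ x, m (m x) = x) (i j : Fin n)
    (hij : i ≠ j) (h1 : m i ≠ j) (h2 : ¬ (m i = i ∧ m j = j)) :
    (Finset.univ.filter fun x => joinMate m i j x = x).card
      = (Finset.univ.filter fun x => m x = x).card := by
  by_cases hi : m i = i
  · have e : (Finset.univ.filter fun x => joinMate m i j x = x)
        = insert (m j) ((Finset.univ.filter fun x => m x = x).erase i) := by
      ext x
      simp only [joinMate, Finset.mem_filter, Finset.mem_univ, true_and, Finset.mem_insert,
        Finset.mem_erase]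
      grind
    rw [e, Finset.card_insert_of_notMem (by simp; grind), Finset.card_erase_of_mem (by simpa)]
    have : 0 < (Finset.univ.filter fun x => m x = x).card := Finset.card_pos.2 ⟨i, by simpa⟩
    omega
  by_cases hj : m j = j
  · have e : (Finset.univ.filter fun x => joinMate m i j x = x)
        = insert (m i) ((Finset.univ.filter fun x => m x = x).erase j) := by
      ext x
      simp only [joinMate, Finset.mem_filter, Finset.mem_univ, true_and, Finset.mem_insert,
        Finset.mem_erase]
      grind
    rw [e, Finset.card_insert_of_notMem (by simp; grind), Finset.card_erase_of_mem (by simpa)]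
    have : 0 < (Finset.univ.filter fun x => m x = x).card := Finset.card_pos.2 ⟨j, by simpa⟩
    omega
  · congr 1
    ext x
    simp only [joinMate, Finset.mem_filter, Finset.mem_univ, true_and]
    grind

theorem joinMate_zigzag {n : ℕ} (m : Fin n → Fin n) (hm : ∀ x, m (m x) = x) (i j k : Fin n)
    (hij : i ≠ j) (hjk : j ≠ k) (hik : i ≠ k) (h : m i = j) :
    joinMate (joinMate m j k) i j = m := by
  funext x
  simp only [joinMate]
  grind

theorem joinMate_comm {α : Type} [DecidableEq α] (m : α → α) (hm : ∀ x, m (m x) = x) (i j k l : α)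
    (hij : i ≠ j) (hkl : k ≠ l) (hik : i ≠ k) (hil : i ≠ l) (hjk : j ≠ k) (hjl : j ≠ l)
    (h1 : m i ≠ j) (h2 : ¬ (m i = i ∧ m j = j)) (_h3 : m k ≠ l) (h4 : ¬ (m k = k ∧ m l = l))
    (h5 : ¬ (joinMate m i j k = k ∧ joinMate m i j l = l)) (h6 : joinMate m i j k ≠ l) :
    joinMate (joinMate m i j) k l = joinMate (joinMate m k l) i j := by
  funext x
  by_cases hi : m i = i <;> by_cases hj : m j = j <;> by_cases hk : m k = k <;> by_cases hl : m l = l <;>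
  by_cases e1 : m i = k <;> by_cases e2 : m i = l <;> by_cases e3 : m j = k <;> by_cases e4 : m j = l <;>
  simp only [joinMate] at * <;>
  grind (splits := 20)
theorem joinMate_loop {α : Type} [DecidableEq α] (m : α → α) (hm : ∀ x, m (m x) = x)
    (i j k l : α)
    (hkl : k ≠ l) (hik : i ≠ k) (hil : i ≠ l) (hjk : j ≠ k) (hjl : j ≠ l)
    (h3 : m k ≠ l) (h5 : joinMate m i j k = l) :
    joinMate m i j = joinMate m k l := by
  have h : (m i = k ∧ m j = l) ∨ (m i = l ∧ m j = k) := by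
    simp only [joinMate] at h5
    grind
  funext x
  simp only [joinMate]
  grind (splits := 20)

set_option maxHeartbeats 4000000 in
theorem joinMate_planar {n : ℕ} (m : Fin n → Fin n) (hm : ∀ x, m (m x) = x) (i j : Fin n) (hij : (i : ℕ) + 1 = j)
   (h1 : m i ≠ j) (h2 : ¬ (m i = i ∧ m j = j))
   (noncrossing : ∀ a b, a < b → b < m a → a < m b ∧ m b < m a)
  (exposed : ∀ a b, a < b → b < m a → m b ≠ b) (a b : Fin n) (hab : a < b) (hb : b < joinMate m i j a) :
  a < joinMate m i j b ∧ joinMate m i j b < joinMate m i j a ∧ joinMate m i j b ≠ b := by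
  have hij' : i ≠ j := by intro h; subst h; omega
  have h3 := noncrossing a b
  have h3' := noncrossing b a
  have h4 := noncrossing i b
  have h5 := noncrossing j b
  have h6 := noncrossing (m i) b
  have h7 := noncrossing (m j) b
  have h4' := noncrossing i a
  have h5' := noncrossing j a
  have h6' := noncrossing (m i) a
  have h7' := noncrossing (m j) a
  have h8 := noncrossing i j
  have h9 := noncrossing (m i) j
  have h10 := noncrossing (m j) i
  have k4 := exposed (m i) j
  have k5 := exposed (m j) i
  have k6 := exposed j i
  have k7 := exposed i j
  have l1 := exposed a b
  have l2 := exposed i b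
  have l3 := exposed j b
  have l4 := exposed (m i) b
  have l5 := exposed (m j) b
  have := hm a
  have := hm b
  have := hm i
  have := hm j
  have : m a = m b → a = b := by grind
  have : m a = m i → a = i := by grind
  have : m a = m j → a = j := by grind
  have : m i = m b → i = b := by grind
  have : m j = m b → j = b := by grind
  have : m i = m j → i = j := by grind
  have d1 : m a = i → a = m i := by grind
  have d2 : m a = j → a = m j := by grind
  have d3 : m b = i → b = m i := by grind
  have d4 : m b = j → b = m j := by grind
  have p1 := noncrossing a i
  have p2 := noncrossing a j
  have p3 := noncrossing a (m i)
  have p4 := noncrossing a (m j)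
  have r1 := noncrossing (m i) (m b)
  have r2 := noncrossing j (m b)
  have r3 := noncrossing i (m b)
  have r4 := noncrossing (m j) (m b)
  have q1 := exposed a i
  have q2 := exposed a j
  clear noncrossing exposed hm
  have va : joinMate m i j a = if a = i then j
  else if a = j then i
  else if a = m i then (if m j = j then a else m j)
  else if a = m j then (if m i = i then a else m i)
  else m a := rfl
  have vb : joinMate m i j b = if b = i then j
  else if b = j then i
  else if b = m i then (if m j = j then b else m j)
  else if b = m j then (if m i = i then b else m i)
  else m b := rfl
  rw [va] at hb ⊢
  rw [vb]
  clear va vb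
  have c1 : a = i → m a = m i := by rintro rfl; rfl
  have c2 : a = j → m a = m j := by rintro rfl; rfl
  have c3 : b = i → m b = m i := by rintro rfl; rfl
  have c4 : b = j → m b = m j := by rintro rfl; rfl
  have c5 : a = m i → m a = i := by rintro rfl; assumption
  have c6 : a = m j → m a = j := by rintro rfl; assumption
  have c7 : b = m i → m b = i := by rintro rfl; assumption
  have c8 : b = m j → m b = j := by rintro rfl; assumption
  simp only [*] at h6 h7 h6' h7' h9 h10 k4 k5 l4 l5 p3 p4 r1 r2 r3 r4
  generalize m a = ma at *
  generalize m b = mb at *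
  generalize m i = mi at *
  generalize m j = mj at *
  split_ifs at hb ⊢ <;> grind (splits := 30)

/-- The link state with a new cup at the neighbouring points `i`, `j`. -/
def LinkState.join {n p : ℕ} (w : LinkState n p) (i j : Fin n) (hij : (i : ℕ) + 1 = j)
    (h1 : w.mate i ≠ j) (h2 : ¬ (w.mate i = i ∧ w.mate j = j)) : LinkState n p where
  mate := joinMate w.mate i j
  mate_mate := by
    intro x
    have := w.mate_mate
    simp only [joinMate]
    grind
  noncrossing := fun a b hab hb =>
    have h := joinMate_planar w.mate w.mate_mate i j hij h1 h2 w.noncrossing w.exposed a b hab hb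
    ⟨h.1, h.2.1⟩
  exposed := fun a b hab hb =>
    (joinMate_planar w.mate w.mate_mate i j hij h1 h2 w.noncrossing w.exposed a b hab hb).2.2
  card_through := by
    rw [joinMate_card w.mate w.mate_mate i j (by intro h; subst h; omega) h1 h2]
    exact w.card_through

/-- The standard representation `V_{n,p}` of `TL_n(δ)`: the vector space with basis the
`(n, p)`-link states. -/
def Std (_δ : ℂ) (n p : ℕ) : Type := LinkState n p →₀ ℂ

noncomputable instance (δ : ℂ) (n p : ℕ) : AddCommGroup (Std δ n p) :=
  inferInstanceAs (AddCommGroup (LinkState n p →₀ ℂ))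

noncomputable instance (δ : ℂ) (n p : ℕ) : Module ℂ (Std δ n p) :=
  inferInstanceAs (Module ℂ (LinkState n p →₀ ℂ))

instance (δ : ℂ) (n p : ℕ) : Module.Finite ℂ (Std δ n p) :=
  inferInstanceAs (Module.Finite ℂ (LinkState n p →₀ ℂ))

/-- The basis vector of `V_{n,p}` given by a link state. -/
noncomputable def Std.ofLink (δ : ℂ) {n p : ℕ} (w : LinkState n p) : Std δ n p :=
  Finsupp.single w 1

/-- The result of stacking the cup-cap diagram on the neighbouring points `i`, `j` on a link state:
a closed circle gives the factor `δ`, and joining two through strands gives `0`. -/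
noncomputable def stack (δ : ℂ) {n p : ℕ} (i j : Fin n) (hij : (i : ℕ) + 1 = j)
    (w : LinkState n p) : Std δ n p :=
  if h1 : w.mate i = j then δ • Std.ofLink δ w
  else if h2 : w.mate i = i ∧ w.mate j = j then 0
  else Std.ofLink δ (w.join i j hij h1 h2)

/-- The linear extension of `stack`. -/
noncomputable def stackOp (δ : ℂ) {n : ℕ} (p : ℕ) (i j : Fin n) (hij : (i : ℕ) + 1 = j) :
    Std δ n p →ₗ[ℂ] Std δ n p :=
  Finsupp.linearCombination ℂ (stack δ i j hij)

theorem stackOp_ofLink (δ : ℂ) {n p : ℕ} (i j : Fin n) (hij : (i : ℕ) + 1 = j)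
    (w : LinkState n p) : stackOp δ p i j hij (Std.ofLink δ w) = stack δ i j hij w := by
  simp only [stackOp, Std.ofLink]
  erw [Finsupp.linearCombination_single]
  exact one_smul _ _

theorem Std.hom_ext {δ : ℂ} {n p : ℕ} {f g : Std δ n p →ₗ[ℂ] Std δ n p}
    (h : ∀ w, f (Std.ofLink δ w) = g (Std.ofLink δ w)) : f = g :=
  Finsupp.lhom_ext' (M := ℂ) (R := ℂ) fun w => LinearMap.ext_ring (h w)

theorem stack_mate (δ : ℂ) {n p : ℕ} (i j : Fin n) (hij : (i : ℕ) + 1 = j)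
    (w : LinkState n p) (h : w.mate i = j) : stack δ i j hij w = δ • Std.ofLink δ w := by
  simp [stack, h]

theorem stack_through (δ : ℂ) {n p : ℕ} (i j : Fin n) (hij : (i : ℕ) + 1 = j)
    (w : LinkState n p) (h : w.mate i = i ∧ w.mate j = j) : stack δ i j hij w = 0 := by
  have h1 : w.mate i ≠ j := by
    rw [h.1]; intro e; simp only [Fin.ext_iff] at e; omega
  rw [stack, dif_neg h1, dif_pos h]

theorem stack_join (δ : ℂ) {n p : ℕ} (i j : Fin n) (hij : (i : ℕ) + 1 = j)
    (w : LinkState n p) (h1 : w.mate i ≠ j) (h2 : ¬ (w.mate i = i ∧ w.mate j = j)) :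
    stack δ i j hij w = Std.ofLink δ (w.join i j hij h1 h2) := by
  rw [stack, dif_neg h1, dif_neg h2]

theorem stackOp_sq (δ : ℂ) {n : ℕ} (p : ℕ) (i j : Fin n) (hij : (i : ℕ) + 1 = j) :
    stackOp δ p i j hij * stackOp δ p i j hij = δ • stackOp δ p i j hij := by
  refine Std.hom_ext fun w => ?_
  rw [Module.End.mul_apply, LinearMap.smul_apply, stackOp_ofLink]
  by_cases h1 : w.mate i = j
  · rw [stack_mate δ i j hij w h1, map_smul, stackOp_ofLink, stack_mate δ i j hij w h1]
  by_cases h2 : w.mate i = i ∧ w.mate j = j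
  · simp [stack_through δ i j hij w h2]
  · have e : stack δ i j hij w = Std.ofLink δ (w.join i j hij h1 h2) := by simp [stack, h1, h2]
    rw [e, stackOp_ofLink, stack_mate]
    simp [LinkState.join, joinMate]

/-- `stackOp` on two neighbouring points that share one point with a cup of `w`. -/
theorem stack_zigzag_aux (δ : ℂ) {n p : ℕ} (i j k l : Fin n) (hij : (i : ℕ) + 1 = j)
    (hkl : (k : ℕ) + 1 = l) (h : j = k ∨ l = i) (w : LinkState n p) (hw : w.mate i = j) :
    stackOp δ p i j hij (stackOp δ p k l hkl (Std.ofLink δ w)) = Std.ofLink δ w := by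
  have hm := w.mate_mate
  have hji : w.mate j = i := by rw [← hw, hm]
  have hne : i ≠ j ∧ k ≠ l ∧ ¬ (i = k ∧ j = l) ∧ ¬ (i = l ∧ j = k) := by
    refine ⟨?_, ?_, ?_, ?_⟩ <;> intro h <;> simp only [Fin.ext_iff] at h <;> omega
  have h1 : w.mate k ≠ l := by grind
  have h2 : ¬ (w.mate k = k ∧ w.mate l = l) := by grind
  have e : stack δ k l hkl w = Std.ofLink δ (w.join k l hkl h1 h2) := by simp [stack, h1, h2]
  have h3 : (w.join k l hkl h1 h2).mate i ≠ j := by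
    simp only [LinkState.join, joinMate]; grind
  have h4 : ¬ ((w.join k l hkl h1 h2).mate i = i ∧ (w.join k l hkl h1 h2).mate j = j) := by
    simp only [LinkState.join, joinMate]; grind
  have e2 : stack δ i j hij (w.join k l hkl h1 h2)
      = Std.ofLink δ ((w.join k l hkl h1 h2).join i j hij h3 h4) := by
    simp only [stack, h3, h4, dite_false]
  rw [stackOp_ofLink, e, stackOp_ofLink, e2]
  congr 1
  ext x : 2
  simp only [LinkState.join, joinMate]
  grind

theorem stackOp_zigzag (δ : ℂ) {n : ℕ} (p : ℕ) (i j k l : Fin n) (hij : (i : ℕ) + 1 = j)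
    (hkl : (k : ℕ) + 1 = l) (h : j = k ∨ l = i) :
    stackOp δ p i j hij * stackOp δ p k l hkl * stackOp δ p i j hij = stackOp δ p i j hij := by
  refine Std.hom_ext fun w => ?_
  rw [Module.End.mul_apply, Module.End.mul_apply, stackOp_ofLink]
  by_cases h1 : w.mate i = j
  · rw [stack_mate δ i j hij w h1, map_smul, map_smul, stack_zigzag_aux δ i j k l hij hkl h w h1]
  by_cases h2 : w.mate i = i ∧ w.mate j = j
  · simp [stack_through δ i j hij w h2]
  · have e : stack δ i j hij w = Std.ofLink δ (w.join i j hij h1 h2) := by simp [stack, h1, h2]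
    rw [e, stack_zigzag_aux δ i j k l hij hkl h]
    simp [LinkState.join, joinMate]

theorem stack_comm_aux (δ : ℂ) {n p : ℕ} (i j k l : Fin n) (hij : (i : ℕ) + 1 = j)
    (hkl : (k : ℕ) + 1 = l) (hik : i ≠ k) (hil : i ≠ l) (hjk : j ≠ k) (hjl : j ≠ l)
    (w : LinkState n p) (h : w.mate i = j ∨ (w.mate i = i ∧ w.mate j = j)) :
    stackOp δ p i j hij (stack δ k l hkl w) = stackOp δ p k l hkl (stack δ i j hij w) := by
  have hm := w.mate_mate
  have nij : i ≠ j := by intro h; simp only [Fin.ext_iff] at h; omega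
  by_cases h3 : w.mate k = l
  · rw [stack_mate δ k l hkl w h3, map_smul, stackOp_ofLink]
    rcases h with h | h
    · rw [stack_mate δ i j hij w h, map_smul, stackOp_ofLink, stack_mate δ k l hkl w h3]
    · rw [stack_through δ i j hij w h, map_zero, smul_zero]
  by_cases h4 : w.mate k = k ∧ w.mate l = l
  · rw [stack_through δ k l hkl w h4, map_zero]
    rcases h with h | h
    · rw [stack_mate δ i j hij w h, map_smul, stackOp_ofLink, stack_through δ k l hkl w h4,
        smul_zero]
    · rw [stack_through δ i j hij w h, map_zero]
  · rw [stack_join δ k l hkl w h3 h4, stackOp_ofLink]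
    rcases h with h | h
    · rw [stack_mate δ i j hij w h, map_smul, stackOp_ofLink, stack_join δ k l hkl w h3 h4,
        stack_mate]
      simp only [LinkState.join, joinMate]
      grind
    · rw [stack_through δ i j hij w h, map_zero, stack_through]
      simp only [LinkState.join, joinMate]
      grind

theorem stackOp_comm (δ : ℂ) {n : ℕ} (p : ℕ) (i j k l : Fin n) (hij : (i : ℕ) + 1 = j)
    (hkl : (k : ℕ) + 1 = l) (hik : i ≠ k) (hil : i ≠ l) (hjk : j ≠ k) (hjl : j ≠ l) :
    stackOp δ p i j hij * stackOp δ p k l hkl = stackOp δ p k l hkl * stackOp δ p i j hij := by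
  have nij : i ≠ j := by intro h; simp only [Fin.ext_iff] at h; omega
  have nkl : k ≠ l := by intro h; simp only [Fin.ext_iff] at h; omega
  refine Std.hom_ext fun w => ?_
  have hm := w.mate_mate
  rw [Module.End.mul_apply, Module.End.mul_apply, stackOp_ofLink, stackOp_ofLink]
  by_cases h1 : w.mate i = j ∨ (w.mate i = i ∧ w.mate j = j)
  · exact stack_comm_aux δ i j k l hij hkl hik hil hjk hjl w h1
  by_cases h3 : w.mate k = l ∨ (w.mate k = k ∧ w.mate l = l)
  · exact (stack_comm_aux δ k l i j hkl hij hik.symm hjk.symm hil.symm hjl.symm w h3).symm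
  obtain ⟨h1, h2⟩ := not_or.1 h1
  obtain ⟨h3, h4⟩ := not_or.1 h3
  rw [stack_join δ i j hij w h1 h2, stack_join δ k l hkl w h3 h4, stackOp_ofLink, stackOp_ofLink]
  by_cases h5 : joinMate w.mate i j k = l
  · have h6 : joinMate w.mate k l i = j := by
      simp only [joinMate] at h5 ⊢; grind
    rw [stack_mate δ i j hij _ h6, stack_mate δ k l hkl _ h5]
    congr 2
    exact LinkState.ext (joinMate_loop w.mate hm i j k l nkl hik hil hjk hjl h3 h5).symm
  by_cases h7 : joinMate w.mate i j k = k ∧ joinMate w.mate i j l = l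
  · have h8 : joinMate w.mate k l i = i ∧ joinMate w.mate k l j = j := by
      simp only [joinMate] at h7 ⊢; grind
    rw [stack_through δ i j hij _ h8, stack_through δ k l hkl _ h7]
  · have h6 : joinMate w.mate k l i ≠ j := by
      simp only [joinMate] at h5 ⊢; grind
    have h8 : ¬ (joinMate w.mate k l i = i ∧ joinMate w.mate k l j = j) := by
      simp only [joinMate] at h7 ⊢; grind
    rw [stack_join δ i j hij _ h6 h8, stack_join δ k l hkl _ h5 h7]
    congr 1
    exact LinkState.ext
      (joinMate_comm w.mate hm i j k l nij nkl hik hil hjk hjl h1 h2 h3 h4 h7 h5).symm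

/-- The representation of `TL_n(δ)` on `V_{n,p}`: the generator `e i` acts by stacking its diagram
on link states. -/
noncomputable def stdRep (δ : ℂ) (n p : ℕ) : TL δ n →ₐ[ℂ] Module.End ℂ (Std δ n p) :=
  liftHom (fun i => stackOp δ p ⟨i, Nat.lt_of_succ_lt i.2⟩ ⟨i + 1, i.2⟩ rfl)
    (fun _ => stackOp_sq _ _ _ _ _)
    (fun i j h => stackOp_zigzag _ _ _ _ _ _ _ _ (by
      rcases h with h | h
      · left; simp [h]
      · right; simp [h]))
    (fun i j h => stackOp_comm _ _ _ _ _ _ _ _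
      (by simp only [ne_eq, Fin.mk.injEq]; omega) (by simp only [ne_eq, Fin.mk.injEq]; omega)
      (by simp only [ne_eq, Fin.mk.injEq]; omega) (by simp only [ne_eq, Fin.mk.injEq]; omega))

noncomputable instance (δ : ℂ) (n p : ℕ) : Module (TL δ n) (Std δ n p) :=
  Module.compHom (Std δ n p) (stdRep δ n p).toRingHom

theorem smul_std (δ : ℂ) (n p : ℕ) (a : TL δ n) (v : Std δ n p) : a • v = stdRep δ n p a v := rfl

instance (δ : ℂ) (n p : ℕ) : IsScalarTower ℂ (TL δ n) (Std δ n p) where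
  smul_assoc c a v := by rw [smul_std, smul_std, map_smul, LinearMap.smul_apply]

/-- `L_{n,p}`, the irreducible quotient of `V_{n,p}`: the quotient by the radical of `V_{n,p}`, that
is by the intersection of its maximal submodules. -/
abbrev Irr (δ : ℂ) (n p : ℕ) : Type :=
  Std δ n p ⧸ Module.jacobson (TL δ n) (Std δ n p)

/-! ### Traces -/

/-- The (unnormalized) trace of a representation `M` of `A`, that is `a ↦ tr(a | M)`. -/
noncomputable def repTrace (A M : Type) [Ring A] [Algebra ℂ A] [AddCommGroup M] [Module ℂ M]
    [Module A M] [IsScalarTower ℂ A M] : A →ₗ[ℂ] ℂ :=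
  LinearMap.trace ℂ M ∘ₗ (Algebra.lsmul ℂ ℂ M : A →ₐ[ℂ] Module.End ℂ M).toLinearMap

/-- A normalized trace on an algebra. -/
def IsNormalizedTrace {A : Type} [Ring A] [Algebra ℂ A] (χ : A →ₗ[ℂ] ℂ) : Prop :=
  (∀ a b, χ (a * b) = χ (b * a)) ∧ χ 1 = 1

/-- `c` is the system of coefficients of `χ` with respect to the traces `t_{n,i}` of the standard
representations: `χ` restricts to `∑ i, c n i • t_{n,i}` on every `TL_n`, and `c` is compatible with
the restriction rule `t_{n+1,i} ↦ t_{n,i-1} + t_{n,i}`. (The second condition only matters for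
`δ = 0` and `n` even, where the `t_{n,i}` are linearly dependent.) -/
def IsStdCoeffs {δ : ℂ} (χ : TLInf δ →ₗ[ℂ] ℂ) (c : ℕ → ℕ → ℂ) : Prop :=
  (∀ n i, n < 2 * i → c n i = 0) ∧
  (∀ n i, 2 * i ≤ n → c n i = c (n + 1) i + c (n + 1) (i + 1)) ∧
  ∀ n, ∀ a : TL δ n, χ (toInf δ n a) =
    ∑ i ∈ Finset.range (n / 2 + 1), c n i * repTrace (TL δ n) (Std δ n i) a

/-- The pairs `(n, i)` that label the irreducible representations `L_{n,i}` of `TL_n(δ)`; for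
`δ = 0` there is no `L_{n,i}` with `n = 2 i`. -/
def IsIrrLabel (δ : ℂ) (n i : ℕ) : Prop := 2 * i ≤ n ∧ (δ = 0 → 2 * i ≠ n)

/-- `lam` is the system of coefficients of `χ` with respect to the traces `l_{n,i}` of the
irreducible representations: `χ` restricts to `∑ i, lam n i • l_{n,i}` on every `TL_n`. Coefficients
without a corresponding `L_{n,i}` are zero, and for `δ = 0`, where by convention there is no
`L_{0,0}`, the expansion is for `n ≥ 1`. -/
def IsIrrCoeffs {δ : ℂ} (χ : TLInf δ →ₗ[ℂ] ℂ) (lam : ℕ → ℕ → ℂ) : Prop :=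
  (∀ n i, ¬ IsIrrLabel δ n i → lam n i = 0) ∧
  ∀ n, (δ = 0 → n ≠ 0) → ∀ a : TL δ n, χ (toInf δ n a) =
    ∑ i ∈ Finset.range (n / 2 + 1), lam n i * repTrace (TL δ n) (Irr δ n i) a

/-- The normalized traces on `TL_∞(δ)` with nonnegative coefficients with respect to the traces of
the standard representations. -/
def positiveTraces (δ : ℂ) : Set (TLInf δ →ₗ[ℂ] ℂ) :=
  {χ | IsNormalizedTrace χ ∧
    ∃ c : ℕ → ℕ → ℝ, IsStdCoeffs χ (fun n i => (c n i : ℂ)) ∧ ∀ n i, 0 ≤ c n i}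

/-- Extremal traces: the normalized traces with nonnegative standard coefficients that are not a
proper convex combination of other such traces. -/
def IsExtremal {δ : ℂ} (χ : TLInf δ →ₗ[ℂ] ℂ) : Prop :=
  χ ∈ Set.extremePoints ℝ (positiveTraces δ)

/-- Multiplicative traces: `a_{n,i} ↦ c_{n,i}` is a ring homomorphism on the graded algebra of the
Bratteli diagram, with basis `a_{n,i}`, `2 i ≤ n`, and product
`a_{n,i} a_{m,j} = ∑ k ≤ min (n - 2 i) (m - 2 j), a_{n+m,i+j+k}`. -/
def IsMultiplicative {δ : ℂ} (χ : TLInf δ →ₗ[ℂ] ℂ) : Prop :=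
  IsNormalizedTrace χ ∧ ∃ c : ℕ → ℕ → ℂ, IsStdCoeffs χ c ∧
    ∀ n i m j, 2 * i ≤ n → 2 * j ≤ m → c n i * c m j =
      ∑ k ∈ Finset.range (min (n - 2 * i) (m - 2 * j) + 1), c (n + m) (i + j + k)

/-! ### Combinatorial data -/

/-- The quantum integer `[n]_r = (r ^ n - r ^ (-n)) / (r - r⁻¹)`, through its recursion, which also
gives the right value at `r = ±1`. -/
noncomputable def qint (r : ℂ) : ℕ → ℂ
  | 0 => 0
  | 1 => 1
  | n + 2 => (r + r⁻¹) * qint r (n + 1) - qint r n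

/-- The pair `(n, p)` is critical for `l` if `n - 2 p + 1 = k l` for some `k > 0`. -/
def IsCritical (l n p : ℕ) : Prop := ∃ k : ℕ, 0 < k ∧ (n : ℤ) - 2 * p + 1 = k * l

end TemperleyLieb

/-! Two facts carry the theorem.

The first is `c (n + 2) (i + 1) = γ * c n i`. For a multiplicative trace it is the product rule for
`a_{n,i}` and `a_{2,1}`. For an extremal trace, consider the functional `x ↦ χ (e 0 * x' * e 1)`,
with `x'` the element `x` moved by two strands. Its standard coefficients are `c (n + 2) (i + 1)`
(`IsStdCoeffs.cupTrace`), and both it and its difference from `χ` have nonnegative coefficients. So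
`χ` is a convex combination of their normalizations when `γ > 0`, and extremality makes the
functional equal to `γ χ`; for `γ = 0` positivity makes all these coefficients vanish. With the
restriction rule, `c n i = γ ^ i * c (n - 2 i) 0` and `c (n + 2) 0 = c (n + 1) 0 - γ * c n 0`, a
recursion solved by rescaled quantum integers (`exists_qint`).

The second is the structure of `V_{n,i}`: with `g = gap l (n - 2 i)`, its radical is `L_{n,i-g}` if
`0 < g ≤ i` and zero otherwise (`radical_all`, `exists_equiv_rad`). Hence `L_{n,k}` occurs in
`V_{n,k}` and, apart from that, only in `V_{n,k+j}` with `j = (n - 2 k + 1) % l`, and `λ_{n,k} =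
c_{n,k} + c_{n,k+j}` where the second term exists.

For this structure, `V_{n,p}` is embedded in `(ℂ²)^{⊗n}` by `toTensor`. The coordinate dot product
pulls back to an invariant form, and every submodule outside its radical is everything
(`eq_top_of_not_le_rad`), so that this radical is the Jacobson radical whenever it is proper.
Vectors killed by all generators become multiples of a `q`-symmetric tensor whose square norm is a
Gaussian binomial coefficient at a root of unity; outside small cases such vectors lie in the
radical, so the coefficient must vanish. This locates the trivial subquotients. Restriction by one
strand and insertion of a cup then give vanishing or simplicity of the radicals by simultaneous
induction on `n`. Powers of the quantum group lowering operator, which commute with the generators,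
provide homomorphisms `V_{n,i-g} → V_{n,i}` onto the radical.

The case `δ = 0` is included because division by `δ` is mostly replaced by `e 0 e 1`, which fixes
every vector with a cup in front. Only `n = 2 i` needs care: there `V_{n,i}` is its own radical for
`i > 0`, and the standard coefficients are recovered from `n + 1`. Uniqueness comes from elements on
which the traces are triangular (`exists_test`). -/

namespace TemperleyLieb

/-! ### Surgery of link states at the first point -/

namespace LinkState

/-- Add a through strand in front. -/
def addThrough {n p : ℕ} (w : LinkState n p) : LinkState (n + 1) p where
  mate := Fin.cases 0 fun x => (w.mate x).succ
  mate_mate x := by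
    cases x using Fin.cases with
    | zero => rfl
    | succ x => simp [w.mate_mate]
  noncrossing a b hab hb := by
    cases a using Fin.cases with
    | zero => simp at hb
    | succ a =>
      cases b using Fin.cases with
      | zero => simp at hab
      | succ b =>
        simp only [Fin.cases_succ, Fin.succ_lt_succ_iff] at *
        exact w.noncrossing a b hab hb
  exposed a b hab hb := by
    cases a using Fin.cases with
    | zero => simp at hb
    | succ a =>
      cases b using Fin.cases with
      | zero => simp at hab
      | succ b =>
        simp only [Fin.cases_succ, Fin.succ_lt_succ_iff, ne_eq, Fin.succ_inj] at *
        exact w.exposed a b hab hb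
  card_through := by
    rw [Fin.card_filter_univ_succ]
    simp only [Fin.cases_zero, Fin.cases_succ, Fin.succ_inj, if_true]
    have := w.card_through
    omega

/-- Close the first through strand `y` of a link state by a cup that starts at a new first point. -/
def close {n p : ℕ} (w : LinkState n p) (y : Fin n) (hy : w.mate y = y)
    (hmin : ∀ x < y, w.mate x ≠ x) : LinkState (n + 1) (p + 1) where
  mate := Fin.cases y.succ fun x => if x = y then 0 else (w.mate x).succ
  mate_mate x := by
    have := w.mate_mate
    cases x using Fin.cases with
    | zero => simp
    | succ x =>
      by_cases h : x = y
      · simp [h]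
      · have : w.mate x ≠ y := by grind
        simp [h, this, w.mate_mate]
  noncrossing a b hab hb := by
    have hm := w.mate_mate
    have h1 := w.noncrossing
    have h2 := w.exposed
    cases a using Fin.cases with
    | zero =>
      cases b using Fin.cases with
      | zero => simp at hab
      | succ b =>
        simp only [Fin.cases_succ, Fin.cases_zero, Fin.succ_lt_succ_iff] at *
        have hby : b ≠ y := by grind
        have := h2 b y
        have h3 : w.mate b ≠ y := by grind
        simp only [hby, if_false, Fin.succ_lt_succ_iff, Fin.succ_pos, true_and]
        grind
    | succ a =>
      cases b using Fin.cases with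
      | zero => simp at hab
      | succ b =>
        simp only [Fin.cases_succ, Fin.succ_lt_succ_iff] at *
        by_cases ha : a = y
        · simp [ha] at hb
        · simp only [ha, if_false, Fin.succ_lt_succ_iff] at *
          have hby : b ≠ y := by
            rintro rfl
            exact h2 a b hab hb hy
          simp only [hby, if_false, Fin.succ_lt_succ_iff]
          exact h1 a b hab hb
  exposed a b hab hb := by
    cases a using Fin.cases with
    | zero =>
      cases b using Fin.cases with
      | zero => simp at hab
      | succ b =>
        simp only [Fin.cases_succ, Fin.cases_zero, Fin.succ_lt_succ_iff] at *
        have hby : b ≠ y := by grind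
        simp only [hby, if_false, ne_eq, Fin.succ_inj]
        exact hmin b hb
    | succ a =>
      cases b using Fin.cases with
      | zero => simp at hab
      | succ b =>
        simp only [Fin.cases_succ, Fin.succ_lt_succ_iff] at *
        by_cases ha : a = y
        · simp [ha] at hb
        · simp only [ha, if_false, Fin.succ_lt_succ_iff] at *
          have hby : b ≠ y := by
            rintro rfl
            exact w.exposed a b hab hb hy
          simp only [hby, if_false, ne_eq, Fin.succ_inj]
          exact w.exposed a b hab hb
  card_through := by
    rw [Fin.card_filter_univ_succ]
    simp only [Fin.cases_zero, Fin.cases_succ, Fin.succ_ne_zero, if_false]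
    have e : (Finset.univ.filter fun x => (if x = y then 0 else (w.mate x).succ) = x.succ)
        = (Finset.univ.filter fun x => w.mate x = x).erase y := by
      ext x
      by_cases h : x = y
      · simp [h, eq_comm, Fin.succ_ne_zero]
      · simp [h]
    change (Finset.univ.filter fun x => (if x = y then (0 : Fin (n + 1)) else (w.mate x).succ)
      = x.succ).card + 2 * (p + 1) = n + 1
    rw [e, Finset.card_erase_of_mem (by simpa)]
    have h0 : 0 < (Finset.univ.filter fun x => w.mate x = x).card :=
      Finset.card_pos.2 ⟨y, by simpa⟩
    have := w.card_through
    omega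

theorem close_zero_ne {n p : ℕ} (w : LinkState n p) (y : Fin n) (hy : w.mate y = y)
    (hmin : ∀ x < y, w.mate x ≠ x) : (w.close y hy hmin).mate 0 ≠ 0 := Fin.succ_ne_zero y

/-- The mates after removal of the first point; a cup at the first point becomes a through
strand. -/
def dropMate {n : ℕ} (m : Fin (n + 1) → Fin (n + 1)) (x : Fin n) : Fin n :=
  if h : m x.succ = 0 then x else (m x.succ).pred h

theorem dropMate_eq {n : ℕ} {m : Fin (n + 1) → Fin (n + 1)} {x : Fin n} (h : m x.succ = 0) :
    dropMate m x = x := by simp [dropMate, h]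

theorem succ_dropMate {n : ℕ} {m : Fin (n + 1) → Fin (n + 1)} {x : Fin n} (h : m x.succ ≠ 0) :
    (dropMate m x).succ = m x.succ := by simp [dropMate, h]

/-- Remove the first point. -/
def dropFirst {n p p' : ℕ} (w : LinkState (n + 1) p)
    (hc : (Finset.univ.filter fun x => dropMate w.mate x = x).card + 2 * p' = n) :
    LinkState n p' where
  mate := dropMate w.mate
  mate_mate x := by
    by_cases h : w.mate x.succ = 0
    · rw [dropMate_eq h, dropMate_eq h]
    · apply Fin.succ_injective
      have h1 := succ_dropMate h
      have h2 : w.mate (dropMate w.mate x).succ ≠ 0 := by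
        rw [h1, w.mate_mate]; exact Fin.succ_ne_zero x
      rw [succ_dropMate h2, h1, w.mate_mate]
  noncrossing a b hab hb := by
    by_cases h : w.mate a.succ = 0
    · rw [dropMate_eq h] at hb
      exact absurd (hab.trans hb) (lt_irrefl _)
    · have h1 := succ_dropMate h
      have h2 := w.noncrossing a.succ b.succ (by simpa using hab) (by rw [← h1]; simpa using hb)
      by_cases h' : w.mate b.succ = 0
      · rw [h'] at h2; simp at h2
      · rw [← succ_dropMate h', ← h1] at h2
        simpa using h2
  exposed a b hab hb := by
    by_cases h : w.mate a.succ = 0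
    · rw [dropMate_eq h] at hb
      exact absurd (hab.trans hb) (lt_irrefl _)
    · have h1 := succ_dropMate h
      have h2 := w.noncrossing a.succ b.succ (by simpa using hab) (by rw [← h1]; simpa using hb)
      have h3 := w.exposed a.succ b.succ (by simpa using hab) (by rw [← h1]; simpa using hb)
      by_cases h' : w.mate b.succ = 0
      · rw [h'] at h2; simp at h2
      · rw [← succ_dropMate h'] at h3
        simpa using h3
  card_through := hc

theorem dropMate_iff {n p : ℕ} (w : LinkState (n + 1) p) (x : Fin n) :
    dropMate w.mate x = x ↔ w.mate x.succ = 0 ∨ w.mate x.succ = x.succ := by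
  by_cases h : w.mate x.succ = 0
  · simp [dropMate_eq h, h]
  · rw [← (Fin.succ_injective n).eq_iff, succ_dropMate h]
    simp [h]

/-- Remove a through strand in front. -/
def tail {n p : ℕ} (w : LinkState (n + 1) p) (h : w.mate 0 = 0) : LinkState n p :=
  w.dropFirst (by
    have := w.card_through
    rw [Fin.card_filter_univ_succ, if_pos h] at this
    have e : (Finset.univ.filter fun x => dropMate w.mate x = x)
        = Finset.univ.filter fun x : Fin n => w.mate x.succ = x.succ := by
      ext x
      simp only [dropMate_iff, Finset.mem_filter, Finset.mem_univ, true_and,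
        or_iff_right_iff_imp]
      intro h'
      have := w.mate_mate x.succ
      rw [h', h] at this
      exact absurd this.symm (Fin.succ_ne_zero x)
    rw [e]
    replace this : (Finset.univ.filter fun x : Fin n => w.mate x.succ = x.succ).card + 1 + 2 * p
      = n + 1 := this
    omega)

/-- Remove the first point, if it starts a cup. -/
def openFirst {n p : ℕ} (w : LinkState (n + 1) (p + 1)) (h : w.mate 0 ≠ 0) : LinkState n p :=
  w.dropFirst (by
    have := w.card_through
    rw [Fin.card_filter_univ_succ, if_neg h] at this
    have e : (Finset.univ.filter fun x => dropMate w.mate x = x)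
        = insert ((w.mate 0).pred h)
          (Finset.univ.filter fun x : Fin n => w.mate x.succ = x.succ) := by
      ext x
      simp only [dropMate_iff, Finset.mem_filter, Finset.mem_univ, true_and,
        Finset.mem_insert]
      have h1 : w.mate x.succ = 0 ↔ x = (w.mate 0).pred h := by
        rw [← (Fin.succ_injective n).eq_iff, Fin.succ_pred]
        have := w.mate_mate
        grind
      rw [h1]
    rw [e, Finset.card_insert_of_notMem]
    · replace this : (Finset.univ.filter fun x : Fin n => w.mate x.succ = x.succ).card
        + 2 * (p + 1) = n + 1 := this
      omega
    · simp only [Finset.mem_filter, Finset.mem_univ, true_and, Fin.succ_pred]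
      rw [w.mate_mate]
      exact h.symm)

theorem addThrough_tail {n p : ℕ} (w : LinkState (n + 1) p) (h : w.mate 0 = 0) :
    (w.tail h).addThrough = w := by
  ext x : 2
  cases x using Fin.cases with
  | zero => simp [addThrough, h]
  | succ x =>
    have h' : w.mate x.succ ≠ 0 := by
      intro h'
      have := w.mate_mate x.succ
      rw [h', h] at this
      exact absurd this.symm (Fin.succ_ne_zero x)
    simp only [addThrough, tail, dropFirst, Fin.cases_succ]
    exact succ_dropMate h'

theorem openFirst_close {n p : ℕ} (w : LinkState n p) (y : Fin n) (hy : w.mate y = y)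
    (hmin : ∀ x < y, w.mate x ≠ x) (h : (w.close y hy hmin).mate 0 ≠ 0) :
    (w.close y hy hmin).openFirst h = w := by
  ext x : 2
  by_cases hx : x = y
  · subst hx
    simp only [openFirst, dropFirst]
    rw [dropMate_eq, hy]
    simp [close]
  · apply Fin.succ_injective
    simp only [openFirst, dropFirst]
    rw [succ_dropMate]
    · simp [close, hx]
    · simp [close, hx]

/-- No through strand lies under a cup, so the far end of the opened cup becomes the first through
strand of the result. The result therefore determines this end, and the other mates are unchanged.
-/
theorem openFirst_injective {n p : ℕ} (w w' : LinkState (n + 1) (p + 1)) (h : w.mate 0 ≠ 0)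
    (h' : w'.mate 0 ≠ 0) (e : w.openFirst h = w'.openFirst h') : w = w' := by
  have key : ∀ (w w' : LinkState (n + 1) (p + 1)) (h : w.mate 0 ≠ 0) (h' : w'.mate 0 ≠ 0),
      w.openFirst h = w'.openFirst h' → w.mate 0 ≤ w'.mate 0 := by
    intro w w' h h' e
    by_contra! hlt
    have e1 : dropMate w.mate = dropMate w'.mate := congrArg LinkState.mate e
    have e2 := congrFun e1 ((w'.mate 0).pred h')
    rw [dropMate_eq (m := w'.mate) (by rw [Fin.succ_pred, w'.mate_mate])] at e2
    rw [dropMate_iff, Fin.succ_pred] at e2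
    have h0 : (0 : Fin (n + 1)) < w'.mate 0 := Fin.pos_of_ne_zero h'
    have h3 := w.exposed 0 (w'.mate 0) h0 hlt
    have h4 := w.noncrossing 0 (w'.mate 0) h0 hlt
    rcases e2 with e2 | e2
    · rw [e2] at h4; simp at h4
    · exact h3 e2
  have e0 : w.mate 0 = w'.mate 0 := le_antisymm (key _ _ h h' e) (key _ _ h' h e.symm)
  ext x : 2
  cases x using Fin.cases with
  | zero => exact e0
  | succ x =>
    have e1 : dropMate w.mate x = dropMate w'.mate x := congrFun (congrArg LinkState.mate e) x
    have m1 := w.mate_mate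
    have m2 := w'.mate_mate
    by_cases h1 : w.mate x.succ = 0
    · grind
    · have h2 : w'.mate x.succ ≠ 0 := by grind
      rw [← succ_dropMate h1, ← succ_dropMate h2, e1]

/-- Add a cup in front. -/
def addCup {n p : ℕ} (w : LinkState n p) : LinkState (n + 2) (p + 1) :=
  w.addThrough.close 0 rfl fun x hx => absurd hx (Fin.not_lt_zero x)

theorem addCup_zero {n p : ℕ} (w : LinkState n p) : w.addCup.mate 0 = 1 := rfl

theorem addCup_succ {n p : ℕ} (w : LinkState n p) (x : Fin n) :
    w.addCup.mate x.succ.succ = (w.mate x).succ.succ := rfl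

theorem exists_addCup {n p : ℕ} (w : LinkState (n + 2) (p + 1)) (h : w.mate 0 = 1) :
    ∃ v : LinkState n p, v.addCup = w := by
  have h0 : w.mate 0 ≠ 0 := by rw [h]; exact Fin.succ_ne_zero (0 : Fin (n + 1))
  have h1 : w.mate 1 = 0 := by rw [← h, w.mate_mate]
  have ht : (w.openFirst h0).mate 0 = 0 := by
    simp only [openFirst, dropFirst]
    exact dropMate_eq h1
  refine ⟨(w.openFirst h0).tail ht, openFirst_injective _ _ (by simp [addCup_zero]) h0 ?_⟩
  conv_lhs => simp only [addCup, openFirst_close, addThrough_tail]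

theorem two_mul_le {n p : ℕ} (w : LinkState n p) : 2 * p ≤ n := by
  have := w.card_through
  omega

theorem exists_through {n p : ℕ} (w : LinkState n p) (h : 2 * p < n) :
    ∃ y, w.mate y = y ∧ ∀ x < y, w.mate x ≠ x := by
  have hc := w.card_through
  have : (Finset.univ.filter fun x => w.mate x = x).Nonempty := by
    rw [← Finset.card_pos]; omega
  refine ⟨Finset.min' _ this, (Finset.mem_filter.1 (Finset.min'_mem _ this)).2, fun x hx hx' => ?_⟩
  exact absurd (Finset.min'_le _ x (by simpa using hx')) (not_le.2 hx)

theorem mate_eq_self {n : ℕ} (w : LinkState n 0) (x : Fin n) : w.mate x = x := by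
  have hc := w.card_through
  rw [mul_zero, add_zero] at hc
  have : (Finset.univ.filter fun x => w.mate x = x) = Finset.univ := by
    rw [← Finset.card_eq_iff_eq_univ, hc, Fintype.card_fin]
  simpa using (Finset.ext_iff.1 this x)

/-- The link state without cups. -/
def idle (n : ℕ) : LinkState n 0 where
  mate x := x
  mate_mate _ := rfl
  noncrossing a b h1 h2 := absurd (h1.trans h2) (lt_irrefl _)
  exposed a b h1 h2 := absurd (h1.trans h2) (lt_irrefl _)
  card_through := by simp

theorem eq_idle {n : ℕ} (w : LinkState n 0) : w = idle n := by
  ext x : 2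
  exact w.mate_eq_self x

/-- A link state with a cup has a cup that joins neighbouring points. -/
theorem exists_adjacent {n p : ℕ} (w : LinkState n (p + 1)) :
    ∃ i j : Fin n, (i : ℕ) + 1 = j ∧ w.mate i = j := by
  have hm := w.mate_mate
  -- Here `d` counts the points strictly under a cup. In a cup with `d` minimal and positive, the
  -- point after the left end starts a narrower cup.
  have hex : ∃ d : ℕ, ∃ i j : Fin n, (i : ℕ) + d + 1 = j ∧ w.mate i = j := by
    have hc := w.card_through
    have : ∃ x, w.mate x ≠ x := by
      by_contra! h
      simp only [h, Finset.filter_true, Finset.card_univ, Fintype.card_fin] at hc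
      omega
    obtain ⟨x, hx⟩ := this
    rcases lt_or_gt_of_ne hx with h | h
    · exact ⟨x - w.mate x - 1, w.mate x, x, by simp only [Fin.lt_def] at h; omega, hm x⟩
    · exact ⟨w.mate x - x - 1, x, w.mate x, by simp only [Fin.lt_def] at h; omega, rfl⟩
  classical
  obtain ⟨i, j, hij, e⟩ := Nat.find_spec hex
  have hmin := fun d => Nat.find_min hex (m := d)
  generalize Nat.find hex = d at *
  by_cases hd : d = 0
  · subst hd
    exact ⟨i, j, hij, e⟩
  · exfalso
    let b : Fin n := ⟨i + 1, by omega⟩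
    have h1 : i < b := by simp [b, Fin.lt_def]
    have h2 : b < w.mate i := by rw [e]; simp only [b, Fin.lt_def]; omega
    have h3 := w.noncrossing i b h1 h2
    have h4 := w.exposed i b h1 h2
    have h5 : b < w.mate b := by
      refine lt_of_le_of_ne ?_ h4.symm
      simp only [Fin.le_def, Fin.lt_def, b] at *
      omega
    rw [e] at h3
    refine hmin (w.mate b - b - 1) ?_ ⟨b, w.mate b, ?_, rfl⟩
    · simp only [Fin.lt_def, b] at *
      omega
    · simp only [Fin.lt_def] at *
      omega

end LinkState

/-! ### The tensor space model -/

/-- The `n`-th tensor power of `ℂ²`, in coordinates; `false` and `true` label the two basis vectors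
of `ℂ²`. -/
abbrev Tensor (n : ℕ) : Type := (Fin n → Bool) → ℂ

/-- The action of the cup-cap diagram at `i`, `j` on tensor space. -/
noncomputable def tensorOp (q : ℂ) {n : ℕ} (i j : Fin n) : Tensor n →ₗ[ℂ] Tensor n where
  toFun y s := if s i = s j then 0 else
    (if s i then q⁻¹ else q) * y s + y (s ∘ Equiv.swap i j)
  map_add' y y' := by
    funext s
    simp only [Pi.add_apply]
    split_ifs <;> ring
  map_smul' c y := by
    funext s
    simp only [Pi.smul_apply, smul_eq_mul, RingHom.id_apply]
    split_ifs <;> ring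

theorem tensorOp_apply (q : ℂ) {n : ℕ} (i j : Fin n) (y : Tensor n) (s : Fin n → Bool) :
    tensorOp q i j y s = if s i = s j then 0 else
      (if s i then q⁻¹ else q) * y s + y (s ∘ Equiv.swap i j) := rfl

/-- The factor of the point `x` in the tensor of a link state. -/
noncomputable def linkFactor (q : ℂ) {n : ℕ} (m : Fin n → Fin n) (s : Fin n → Bool) (x : Fin n) :
    ℂ :=
  if m x = x then (if s x then 0 else 1)
  else if x < m x then (if s x = s (m x) then 0 else if s x then 1 else q)
  else 1

/-- The tensor of a link state: cups become invariant vectors and through strands the vector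
labelled by `false`. -/
noncomputable def linkTensor (q : ℂ) {n : ℕ} (m : Fin n → Fin n) : Tensor n :=
  fun s => ∏ x, linkFactor q m s x

theorem linkFactor_self (q : ℂ) {n : ℕ} {m : Fin n → Fin n} (s : Fin n → Bool) {x : Fin n}
    (h : m x = x) : linkFactor q m s x = if s x then 0 else 1 := by simp [linkFactor, h]

theorem linkFactor_lt (q : ℂ) {n : ℕ} {m : Fin n → Fin n} (s : Fin n → Bool) {x : Fin n}
    (h : x < m x) :
    linkFactor q m s x = if s x = s (m x) then 0 else if s x then 1 else q := by
  simp [linkFactor, h, h.ne']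

theorem linkFactor_gt (q : ℂ) {n : ℕ} {m : Fin n → Fin n} (s : Fin n → Bool) {x : Fin n}
    (h : m x < x) : linkFactor q m s x = 1 := by
  simp [linkFactor, h.ne, h.not_gt]

theorem linkFactor_congr (q : ℂ) {n : ℕ} {m m' : Fin n → Fin n} {s s' : Fin n → Bool} {x : Fin n}
    (h : m x = m' x) (h1 : s x = s' x) (h2 : s (m x) = s' (m x)) :
    linkFactor q m s x = linkFactor q m' s' x := by
  simp only [linkFactor, h1, h2, ← h]

theorem linkTensor_eq_zero (q : ℂ) {n : ℕ} {m : Fin n → Fin n} {s : Fin n → Bool} (x : Fin n)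
    (h : linkFactor q m s x = 0) : linkTensor q m s = 0 :=
  Finset.prod_eq_zero (Finset.mem_univ x) h

theorem linkTensor_split (q : ℂ) {n : ℕ} (m : Fin n → Fin n) (s : Fin n → Bool) (Q : Finset (Fin n)) :
    linkTensor q m s = (∏ x ∈ Q, linkFactor q m s x) * ∏ x ∈ Qᶜ, linkFactor q m s x :=
  (Finset.prod_mul_prod_compl Q _).symm

/-- The cup vector, with weight `q` at (`false`, `true`) and `1` at (`true`, `false`), spans the
image of the rank one operator on two tensor factors and has eigenvalue `q + q⁻¹`. -/
theorem tensorOp_linkTensor_mate (q : ℂ) {n : ℕ} (m : Fin n → Fin n)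
    (hm : ∀ x, m (m x) = x) (hq : q ≠ 0) (i j : Fin n) (hij : i < j) (h : m i = j) :
    tensorOp q i j (linkTensor q m) = (q + q⁻¹) • linkTensor q m := by
  have hji : m j = i := by rw [← h, hm]
  funext s
  have hs : (s ∘ Equiv.swap i j) i = s j := by simp
  have hs' : (s ∘ Equiv.swap i j) j = s i := by simp
  rw [tensorOp_apply, Pi.smul_apply, smul_eq_mul, linkTensor_split q m s {i, j},
    linkTensor_split q m (s ∘ Equiv.swap i j) {i, j}, Finset.prod_pair hij.ne,
    Finset.prod_pair hij.ne]
  have e : ∏ x ∈ ({i, j} : Finset (Fin n))ᶜ, linkFactor q m (s ∘ Equiv.swap i j) x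
      = ∏ x ∈ ({i, j} : Finset (Fin n))ᶜ, linkFactor q m s x := by
    refine Finset.prod_congr rfl fun x hx => linkFactor_congr q rfl ?_ ?_
    · simp only [Finset.mem_compl, Finset.mem_insert, Finset.mem_singleton, not_or] at hx
      simp [Equiv.swap_apply_of_ne_of_ne hx.1 hx.2]
    · simp only [Finset.mem_compl, Finset.mem_insert, Finset.mem_singleton, not_or] at hx
      have h1 : m x ≠ i := by grind
      have h2 : m x ≠ j := by grind
      simp [Equiv.swap_apply_of_ne_of_ne h1 h2]
  rw [e]
  rw [linkFactor_gt q s (x := j) (by rwa [hji]), linkFactor_lt q s (x := i) (by rwa [h]),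
    linkFactor_gt q _ (x := j) (by rwa [hji]), linkFactor_lt q _ (x := i) (by rwa [h]), h, hs, hs']
  generalize ∏ x ∈ ({i, j} : Finset (Fin n))ᶜ, linkFactor q m s x = P
  cases s i <;> cases s j <;> simp <;> field_simp; ring

theorem tensorOp_linkTensor_through (q : ℂ) {n : ℕ} (m : Fin n → Fin n)
    (i j : Fin n) (h : m i = i ∧ m j = j) : tensorOp q i j (linkTensor q m) = 0 := by
  funext s
  have hs : (s ∘ Equiv.swap i j) i = s j := by simp
  have hs' : (s ∘ Equiv.swap i j) j = s i := by simp
  have f1 := linkFactor_self q s h.1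
  have f2 := linkFactor_self q s h.2
  have f3 := linkFactor_self q (s ∘ Equiv.swap i j) h.1
  have f4 := linkFactor_self q (s ∘ Equiv.swap i j) h.2
  rw [hs] at f3
  rw [hs'] at f4
  rw [tensorOp_apply]
  by_cases h0 : s i = s j
  · rw [if_pos h0]; rfl
  · rw [if_neg h0]
    have a1 : linkTensor q m s = 0 := by
      cases hi : s i
      · exact linkTensor_eq_zero q j (by rw [f2]; grind)
      · exact linkTensor_eq_zero q i (by rw [f1]; grind)
    have a2 : linkTensor q m (s ∘ Equiv.swap i j) = 0 := by
      cases hi : s i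
      · exact linkTensor_eq_zero q i (by rw [f3]; grind)
      · exact linkTensor_eq_zero q j (by rw [f4]; grind)
    simp [a1, a2]

/-- The operator contracts the factors at `i` and `j` and puts the cup vector there; the contraction
splices the two strands. Planarity decides on which side of `i`, `j` the mates lie, and in each
admissible position the powers of `q` match. -/
theorem tensorOp_linkTensor_join (q : ℂ) (hq : q ≠ 0) {n : ℕ} (m : Fin n → Fin n) (hm : ∀ x, m (m x) = x)
    (noncrossing : ∀ a b, a < b → b < m a → a < m b ∧ m b < m a)
    (exposed : ∀ a b, a < b → b < m a → m b ≠ b) (i j : Fin n) (hij : (i : ℕ) + 1 = j)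
    (h1 : m i ≠ j) (h2 : ¬ (m i = i ∧ m j = j)) :
    tensorOp q i j (linkTensor q m) = linkTensor q (joinMate m i j) := by
  have lij : i < j := by simp only [Fin.lt_def]; omega
  have nlt : ∀ x, x ≠ i → x ≠ j → (x < i ↔ x < j) := by
    intro x h h'
    simp only [Fin.lt_def, ne_eq, Fin.ext_iff] at *
    omega
  funext s
  set s' := s ∘ Equiv.swap i j with hs'
  have si : s' i = s j := by simp [hs']
  have sj : s' j = s i := by simp [hs']
  have sx : ∀ x, x ≠ i → x ≠ j → s' x = s x := by
    intro x h h'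
    simp [hs', Equiv.swap_apply_of_ne_of_ne h h']
  set m' := joinMate m i j with hm'
  have mi : m' i = j := by simp [hm', joinMate]
  have mj : m' j = i := by simp [hm', joinMate, lij.ne']
  have mx : ∀ x, x ≠ i → x ≠ j → x ≠ m i → x ≠ m j → m' x = m x := by
    intro x a b c d
    simp [hm', joinMate, a, b, c, d]
  have ni : m j ≠ i := by grind
  rw [tensorOp_apply, ← hs']
  -- Only the factors at `i`, `j` and their mates change; the product over all other points is
  -- common to the three tensors.
  set Q : Finset (Fin n) := {i, j, m i, m j} with hQ
  have e1 : ∏ x ∈ Qᶜ, linkFactor q m s' x = ∏ x ∈ Qᶜ, linkFactor q m s x := by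
    refine Finset.prod_congr rfl fun x hx => ?_
    simp only [hQ, Finset.mem_compl, Finset.mem_insert, Finset.mem_singleton, not_or] at hx
    exact linkFactor_congr q rfl (sx _ hx.1 hx.2.1) (sx _ (by grind) (by grind))
  have e2 : ∏ x ∈ Qᶜ, linkFactor q m' s x = ∏ x ∈ Qᶜ, linkFactor q m s x := by
    refine Finset.prod_congr rfl fun x hx => ?_
    simp only [hQ, Finset.mem_compl, Finset.mem_insert, Finset.mem_singleton, not_or] at hx
    exact linkFactor_congr q (mx _ hx.1 hx.2.1 hx.2.2.1 hx.2.2.2) rfl rfl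
  rw [linkTensor_split q m s Q, linkTensor_split q m s' Q, linkTensor_split q m' s Q, e1, e2]
  generalize ∏ x ∈ Qᶜ, linkFactor q m s x = P
  have fi := linkFactor_lt q (m := m') s (x := i) (by rwa [mi])
  have fj := linkFactor_gt q (m := m') s (x := j) (by rwa [mj])
  rw [mi] at fi
  by_cases hi : m i = i
  · -- `i` is the end of a through strand
    have hj : m j ≠ j := fun h => h2 ⟨hi, h⟩
    have hb : j < m j := by
      by_contra hlt
      have h3 : m j < j := lt_of_le_of_ne (not_lt.1 hlt) hj
      have h4 := exposed (m j) i ((nlt _ ni hj).2 h3) (by rw [hm]; exact lij)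
      exact h4 hi
    have mb : m' (m j) = m j := by simp [hm', joinMate, ni, hj, hi]
    have hQ' : Q = {i, j, m j} := by rw [hQ, hi]; ext x; simp; tauto
    have expand : ∀ f : Fin n → ℂ, ∏ x ∈ Q, f x = f i * (f j * f (m j)) := by
      intro f
      rw [hQ', Finset.prod_insert (by simp [lij.ne, ni.symm]), Finset.prod_pair hj.symm]
    have g1 := linkFactor_self q s hi
    have g2 := linkFactor_lt q s hb
    have g3 := linkFactor_gt q s (m := m) (x := m j) (by rwa [hm])
    have k1 := linkFactor_self q s' hi
    have k2 := linkFactor_lt q s' hb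
    have k3 := linkFactor_gt q s' (m := m) (x := m j) (by rwa [hm])
    have fb := linkFactor_self q s mb
    rw [expand, expand, expand, g1, g2, g3, k1, k2, k3, fi, fj, fb, si, sj, sx _ ni hj]
    cases s i <;> cases s j <;> cases s (m j) <;> simp
  by_cases hj : m j = j
  · -- `j` is the end of a through strand
    have ha : m i < i := by
      by_contra hlt
      have h3 : i < m i := lt_of_le_of_ne (not_lt.1 hlt) (Ne.symm hi)
      have h4 : j < m i := lt_of_le_of_ne (not_lt.1 (mt (nlt _ hi h1).2 h3.not_gt)) h1.symm
      exact exposed i j lij h4 hj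
    have ma : m' (m i) = m i := by simp [hm', joinMate, h1, hi, hj]
    have hQ' : Q = {i, j, m i} := by rw [hQ, hj]; ext x; simp; tauto
    have expand : ∀ f : Fin n → ℂ, ∏ x ∈ Q, f x = f i * (f j * f (m i)) := by
      intro f
      rw [hQ', Finset.prod_insert (by simp [lij.ne, Ne.symm hi]), Finset.prod_pair h1.symm]
    have g1 := linkFactor_self q s hj
    have g2 := linkFactor_gt q s ha
    have g3 := linkFactor_lt q s (m := m) (x := m i) (by rwa [hm])
    have k1 := linkFactor_self q s' hj
    have k2 := linkFactor_gt q s' ha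
    have k3 := linkFactor_lt q s' (m := m) (x := m i) (by rwa [hm])
    have fa := linkFactor_self q s ma
    rw [hm] at g3 k3
    rw [expand, expand, expand, g1, g2, g3, k1, k2, k3, fi, fj, fa, si, sj, sx _ hi h1]
    cases s i <;> cases s j <;> cases s (m i) <;> simp <;> field_simp
  · -- both points are ends of cups
    have hab : m i ≠ m j := by grind
    have ma : m' (m i) = m j := by simp [hm', joinMate, h1, hi, hj]
    have mb : m' (m j) = m i := by simp [hm', joinMate, ni, hi, hj, hab.symm]
    have expand : ∀ f : Fin n → ℂ, ∏ x ∈ Q, f x = f i * (f j * (f (m i) * f (m j))) := by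
      intro f
      rw [hQ, Finset.prod_insert (by simp [lij.ne, Ne.symm hi, ni.symm]),
        Finset.prod_insert (by simp [h1.symm, Ne.symm hj]), Finset.prod_pair hab]
    have n1 := nlt _ hi h1
    have n2 := nlt _ ni hj
    have sa := sx _ hi h1
    have sb := sx _ ni hj
    rw [expand, expand, expand, fi, fj]
    rcases lt_or_gt_of_ne hi with ha | ha
    · have g1 := fun s => linkFactor_gt q s ha
      have g2 := fun s => linkFactor_lt q s (m := m) (x := m i) (by rwa [hm])
      rw [hm] at g2
      rcases lt_or_gt_of_ne hj with hb | hb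
      · have g3 := fun s => linkFactor_gt q s hb
        have g4 := fun s => linkFactor_lt q s (m := m) (x := m j) (by rwa [hm])
        rw [hm] at g4
        have hlt : m j < m i := by
          have := noncrossing (m j) i (n2.2 hb) (by rw [hm]; exact lij)
          exact this.1
        have f1 := linkFactor_gt q s (m := m') (x := m i) (by rwa [ma])
        have f2 := linkFactor_lt q s (m := m') (x := m j) (by rwa [mb])
        rw [g1, g2, g3, g4, g1, g2, g3, g4, f1, f2, mb, si, sj, sa, sb]
        cases s i <;> cases s j <;> cases s (m i) <;> cases s (m j) <;> simp <;> field_simp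
      · have g3 := fun s => linkFactor_lt q s hb
        have g4 := fun s => linkFactor_gt q s (m := m) (x := m j) (by rwa [hm])
        have hlt : m i < m j := ha.trans (lij.trans hb)
        have f1 := linkFactor_lt q s (m := m') (x := m i) (by rwa [ma])
        have f2 := linkFactor_gt q s (m := m') (x := m j) (by rwa [mb])
        rw [g1, g2, g3, g4, g1, g2, g3, g4, f1, f2, ma, si, sj, sa, sb]
        cases s i <;> cases s j <;> cases s (m i) <;> cases s (m j) <;> simp <;> field_simp
    · have g1 := fun s => linkFactor_lt q s ha
      have g2 := fun s => linkFactor_gt q s (m := m) (x := m i) (by rwa [hm])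
      have ha' : j < m i := lt_of_le_of_ne (not_lt.1 (mt n1.2 ha.not_gt)) h1.symm
      have h3 := noncrossing i j lij ha'
      have hb : j < m j := by
        refine lt_of_le_of_ne (not_lt.1 (mt n2.2 h3.1.not_gt)) (Ne.symm hj)
      have g3 := fun s => linkFactor_lt q s hb
      have g4 := fun s => linkFactor_gt q s (m := m) (x := m j) (by rwa [hm])
      have f1 := linkFactor_gt q s (m := m') (x := m i) (by rw [ma]; exact h3.2)
      have f2 := linkFactor_lt q s (m := m') (x := m j) (by rw [mb]; exact h3.2)
      rw [g1, g2, g3, g4, g1, g2, g3, g4, f1, f2, mb, si, sj, sa, sb]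
      cases s i <;> cases s j <;> cases s (m i) <;> cases s (m j) <;> simp <;> field_simp

theorem linkTensor_addThrough (q : ℂ) {n p : ℕ} (w : LinkState n p) (b : Bool) (s : Fin n → Bool) :
    linkTensor q w.addThrough.mate (Fin.cons b s) = if b then 0 else linkTensor q w.mate s := by
  have h : ∀ x : Fin n, linkFactor q w.addThrough.mate (Fin.cons b s) x.succ
      = linkFactor q w.mate s x := by
    intro x
    simp [linkFactor, LinkState.addThrough]
  have h0 : linkFactor q w.addThrough.mate (Fin.cons b s) 0 = if b then 0 else 1 := by
    simp [linkFactor, LinkState.addThrough]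
  rw [linkTensor, Fin.prod_univ_succ, h0, Finset.prod_congr rfl fun x _ => h x]
  cases b <;> simp [linkTensor]

theorem linkTensor_addCup (q : ℂ) {n p : ℕ} (w : LinkState n p) (a b : Bool) (s : Fin n → Bool) :
    linkTensor q w.addCup.mate (Fin.cons a (Fin.cons b s))
      = if a = b then 0 else (if a then 1 else q) * linkTensor q w.mate s := by
  have h : ∀ x : Fin n, linkFactor q w.addCup.mate (Fin.cons a (Fin.cons b s)) x.succ.succ
      = linkFactor q w.mate s x := by
    intro x
    simp [linkFactor, LinkState.addCup_succ]
  have h0 : linkFactor q w.addCup.mate (Fin.cons a (Fin.cons b s)) 0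
      = if a = b then 0 else if a then 1 else q := by
    rw [linkFactor_lt _ _ (by rw [LinkState.addCup_zero]; exact Fin.succ_pos 0),
      LinkState.addCup_zero]
    rfl
  have h1 : linkFactor q w.addCup.mate (Fin.cons a (Fin.cons b s)) (Fin.succ 0) = 1 :=
    linkFactor_gt _ _ (Fin.succ_pos 0)
  rw [linkTensor, Fin.prod_univ_succ, Fin.prod_univ_succ, h0, h1,
    Finset.prod_congr rfl fun x _ => h x]
  split_ifs <;> simp [linkTensor]

/-- With first index `true`, the cup at the first point has weight `1` and forces `false` at its far
end, exactly as a through strand there does. -/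
theorem linkTensor_openFirst (q : ℂ) {n p : ℕ} (w : LinkState (n + 1) (p + 1)) (h : w.mate 0 ≠ 0)
    (s : Fin n → Bool) :
    linkTensor q w.mate (Fin.cons true s) = linkTensor q (w.openFirst h).mate s := by
  set y := (w.mate 0).pred h with hy
  have hy' : w.mate 0 = y.succ := (Fin.succ_pred _ _).symm
  have hyy : w.mate y.succ = 0 := by rw [← hy', w.mate_mate]
  have h0 : linkFactor q w.mate (Fin.cons true s) 0 = if s y then 0 else 1 := by
    rw [linkFactor_lt _ _ (Fin.pos_of_ne_zero h), hy']
    simp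
  have h1 : linkFactor q w.mate (Fin.cons true s) y.succ = 1 :=
    linkFactor_gt _ _ (by rw [hyy]; exact Fin.succ_pos y)
  have h2 : linkFactor q (w.openFirst h).mate s y = if s y then 0 else 1 :=
    linkFactor_self _ _ (LinkState.dropMate_eq hyy)
  have h3 : ∀ x ∈ Finset.univ.erase y, linkFactor q w.mate (Fin.cons true s) x.succ
      = linkFactor q (w.openFirst h).mate s x := by
    intro x hx
    have hxy : x ≠ y := by simpa using hx
    have hne : w.mate x.succ ≠ 0 := by
      intro h'
      have := w.mate_mate x.succ
      rw [h', hy'] at this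
      exact hxy (Fin.succ_injective _ this.symm)
    have e : w.mate x.succ = ((w.openFirst h).mate x).succ := (LinkState.succ_dropMate hne).symm
    simp [linkFactor, e]
  rw [linkTensor, Fin.prod_univ_succ, h0, ← Finset.mul_prod_erase _ _ (Finset.mem_univ y), h1,
    one_mul, Finset.prod_congr rfl h3, linkTensor, ← Finset.mul_prod_erase _ _ (Finset.mem_univ y),
    h2]

theorem linkTensor_idle (q : ℂ) (n : ℕ) (s : Fin n → Bool) :
    linkTensor q (LinkState.idle n).mate s = if ∃ x, s x then 0 else 1 := by
  split_ifs with h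
  · obtain ⟨x, hx⟩ := h
    exact linkTensor_eq_zero q x (by rw [linkFactor_self _ _ rfl, if_pos hx])
  · refine Finset.prod_eq_one fun x _ => ?_
    rw [linkFactor_self _ _ rfl, if_neg fun hx => h ⟨x, hx⟩]

/-! ### Generators -/

theorem liftHom_gen {δ : ℂ} {S : Set ℕ} {A : Type*} [Ring A] [Algebra ℂ A] (f : S → A)
    (hsq : ∀ i, f i * f i = δ • f i)
    (hzig : ∀ i j : S, ((i : ℕ) + 1 = j ∨ (j : ℕ) + 1 = i) → f i * f j * f i = f i)
    (hcomm : ∀ i j : S, ((i : ℕ) + 1 < j ∨ (j : ℕ) + 1 < i) → f i * f j = f j * f i) (i : S) :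
    liftHom f hsq hzig hcomm (gen δ S i) = f i := by
  simp [liftHom, gen]

theorem alg_induction {δ : ℂ} {S : Set ℕ} {P : Alg δ S → Prop}
    (halg : ∀ c : ℂ, P (algebraMap ℂ _ c)) (hgen : ∀ i, P (gen δ S i))
    (hmul : ∀ a b, P a → P b → P (a * b)) (hadd : ∀ a b, P a → P b → P (a + b)) (a : Alg δ S) :
    P a := by
  obtain ⟨x, rfl⟩ := RingQuot.mkAlgHom_surjective ℂ (Rel δ S) a
  induction x using FreeAlgebra.induction with
  | grade0 c => rw [AlgHom.commutes]; exact halg c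
  | grade1 i => exact hgen i
  | mul a b ha hb => rw [map_mul]; exact hmul _ _ ha hb
  | add a b ha hb => rw [map_add]; exact hadd _ _ ha hb

/-- A linear map that intertwines the generators intertwines the whole algebra. -/
theorem intertwine {δ : ℂ} {S : Set ℕ} {A : Type*} [Ring A] [Algebra ℂ A]
    {M N : Type*} [AddCommGroup M] [Module ℂ M] [Module (Alg δ S) M] [IsScalarTower ℂ (Alg δ S) M]
    [AddCommGroup N] [Module ℂ N] [Module A N] [IsScalarTower ℂ A N] (φ : Alg δ S →ₐ[ℂ] A)
    (f : M →ₗ[ℂ] N) (h : ∀ i v, f (gen δ S i • v) = φ (gen δ S i) • f v) (a : Alg δ S) :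
    ∀ v, f (a • v) = φ a • f v := by
  induction a using alg_induction with
  | halg c => intro v; rw [AlgHom.commutes, algebraMap_smul, algebraMap_smul, map_smul]
  | hgen i => exact h i
  | hmul a b ha hb => intro v; rw [mul_smul, ha, hb, map_mul, mul_smul]
  | hadd a b ha hb => intro v; rw [add_smul, map_add, ha, hb, map_add, add_smul]

/-- A subspace that is stable under the generators, as a submodule. -/
def ofStable {δ : ℂ} {S : Set ℕ} {M : Type*} [AddCommGroup M] [Module ℂ M] [Module (Alg δ S) M]
    [IsScalarTower ℂ (Alg δ S) M] (N : Submodule ℂ M) (h : ∀ i, ∀ v ∈ N, gen δ S i • v ∈ N) :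
    Submodule (Alg δ S) M where
  toAddSubmonoid := N.toAddSubmonoid
  smul_mem' a := by
    induction a using alg_induction with
    | halg c => intro v hv; rw [algebraMap_smul]; exact N.smul_mem c hv
    | hgen i => exact fun hv => h i _ hv
    | hmul a b ha hb => intro v hv; rw [mul_smul]; exact ha (hb hv)
    | hadd a b ha hb => intro v hv; rw [add_smul]; exact N.add_mem (ha hv) (hb hv)

theorem mem_ofStable {δ : ℂ} {S : Set ℕ} {M : Type*} [AddCommGroup M] [Module ℂ M]
    [Module (Alg δ S) M] [IsScalarTower ℂ (Alg δ S) M] {N : Submodule ℂ M}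
    {h : ∀ i, ∀ v ∈ N, gen δ S i • v ∈ N} {v : M} : v ∈ ofStable N h ↔ v ∈ N := Iff.rfl

/-- The generator `e k` of `TL_n`. -/
noncomputable def cc (δ : ℂ) (n k : ℕ) (hk : k + 1 < n) : TL δ n := gen δ {i | i + 1 < n} ⟨k, hk⟩

theorem cc_sq (δ : ℂ) (n k : ℕ) (hk : k + 1 < n) : cc δ n k hk * cc δ n k hk = δ • cc δ n k hk :=
  gen_sq _ _ _

theorem cc_zigzag (δ : ℂ) (n k j : ℕ) (hk : k + 1 < n) (hj : j + 1 < n)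
    (h : k + 1 = j ∨ j + 1 = k) : cc δ n k hk * cc δ n j hj * cc δ n k hk = cc δ n k hk :=
  gen_zigzag _ _ _ _ h

theorem cc_comm (δ : ℂ) (n k j : ℕ) (hk : k + 1 < n) (hj : j + 1 < n)
    (h : k + 1 < j ∨ j + 1 < k) : cc δ n k hk * cc δ n j hj = cc δ n j hj * cc δ n k hk :=
  gen_comm _ _ _ _ h

/-- The embedding `e k ↦ e (k + 1)` of `TL_n` into `TL_{n+1}`. -/
noncomputable def shift (δ : ℂ) (n : ℕ) : TL δ n →ₐ[ℂ] TL δ (n + 1) :=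
  liftHom (fun i => cc δ (n + 1) (i + 1) (Nat.succ_lt_succ i.2))
    (fun _ => cc_sq _ _ _ _)
    (fun _ _ h => cc_zigzag _ _ _ _ _ _ (by omega))
    (fun _ _ h => cc_comm _ _ _ _ _ _ (by omega))

theorem shift_cc (δ : ℂ) (n k : ℕ) (hk : k + 1 < n) :
    shift δ n (cc δ n k hk) = cc δ (n + 1) (k + 1) (Nat.succ_lt_succ hk) := liftHom_gen _ _ _ _ _

/-- The embedding `e k ↦ e (k + 2)` of `TL_n` into `TL_{n+2}`. -/
noncomputable def shiftTwo (δ : ℂ) (n : ℕ) : TL δ n →ₐ[ℂ] TL δ (n + 2) :=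
  (shift δ (n + 1)).comp (shift δ n)

theorem shiftTwo_cc (δ : ℂ) (n k : ℕ) (hk : k + 1 < n) :
    shiftTwo δ n (cc δ n k hk) = cc δ (n + 2) (k + 2) (by omega) := by
  rw [shiftTwo, AlgHom.comp_apply, shift_cc, shift_cc]

theorem cc_smul_std (δ : ℂ) (n p k : ℕ) (hk : k + 1 < n) (v : Std δ n p) :
    cc δ n k hk • v = stackOp δ p ⟨k, Nat.lt_of_succ_lt hk⟩ ⟨k + 1, hk⟩ rfl v := by
  rw [smul_std, cc, stdRep, liftHom_gen]

/-! ### Linear maps between standard representations -/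

/-- The linear map with given values on the link states. -/
noncomputable def Std.lift (δ : ℂ) {n p : ℕ} {M : Type*} [AddCommGroup M] [Module ℂ M]
    (f : LinkState n p → M) : Std δ n p →ₗ[ℂ] M :=
  Finsupp.linearCombination ℂ f

theorem Std.lift_ofLink (δ : ℂ) {n p : ℕ} {M : Type*} [AddCommGroup M] [Module ℂ M]
    (f : LinkState n p → M) (w : LinkState n p) : Std.lift δ f (Std.ofLink δ w) = f w := by
  simp only [Std.lift, Std.ofLink]
  erw [Finsupp.linearCombination_single]
  exact one_smul _ _

theorem Std.ext_hom {δ : ℂ} {n p : ℕ} {M : Type*} [AddCommGroup M] [Module ℂ M]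
    {f g : Std δ n p →ₗ[ℂ] M} (h : ∀ w, f (Std.ofLink δ w) = g (Std.ofLink δ w)) : f = g :=
  Finsupp.lhom_ext' (M := ℂ) (R := ℂ) fun w => LinearMap.ext_ring (h w)

theorem Std.induction {δ : ℂ} {n p : ℕ} (N : Submodule ℂ (Std δ n p))
    (h : ∀ w, Std.ofLink δ w ∈ N) (v : Std δ n p) : v ∈ N := by
  induction v using Finsupp.induction_linear with
  | zero => exact N.zero_mem
  | add f g hf hg => exact N.add_mem hf hg
  | single w c =>
    have : (Finsupp.single w c : Std δ n p) = c • Std.ofLink δ w :=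
      (Finsupp.smul_single_one w c).symm
    rw [this]
    exact N.smul_mem c (h w)

/-- Add a through strand in front. -/
noncomputable def addStrand (δ : ℂ) (n p : ℕ) : Std δ n p →ₗ[ℂ] Std δ (n + 1) p :=
  Std.lift δ fun w => Std.ofLink δ w.addThrough

/-- Add a cup in front. -/
noncomputable def addCup (δ : ℂ) (n p : ℕ) : Std δ n p →ₗ[ℂ] Std δ (n + 2) (p + 1) :=
  Std.lift δ fun w => Std.ofLink δ w.addCup

open Classical in
/-- Remove a through strand in front; link states with a cup in front go to `0`. -/
noncomputable def dropStrand (δ : ℂ) (n p : ℕ) : Std δ (n + 1) p →ₗ[ℂ] Std δ n p :=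
  Std.lift δ fun w => if h : w.mate 0 = 0 then Std.ofLink δ (w.tail h) else 0

open Classical in
/-- Open the cup at the first point and remove this point; link states with a through strand in
front go to `0`. -/
noncomputable def openCup (δ : ℂ) (n p : ℕ) : Std δ (n + 1) (p + 1) →ₗ[ℂ] Std δ n p :=
  Std.lift δ fun w => if h : w.mate 0 = 0 then 0 else Std.ofLink δ (w.openFirst h)

open Classical in
/-- Close the first through strand by a cup that starts at a new first point. -/
noncomputable def closeStrand (δ : ℂ) (n p : ℕ) : Std δ n p →ₗ[ℂ] Std δ (n + 1) (p + 1) :=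
  Std.lift δ fun w => if h : ∃ y, w.mate y = y ∧ ∀ x < y, w.mate x ≠ x then
    Std.ofLink δ (w.close h.choose h.choose_spec.1 h.choose_spec.2) else 0

theorem dropStrand_addStrand (δ : ℂ) (n p : ℕ) (v : Std δ n p) :
    dropStrand δ n p (addStrand δ n p v) = v := by
  refine LinearMap.congr_fun (f := dropStrand δ n p ∘ₗ addStrand δ n p) (g := LinearMap.id)
    (Std.ext_hom fun w => ?_) v
  have h : w.addThrough.mate 0 = 0 := rfl
  rw [LinearMap.comp_apply, addStrand, Std.lift_ofLink, dropStrand, Std.lift_ofLink, dif_pos h,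
    LinearMap.id_apply]
  refine congrArg _ (LinkState.ext (funext fun x => ?_))
  apply Fin.succ_injective
  exact LinkState.succ_dropMate (m := w.addThrough.mate) (Fin.succ_ne_zero _)

theorem openCup_addStrand (δ : ℂ) (n p : ℕ) (v : Std δ n (p + 1)) :
    openCup δ n p (addStrand δ n (p + 1) v) = 0 := by
  refine LinearMap.congr_fun (f := openCup δ n p ∘ₗ addStrand δ n (p + 1)) (g := 0)
    (Std.ext_hom fun w => ?_) v
  have h : w.addThrough.mate 0 = 0 := rfl
  rw [LinearMap.comp_apply, addStrand, Std.lift_ofLink, openCup, Std.lift_ofLink, dif_pos h,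
    LinearMap.zero_apply]

theorem addStrand_add_closeStrand (δ : ℂ) (n p : ℕ) (v : Std δ (n + 1) (p + 1)) :
    addStrand δ n (p + 1) (dropStrand δ n (p + 1) v) + closeStrand δ n p (openCup δ n p v) = v := by
  refine LinearMap.congr_fun (f := addStrand δ n (p + 1) ∘ₗ dropStrand δ n (p + 1)
    + closeStrand δ n p ∘ₗ openCup δ n p) (g := LinearMap.id) (Std.ext_hom fun w => ?_) v
  rw [LinearMap.add_apply, LinearMap.comp_apply, LinearMap.comp_apply, dropStrand, openCup,
    Std.lift_ofLink, Std.lift_ofLink, LinearMap.id_apply]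
  by_cases h : w.mate 0 = 0
  · rw [dif_pos h, dif_pos h, map_zero, add_zero, addStrand, Std.lift_ofLink,
      LinkState.addThrough_tail]
  · have h' : ∃ y, (w.openFirst h).mate y = y ∧ ∀ x < y, (w.openFirst h).mate x ≠ x := by
      refine LinkState.exists_through _ ?_
      have := w.two_mul_le
      omega
    rw [dif_neg h, dif_neg h, map_zero, zero_add, closeStrand, Std.lift_ofLink, dif_pos h']
    congr 1
    refine LinkState.openFirst_injective _ _ (LinkState.close_zero_ne _ _ _ _) h ?_
    rw [LinkState.openFirst_close]

theorem openCup_closeStrand (δ : ℂ) (n p : ℕ) (hp : 2 * p < n) (v : Std δ n p) :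
    openCup δ n p (closeStrand δ n p v) = v := by
  refine LinearMap.congr_fun (f := openCup δ n p ∘ₗ closeStrand δ n p) (g := LinearMap.id)
    (Std.ext_hom fun w => ?_) v
  have h' := w.exists_through hp
  rw [LinearMap.comp_apply, closeStrand, Std.lift_ofLink, dif_pos h', openCup, Std.lift_ofLink,
    dif_neg (LinkState.close_zero_ne _ _ _ _), LinearMap.id_apply, LinkState.openFirst_close]

theorem exists_addStrand_of_openCup {δ : ℂ} {n p : ℕ} {v : Std δ (n + 1) (p + 1)}
    (h : openCup δ n p v = 0) : ∃ u, addStrand δ n (p + 1) u = v :=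
  ⟨_, by simpa [h] using addStrand_add_closeStrand δ n p v⟩

theorem std_zero_eq (δ : ℂ) (n : ℕ) (v : Std δ n 0) :
    ∃ c : ℂ, v = c • Std.ofLink δ (LinkState.idle n) := by
  have := Std.induction (Submodule.span ℂ {Std.ofLink δ (LinkState.idle n)}) (fun w => by
    rw [w.eq_idle]
    exact Submodule.mem_span_singleton_self _) v
  obtain ⟨c, hc⟩ := Submodule.mem_span_singleton.1 this
  exact ⟨c, hc.symm⟩

theorem addStrand_idle (δ : ℂ) (n : ℕ) : addStrand δ n 0 (Std.ofLink δ (LinkState.idle n))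
    = Std.ofLink δ (LinkState.idle (n + 1)) := by
  rw [addStrand, Std.lift_ofLink, LinkState.eq_idle (LinkState.addThrough _)]

theorem exists_addStrand_zero {δ : ℂ} {n : ℕ} (v : Std δ (n + 1) 0) :
    ∃ u, addStrand δ n 0 u = v := by
  obtain ⟨c, rfl⟩ := std_zero_eq δ (n + 1) v
  exact ⟨c • Std.ofLink δ (LinkState.idle n), by rw [map_smul, addStrand_idle]⟩

theorem std_subsingleton (δ : ℂ) {n p : ℕ} (h : n < 2 * p) : Subsingleton (Std δ n p) := by
  have : IsEmpty (LinkState n p) := ⟨fun w => by have := w.two_mul_le; omega⟩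
  exact inferInstanceAs (Subsingleton (LinkState n p →₀ ℂ))

/-! ### The map to tensor space -/

/-- The weight of a closed circle. -/
noncomputable abbrev loop (q : ℂ) : ℂ := q + q⁻¹

/-- The embedding of a standard representation into tensor space. -/
noncomputable def toTensor (q : ℂ) (n p : ℕ) : Std (loop q) n p →ₗ[ℂ] Tensor n :=
  Std.lift (loop q) fun w => linkTensor q w.mate

theorem toTensor_ofLink (q : ℂ) {n p : ℕ} (w : LinkState n p) :
    toTensor q n p (Std.ofLink (loop q) w) = linkTensor q w.mate := Std.lift_ofLink _ _ _

theorem toTensor_cc (q : ℂ) (hq : q ≠ 0) (n p k : ℕ) (hk : k + 1 < n) (v : Std (loop q) n p) :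
    toTensor q n p (cc (loop q) n k hk • v)
      = tensorOp q ⟨k, Nat.lt_of_succ_lt hk⟩ ⟨k + 1, hk⟩ (toTensor q n p v) := by
  rw [cc_smul_std]
  set i : Fin n := ⟨k, Nat.lt_of_succ_lt hk⟩
  set j : Fin n := ⟨k + 1, hk⟩
  have hij : (i : ℕ) + 1 = j := rfl
  refine LinearMap.congr_fun (f := toTensor q n p ∘ₗ stackOp (loop q) p i j hij)
    (g := tensorOp q i j ∘ₗ toTensor q n p) (Std.ext_hom fun w => ?_) v
  rw [LinearMap.comp_apply, LinearMap.comp_apply, stackOp_ofLink, toTensor_ofLink]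
  have lij : i < j := by simp only [Fin.lt_def]; omega
  by_cases h1 : w.mate i = j
  · rw [stack_mate _ _ _ _ _ h1, map_smul, toTensor_ofLink,
      tensorOp_linkTensor_mate q _ w.mate_mate hq i j lij h1]
  by_cases h2 : w.mate i = i ∧ w.mate j = j
  · rw [stack_through _ _ _ _ _ h2, map_zero, tensorOp_linkTensor_through q _ i j h2]
  · rw [stack_join _ _ _ _ _ h1 h2, toTensor_ofLink,
      tensorOp_linkTensor_join q hq _ w.mate_mate w.noncrossing w.exposed i j hij h1 h2]
    rfl

theorem toTensor_addStrand (q : ℂ) {n p : ℕ} (v : Std (loop q) n p) (b : Bool) (s : Fin n → Bool) :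
    toTensor q (n + 1) p (addStrand _ n p v) (Fin.cons b s)
      = if b then 0 else toTensor q n p v s := by
  refine LinearMap.congr_fun (f := LinearMap.proj (Fin.cons b s) ∘ₗ toTensor q (n + 1) p
    ∘ₗ addStrand _ n p) (g := if b then 0 else LinearMap.proj s ∘ₗ toTensor q n p)
    (Std.ext_hom fun w => ?_) v |>.trans ?_
  · simp only [LinearMap.comp_apply, addStrand, Std.lift_ofLink, toTensor_ofLink,
      LinearMap.proj_apply, linkTensor_addThrough]
    split_ifs <;> simp [toTensor_ofLink]
  · split_ifs <;> rfl

theorem toTensor_addCup (q : ℂ) {n p : ℕ} (v : Std (loop q) n p) (a b : Bool) (s : Fin n → Bool) :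
    toTensor q (n + 2) (p + 1) (addCup _ n p v) (Fin.cons a (Fin.cons b s))
      = if a = b then 0 else (if a then 1 else q) * toTensor q n p v s := by
  refine LinearMap.congr_fun (f := LinearMap.proj (Fin.cons a (Fin.cons b s))
    ∘ₗ toTensor q (n + 2) (p + 1) ∘ₗ addCup _ n p)
    (g := (if a = b then 0 else if a then (1 : ℂ) else q) • LinearMap.proj s ∘ₗ toTensor q n p)
    (Std.ext_hom fun w => ?_) v |>.trans ?_
  · simp only [LinearMap.comp_apply, addCup, Std.lift_ofLink, toTensor_ofLink,
      LinearMap.proj_apply, linkTensor_addCup]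
    split_ifs <;> simp [toTensor_ofLink]
  · split_ifs <;> simp

theorem toTensor_openCup (q : ℂ) {n p : ℕ} (v : Std (loop q) (n + 1) (p + 1)) (s : Fin n → Bool) :
    toTensor q (n + 1) (p + 1) v (Fin.cons true s) = toTensor q n p (openCup _ n p v) s := by
  refine LinearMap.congr_fun (f := LinearMap.proj (Fin.cons true s) ∘ₗ toTensor q (n + 1) (p + 1))
    (g := LinearMap.proj s ∘ₗ toTensor q n p ∘ₗ openCup _ n p) (Std.ext_hom fun w => ?_) v
  simp only [LinearMap.comp_apply, openCup, Std.lift_ofLink, toTensor_ofLink, LinearMap.proj_apply]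
  by_cases h : w.mate 0 = 0
  · rw [dif_pos h, map_zero]
    conv_lhs => rw [← w.addThrough_tail h]
    rw [linkTensor_addThrough]
    rfl
  · rw [dif_neg h, toTensor_ofLink, linkTensor_openFirst]

/-- The slice with first index `true` is the tensor of the state with its first cup opened. If it
vanishes, only states with a through strand in front remain, and these are seen by the other slice.
-/
theorem toTensor_eq_zero (q : ℂ) (n : ℕ) : ∀ p (v : Std (loop q) n p), toTensor q n p v = 0 →
    v = 0 := by
  induction n with
  | zero =>
    intro p v h
    cases p with
    | zero =>
      obtain ⟨c, rfl⟩ := std_zero_eq _ _ v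
      have := congrFun h Fin.elim0
      rw [map_smul, toTensor_ofLink, Pi.smul_apply, linkTensor_idle] at this
      simp only [IsEmpty.exists_iff, if_false, smul_eq_mul, mul_one, Pi.zero_apply] at this
      rw [this, zero_smul]
    | succ p =>
      have := std_subsingleton (loop q) (n := 0) (p := p + 1) (by omega)
      exact Subsingleton.elim _ _
  | succ n ih =>
    intro p v h
    have hu : ∃ u, addStrand _ n p u = v := by
      cases p with
      | zero => exact exists_addStrand_zero v
      | succ p =>
        refine exists_addStrand_of_openCup (ih p _ ?_)
        funext s
        rw [← toTensor_openCup, h]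
        rfl
    obtain ⟨u, rfl⟩ := hu
    rw [ih p u, map_zero]
    funext s
    have := congrFun h (Fin.cons false s)
    rwa [toTensor_addStrand] at this

theorem toTensor_injective (q : ℂ) (n p : ℕ) : Function.Injective (toTensor q n p) :=
  (injective_iff_map_eq_zero _).2 (toTensor_eq_zero q n p)

theorem tensor_ext {n : ℕ} {y y' : Tensor (n + 1)}
    (h : ∀ b s, y (Fin.cons b s) = y' (Fin.cons b s)) : y = y' := by
  funext s
  rw [← Fin.cons_self_tail s]
  exact h _ _

theorem tensorOp_cons (q : ℂ) {n : ℕ} (i j : Fin n) (y : Tensor (n + 1)) (b : Bool)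
    (s : Fin n → Bool) :
    tensorOp q i.succ j.succ y (Fin.cons b s) = tensorOp q i j (fun t => y (Fin.cons b t)) s := by
  have : (Fin.cons b s : Fin (n + 1) → Bool) ∘ Equiv.swap i.succ j.succ
      = Fin.cons b (s ∘ Equiv.swap i j) := by
    funext x
    cases x using Fin.cases with
    | zero =>
      simp [Equiv.swap_apply_of_ne_of_ne (Fin.succ_ne_zero i).symm (Fin.succ_ne_zero j).symm]
    | succ x =>
      have : Equiv.swap i.succ j.succ x.succ = (Equiv.swap i j x).succ := by
        simp only [Equiv.swap_apply_def, Fin.succ_inj]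
        split_ifs <;> rfl
      simp [this]
  rw [tensorOp_apply, tensorOp_apply, this]
  simp

theorem tensorOp_zero_one (q : ℂ) {n : ℕ} (y : Tensor (n + 2)) (a b : Bool) (s : Fin n → Bool) :
    tensorOp q 0 1 y (Fin.cons a (Fin.cons b s)) = if a = b then 0 else
      (if a then q⁻¹ else q) * y (Fin.cons a (Fin.cons b s)) + y (Fin.cons b (Fin.cons a s)) := by
  have : (Fin.cons a (Fin.cons b s) : Fin (n + 2) → Bool) ∘ Equiv.swap 0 1
      = Fin.cons b (Fin.cons a s) := by
    funext x
    cases x using Fin.cases with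
    | zero => simp
    | succ x =>
      cases x using Fin.cases with
      | zero => simp
      | succ x =>
        have h1 : x.succ.succ ≠ (1 : Fin (n + 2)) := fun h =>
          Fin.succ_ne_zero x (Fin.succ_injective _ h)
        rw [Function.comp_apply, Equiv.swap_apply_of_ne_of_ne (Fin.succ_ne_zero _) h1]
        simp
  rw [tensorOp_apply, this]
  simp

/-- Injectivity of `toTensor` moves the check to tensor space, where a generator away from the first
point acts slice by slice; this avoids cases on link states. -/
theorem addStrand_cc (q : ℂ) (hq : q ≠ 0) (n p k : ℕ) (hk : k + 1 < n) (v : Std (loop q) n p) :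
    addStrand (loop q) n p (cc (loop q) n k hk • v)
      = cc (loop q) (n + 1) (k + 1) (Nat.succ_lt_succ hk) • addStrand (loop q) n p v := by
  apply toTensor_injective
  rw [toTensor_cc q hq]
  refine tensor_ext fun b s => ?_
  have := tensorOp_cons q ⟨k, Nat.lt_of_succ_lt hk⟩ ⟨k + 1, hk⟩
    (toTensor q (n + 1) p (addStrand (loop q) n p v)) b s
  refine Eq.trans ?_ this.symm
  rw [toTensor_addStrand, toTensor_cc q hq]
  simp only [toTensor_addStrand]
  cases b
  · simp
  · simp [tensorOp_apply]

theorem openCup_cc (q : ℂ) (hq : q ≠ 0) (n p k : ℕ) (hk : k + 1 < n)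
    (v : Std (loop q) (n + 1) (p + 1)) :
    openCup (loop q) n p (cc (loop q) (n + 1) (k + 1) (Nat.succ_lt_succ hk) • v) = cc (loop q) n k hk • openCup (loop q) n p v := by
  apply toTensor_injective
  funext s
  rw [← toTensor_openCup, toTensor_cc q hq, toTensor_cc q hq]
  refine (tensorOp_cons q ⟨k, Nat.lt_of_succ_lt hk⟩ ⟨k + 1, hk⟩ _ true s).trans ?_
  simp only [toTensor_openCup]

theorem addCup_cc (q : ℂ) (hq : q ≠ 0) (n p k : ℕ) (hk : k + 1 < n) (v : Std (loop q) n p) :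
    addCup (loop q) n p (cc (loop q) n k hk • v) = cc (loop q) (n + 2) (k + 2) (by omega) • addCup (loop q) n p v := by
  apply toTensor_injective
  rw [toTensor_cc q hq]
  refine tensor_ext fun a s => ?_
  have h1 := tensorOp_cons q ⟨k + 1, by omega⟩ ⟨k + 2, by omega⟩
    (toTensor q (n + 2) (p + 1) (addCup (loop q) n p v)) a s
  refine Eq.trans ?_ h1.symm
  suffices key : (fun s => toTensor q (n + 2) (p + 1)
      (addCup (loop q) n p (cc (loop q) n k hk • v)) (Fin.cons a s))
      = tensorOp q ⟨k + 1, by omega⟩ ⟨k + 2, by omega⟩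
        fun s => toTensor q (n + 2) (p + 1) (addCup (loop q) n p v) (Fin.cons a s) from
    congrFun key s
  refine tensor_ext fun b s => ?_
  have h2 := tensorOp_cons q ⟨k, by omega⟩ ⟨k + 1, hk⟩
    (fun t => toTensor q (n + 2) (p + 1) (addCup (loop q) n p v) (Fin.cons a t)) b s
  refine Eq.trans ?_ h2.symm
  rw [toTensor_addCup, toTensor_cc q hq]
  simp only [toTensor_addCup]
  by_cases h : a = b
  · simp [h, tensorOp_apply]
  · simp only [h, if_false]
    exact (congrFun (map_smul (tensorOp q ⟨k, Nat.lt_of_succ_lt hk⟩ ⟨k + 1, hk⟩)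
      (if a then 1 else q) (toTensor q n p v)) s).symm

theorem addStrand_smul (q : ℂ) (hq : q ≠ 0) (n p : ℕ) (a : TL (loop q) n) (v : Std (loop q) n p) :
    addStrand (loop q) n p (a • v) = shift (loop q) n a • addStrand (loop q) n p v :=
  intertwine (shift (loop q) n) (addStrand (loop q) n p) (fun i v => by
    rw [← cc, shift_cc]
    exact addStrand_cc q hq n p i i.2 v) a v

theorem openCup_smul (q : ℂ) (hq : q ≠ 0) (n p : ℕ) (a : TL (loop q) n)
    (v : Std (loop q) (n + 1) (p + 1)) :
    openCup (loop q) n p (shift (loop q) n a • v) = a • openCup (loop q) n p v := by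
  revert v
  induction a using alg_induction with
  | halg c => intro v; rw [AlgHom.commutes, algebraMap_smul, algebraMap_smul, map_smul]
  | hgen i => intro v; rw [← cc, shift_cc]; exact openCup_cc q hq n p i i.2 v
  | hmul a b ha hb => intro v; rw [map_mul, mul_smul, ha, hb, mul_smul]
  | hadd a b ha hb => intro v; rw [map_add, add_smul, map_add, ha, hb, add_smul]

theorem addCup_smul (q : ℂ) (hq : q ≠ 0) (n p : ℕ) (a : TL (loop q) n) (v : Std (loop q) n p) :
    addCup (loop q) n p (a • v) = shiftTwo (loop q) n a • addCup (loop q) n p v :=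
  intertwine (shiftTwo (loop q) n) (addCup (loop q) n p) (fun i v => by
    rw [← cc, shiftTwo_cc]
    exact addCup_cc q hq n p i i.2 v) a v

/-! ### Cups at the first two points -/

theorem addCup_ofLink (δ : ℂ) {n p : ℕ} (w : LinkState n p) :
    addCup δ n p (Std.ofLink δ w) = Std.ofLink δ w.addCup := Std.lift_ofLink _ _ _

theorem cc_smul_mate (δ : ℂ) {n p k : ℕ} (hk : k + 1 < n) (w : LinkState n p)
    (h : w.mate ⟨k, Nat.lt_of_succ_lt hk⟩ = ⟨k + 1, hk⟩) :
    cc δ n k hk • Std.ofLink δ w = δ • Std.ofLink δ w := by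
  rw [cc_smul_std, stackOp_ofLink, stack_mate _ _ _ _ _ h]

theorem cc_cc_smul_mate (δ : ℂ) {n p k j : ℕ} (hk : k + 1 < n) (hj : j + 1 < n)
    (hkj : k + 1 = j ∨ j + 1 = k) (w : LinkState n p)
    (h : w.mate ⟨k, Nat.lt_of_succ_lt hk⟩ = ⟨k + 1, hk⟩) :
    cc δ n k hk • cc δ n j hj • Std.ofLink δ w = Std.ofLink δ w := by
  rw [cc_smul_std, cc_smul_std]
  refine stack_zigzag_aux δ _ _ _ _ rfl rfl ?_ w h
  simp only [Fin.mk.injEq]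
  omega

theorem cc_zero_addCup (δ : ℂ) {n p : ℕ} (v : Std δ n p) :
    cc δ (n + 2) 0 (by omega) • addCup δ n p v = δ • addCup δ n p v := by
  refine LinearMap.congr_fun (f := Algebra.lsmul ℂ ℂ _ (cc δ (n + 2) 0 (by omega)) ∘ₗ addCup δ n p)
    (g := δ • addCup δ n p) (Std.ext_hom fun w => ?_) v
  rw [LinearMap.comp_apply, LinearMap.smul_apply, addCup_ofLink]
  exact cc_smul_mate δ _ _ rfl

/-- This zigzag recovers a cup without division by `δ`, so that the arguments below include `δ = 0`.
It needs a third strand, whence `1 ≤ n`. -/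
theorem cc_zero_one_addCup (δ : ℂ) {n p : ℕ} (hn : 1 ≤ n) (v : Std δ n p) :
    cc δ (n + 2) 0 (by omega) • cc δ (n + 2) 1 (by omega) • addCup δ n p v = addCup δ n p v := by
  refine LinearMap.congr_fun (f := Algebra.lsmul ℂ ℂ _ (cc δ (n + 2) 0 (by omega)) ∘ₗ
    Algebra.lsmul ℂ ℂ _ (cc δ (n + 2) 1 (by omega)) ∘ₗ addCup δ n p)
    (g := addCup δ n p) (Std.ext_hom fun w => ?_) v
  rw [LinearMap.comp_apply, LinearMap.comp_apply, addCup_ofLink]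
  exact cc_cc_smul_mate δ _ _ (by omega) _ rfl

theorem exists_addCup_stack (δ : ℂ) {n p : ℕ} (w : LinkState (n + 2) (p + 1)) :
    ∃ z, addCup δ n p z = cc δ (n + 2) 0 (by omega) • Std.ofLink δ w := by
  rw [cc_smul_std, stackOp_ofLink]
  set i : Fin (n + 2) := ⟨0, _⟩
  set j : Fin (n + 2) := ⟨0 + 1, _⟩
  have hij : (i : ℕ) + 1 = j := rfl
  by_cases h1 : w.mate i = j
  · obtain ⟨v, rfl⟩ := w.exists_addCup h1
    exact ⟨δ • Std.ofLink δ v, by rw [stack_mate _ _ _ _ _ h1, map_smul, addCup_ofLink]⟩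
  by_cases h2 : w.mate i = i ∧ w.mate j = j
  · exact ⟨0, by rw [stack_through _ _ _ _ _ h2, map_zero]⟩
  · obtain ⟨v, hv⟩ := (w.join i j hij h1 h2).exists_addCup (by
      change joinMate w.mate i j i = j
      simp [joinMate])
    exact ⟨Std.ofLink δ v, by rw [stack_join _ _ _ _ _ h1 h2, addCup_ofLink, hv]⟩

theorem openCup_addCup (δ : ℂ) {n p : ℕ} (v : Std δ n p) :
    openCup δ (n + 1) p (addCup δ n p v) = addStrand δ n p v := by
  refine LinearMap.congr_fun (f := openCup δ (n + 1) p ∘ₗ addCup δ n p)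
    (g := addStrand δ n p) (Std.ext_hom fun w => ?_) v
  have h : w.addCup.mate 0 ≠ 0 := LinkState.close_zero_ne _ _ _ _
  rw [LinearMap.comp_apply, addCup_ofLink, openCup, Std.lift_ofLink, dif_neg h, addStrand,
    Std.lift_ofLink]
  congr 1
  exact LinkState.openFirst_close _ _ _ _ _

/-- Connect the first two points. -/
noncomputable def cap (δ : ℂ) (n p : ℕ) : Std δ (n + 2) (p + 1) →ₗ[ℂ] Std δ n p :=
  dropStrand δ n p ∘ₗ openCup δ (n + 1) p ∘ₗ Algebra.lsmul ℂ ℂ _ (cc δ (n + 2) 0 (by omega))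

theorem addCup_injective (δ : ℂ) (n p : ℕ) : Function.Injective (addCup δ n p) := by
  intro v v' h
  rw [← dropStrand_addStrand δ n p v, ← openCup_addCup, h, openCup_addCup,
    dropStrand_addStrand]

/-- The diagram of the first generator is a cap followed by a cup, so its action factors through two
strands fewer. -/
theorem addCup_cap (δ : ℂ) {n p : ℕ} (v : Std δ (n + 2) (p + 1)) :
    addCup δ n p (cap δ n p v) = cc δ (n + 2) 0 (by omega) • v := by
  refine LinearMap.congr_fun (f := addCup δ n p ∘ₗ cap δ n p)
    (g := Algebra.lsmul ℂ ℂ _ (cc δ (n + 2) 0 (by omega))) (Std.ext_hom fun w => ?_) v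
  obtain ⟨z, hz⟩ := exists_addCup_stack δ w
  change addCup δ n p (dropStrand δ n p (openCup δ (n + 1) p (cc δ (n + 2) 0 _ • Std.ofLink δ w)))
    = cc δ (n + 2) 0 _ • Std.ofLink δ w
  rw [← hz, openCup_addCup, dropStrand_addStrand]

theorem cap_cc_one_addCup (δ : ℂ) {n p : ℕ} (hn : 1 ≤ n) (v : Std δ n p) :
    cap δ n p (cc δ (n + 2) 1 (by omega) • addCup δ n p v) = v := by
  apply addCup_injective
  rw [addCup_cap, cc_zero_one_addCup δ hn]

theorem cap_addCup (δ : ℂ) {n p : ℕ} (v : Std δ n p) : cap δ n p (addCup δ n p v) = δ • v := by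
  apply addCup_injective
  rw [addCup_cap, cc_zero_addCup, map_smul]

theorem cc_smul_idle (δ : ℂ) {n k : ℕ} (hk : k + 1 < n) (v : Std δ n 0) : cc δ n k hk • v = 0 := by
  obtain ⟨c, rfl⟩ := std_zero_eq δ n v
  rw [smul_comm, cc_smul_std, stackOp_ofLink, stack_through, smul_zero]
  exact ⟨rfl, rfl⟩

/-- A subspace of a standard representation is everything if it contains the states with a cup in
front and is stable under the generators. -/
theorem cup_induction {δ : ℂ} {n p : ℕ} (N : Submodule (TL δ (n + 2)) (Std δ (n + 2) (p + 1)))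
    (h : ∀ v, addCup δ n p v ∈ N) : N = ⊤ := by
  have key : ∀ k : ℕ, ∀ hk : k + 1 < n + 2, ∀ w : LinkState (n + 2) (p + 1),
      w.mate ⟨k, Nat.lt_of_succ_lt hk⟩ = ⟨k + 1, hk⟩ → Std.ofLink δ w ∈ N := by
    intro k
    induction k with
    | zero =>
      intro hk w hw
      obtain ⟨v, rfl⟩ := w.exists_addCup hw
      rw [← addCup_ofLink]
      exact h _
    | succ k ih =>
      intro hk w hw
      -- The zigzag `e (k+1) e k w = w` reduces to `e k w`, which is zero or a multiple of a state
      -- with a cup one place further to the left.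
      have h1 := cc_cc_smul_mate δ hk (j := k) (by omega) (by omega) w hw
      rw [← h1]
      refine N.smul_mem _ ?_
      rw [cc_smul_std, stackOp_ofLink]
      set i : Fin (n + 2) := ⟨k, _⟩
      set j : Fin (n + 2) := ⟨k + 1, _⟩
      have hij : (i : ℕ) + 1 = j := rfl
      by_cases h1 : w.mate i = j
      · rw [stack_mate _ _ _ _ _ h1]
        have := N.smul_mem (algebraMap ℂ _ δ) (ih (by omega) w h1)
        rwa [algebraMap_smul] at this
      by_cases h2 : w.mate i = i ∧ w.mate j = j
      · rw [stack_through _ _ _ _ _ h2]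
        exact N.zero_mem
      · rw [stack_join _ _ _ _ _ h1 h2]
        refine ih (by omega) _ ?_
        change joinMate w.mate i j i = j
        simp [joinMate]
  rw [eq_top_iff]
  intro v _
  refine Std.induction (N.restrictScalars ℂ) (fun w => ?_) v
  obtain ⟨i, j, hij, hw⟩ := w.exists_adjacent
  have hj : (i : ℕ) + 1 < n + 2 := by omega
  refine key i hj w ?_
  rw [Fin.eta, hw]
  exact Fin.ext hij.symm

/-! ### The bilinear form -/

/-- The matrix is symmetric: a diagonal part, and a part that permutes the basis by an involution.
-/
theorem tensorOp_symm (q : ℂ) {n : ℕ} (i j : Fin n) (y y' : Tensor n) :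
    tensorOp q i j y ⬝ᵥ y' = y ⬝ᵥ tensorOp q i j y' := by
  have h : ∀ y y' : Tensor n, tensorOp q i j y ⬝ᵥ y'
      = ∑ s, (if s i = s j then 0 else (if s i then q⁻¹ else q) * y s * y' s)
        + ∑ s, if s i = s j then 0 else y (s ∘ Equiv.swap i j) * y' s := by
    intro y y'
    rw [dotProduct, ← Finset.sum_add_distrib]
    refine Finset.sum_congr rfl fun s _ => ?_
    rw [tensorOp_apply]
    split_ifs <;> ring
  rw [dotProduct_comm y, h, h]
  congr 1
  · refine Finset.sum_congr rfl fun s _ => ?_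
    split_ifs <;> ring
  · let e : (Fin n → Bool) ≃ (Fin n → Bool) :=
      { toFun := fun s => s ∘ Equiv.swap i j
        invFun := fun s => s ∘ Equiv.swap i j
        left_inv := fun s => by funext x; simp
        right_inv := fun s => by funext x; simp }
    refine Fintype.sum_equiv e _ _ fun s => ?_
    have he : e s ∘ Equiv.swap i j = s := e.left_inv s
    have h1 : e s i = s j := by simp [e]
    have h2 : e s j = s i := by simp [e]
    rw [he, h1, h2, mul_comm]
    simp only [eq_comm]
    rfl

/-- The invariant bilinear form. -/
noncomputable def form (q : ℂ) (n p : ℕ) : Std (loop q) n p →ₗ[ℂ] Std (loop q) n p →ₗ[ℂ] ℂ :=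
  LinearMap.mk₂ ℂ (fun v v' => toTensor q n p v ⬝ᵥ toTensor q n p v')
    (fun _ _ _ => by rw [map_add, add_dotProduct]) (fun _ _ _ => by rw [map_smul, smul_dotProduct])
    (fun _ _ _ => by rw [map_add, dotProduct_add]) (fun _ _ _ => by rw [map_smul, dotProduct_smul])

theorem form_apply (q : ℂ) {n p : ℕ} (v v' : Std (loop q) n p) :
    form q n p v v' = toTensor q n p v ⬝ᵥ toTensor q n p v' := rfl

theorem form_comm (q : ℂ) {n p : ℕ} (v v' : Std (loop q) n p) : form q n p v v' = form q n p v' v :=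
  dotProduct_comm _ _

theorem form_cc (q : ℂ) (hq : q ≠ 0) {n p k : ℕ} (hk : k + 1 < n) (v v' : Std (loop q) n p) :
    form q n p (cc (loop q) n k hk • v) v' = form q n p v (cc (loop q) n k hk • v') := by
  rw [form_apply, form_apply, toTensor_cc q hq, toTensor_cc q hq, tensorOp_symm]

theorem dotProduct_cons {n : ℕ} (y y' : Tensor (n + 1)) :
    y ⬝ᵥ y' = (fun s => y (Fin.cons false s)) ⬝ᵥ (fun s => y' (Fin.cons false s))
      + (fun s => y (Fin.cons true s)) ⬝ᵥ (fun s => y' (Fin.cons true s)) := by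
  simp only [dotProduct]
  rw [← (Fin.consEquiv fun _ : Fin (n + 1) => Bool).sum_comp, Fintype.sum_prod_type]
  simp only [Fintype.sum_bool]
  rw [add_comm]
  rfl

theorem form_addStrand (q : ℂ) {n p : ℕ} (v v' : Std (loop q) n p) :
    form q (n + 1) p (addStrand _ n p v) (addStrand _ n p v') = form q n p v v' := by
  rw [form_apply, dotProduct_cons]
  simp only [toTensor_addStrand]
  simp [form_apply, dotProduct]

/-- Up to the factor `q`, cup and cap are adjoint: the cup vector has coordinates `q` and `1`, and
the cap pairs the first two factors with the vector of coordinates `1` and `q⁻¹`. -/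
theorem form_addCup (q : ℂ) (hq : q ≠ 0) {n p : ℕ} (v : Std (loop q) n p)
    (v' : Std (loop q) (n + 2) (p + 1)) :
    form q (n + 2) (p + 1) (addCup _ n p v) v' = q * form q n p v (cap _ n p v') := by
  have h : ∀ s, q * toTensor q n p (cap _ n p v') s
      = q * toTensor q _ _ v' (Fin.cons false (Fin.cons true s))
        + toTensor q _ _ v' (Fin.cons true (Fin.cons false s)) := by
    intro s
    have h1 := toTensor_addCup q (cap _ n p v') false true s
    rw [addCup_cap, toTensor_cc q hq] at h1
    have h2 := tensorOp_zero_one q (toTensor q _ _ v') false true s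
    rw [if_neg (by simp), if_neg (by simp)] at h1 h2
    rw [← h1]
    exact h2
  rw [form_apply, form_apply, dotProduct_cons, dotProduct_cons, dotProduct_cons, ← smul_eq_mul,
    ← dotProduct_smul]
  have h' : q • toTensor q n p (cap _ n p v') = fun s =>
      q * toTensor q _ _ v' (Fin.cons false (Fin.cons true s))
        + toTensor q _ _ v' (Fin.cons true (Fin.cons false s)) := funext h
  rw [h']
  simp only [toTensor_addCup]
  simp only [dotProduct, ← Finset.sum_add_distrib]
  refine Finset.sum_congr rfl fun s _ => ?_
  simp
  ring

theorem form_addCup_cc_one (q : ℂ) (hq : q ≠ 0) {n p : ℕ} (hn : 1 ≤ n) (v v' : Std (loop q) n p) :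
    form q (n + 2) (p + 1) (addCup _ n p v) (cc (loop q) (n + 2) 1 (by omega) • addCup _ n p v')
      = q * form q n p v v' := by
  rw [form_addCup q hq, cap_cc_one_addCup _ hn]

theorem form_idle (q : ℂ) (n : ℕ) : form q n 0 (Std.ofLink _ (LinkState.idle n))
    (Std.ofLink _ (LinkState.idle n)) = 1 := by
  induction n with
  | zero => simp [form_apply, toTensor_ofLink, dotProduct, linkTensor_idle]
  | succ n ih => rw [← addStrand_idle, form_addStrand, ih]

/-- The radical of the bilinear form. -/
noncomputable def rad (q : ℂ) (hq : q ≠ 0) (n p : ℕ) :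
    Submodule (TL (loop q) n) (Std (loop q) n p) :=
  ofStable (LinearMap.ker (form q n p)) fun i v hv => by
    rw [LinearMap.mem_ker] at hv ⊢
    ext v'
    rw [← cc, form_cc q hq, hv]
    rfl

theorem mem_rad {q : ℂ} {hq : q ≠ 0} {n p : ℕ} {v : Std (loop q) n p} :
    v ∈ rad q hq n p ↔ ∀ v', form q n p v v' = 0 := by
  rw [rad, mem_ofStable, LinearMap.mem_ker]
  exact ⟨fun h v' => by rw [h]; rfl, fun h => LinearMap.ext h⟩

/-! ### Gaussian binomial coefficients at roots of unity -/

/-- Gaussian binomial coefficients. -/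
noncomputable def gaussBinom (ω : ℂ) : ℕ → ℕ → ℂ
  | _, 0 => 1
  | 0, _ + 1 => 0
  | n + 1, i + 1 => ω ^ (i + 1) * gaussBinom ω n (i + 1) + gaussBinom ω n i

theorem gaussBinom_zero (ω : ℂ) (n : ℕ) : gaussBinom ω n 0 = 1 := by
  cases n <;> rw [gaussBinom]

theorem gaussBinom_succ (ω : ℂ) (n i : ℕ) : gaussBinom ω (n + 1) (i + 1)
    = ω ^ (i + 1) * gaussBinom ω n (i + 1) + gaussBinom ω n i := by rw [gaussBinom]

theorem gaussBinom_of_lt (ω : ℂ) {n i : ℕ} (h : n < i) : gaussBinom ω n i = 0 := by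
  induction n generalizing i with
  | zero =>
    cases i with
    | zero => omega
    | succ i => rw [gaussBinom]
  | succ n ih =>
    cases i with
    | zero => omega
    | succ i => rw [gaussBinom_succ, ih (by omega), ih (by omega), mul_zero, add_zero]

theorem gaussBinom_self (ω : ℂ) (n : ℕ) : gaussBinom ω n n = 1 := by
  induction n with
  | zero => exact gaussBinom_zero ω 0
  | succ n ih => rw [gaussBinom_succ, ih, gaussBinom_of_lt ω (Nat.lt_succ_self n), mul_zero, zero_add]

/-- The `q`-analogue of `(i+1) C(n+1,i+1) = (n+1) C(n,i)`. At a root of unity of order `l` it makes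
the inner coefficients of row `l` vanish. -/
theorem gaussBinom_absorb (ω : ℂ) (n i : ℕ) :
    (ω ^ (i + 1) - 1) * gaussBinom ω (n + 1) (i + 1) = (ω ^ (n + 1) - 1) * gaussBinom ω n i := by
  induction n generalizing i with
  | zero =>
    rw [gaussBinom_succ, gaussBinom_of_lt ω (Nat.succ_pos i)]
    cases i with
    | zero => simp [gaussBinom_zero]
    | succ i => simp [gaussBinom_of_lt ω (Nat.succ_pos i)]
  | succ n ih =>
    rw [gaussBinom_succ, mul_add, mul_left_comm, ih i]
    cases i with
    | zero => simp only [gaussBinom_zero]; ring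
    | succ i =>
      have h := ih i
      rw [gaussBinom_succ] at h ⊢
      linear_combination ω * h

variable {ω : ℂ} {l : ℕ}

theorem gaussBinom_root (hω : IsPrimitiveRoot ω l) {i : ℕ} (h0 : 0 < i) (hi : i < l) :
    gaussBinom ω l i = 0 := by
  obtain ⟨i, rfl⟩ := Nat.exists_eq_succ_of_ne_zero h0.ne'
  obtain ⟨m, rfl⟩ := Nat.exists_eq_succ_of_ne_zero (show l ≠ 0 by omega)
  have h := gaussBinom_absorb ω m i
  rw [show ω ^ (m + 1) = 1 from hω.pow_eq_one, sub_self, zero_mul] at h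
  exact (mul_eq_zero.1 h).resolve_left (sub_ne_zero.2 (hω.pow_ne_one_of_pos_of_lt (by omega) hi))

/-- Below column `l`, row `l` agrees with row `0`, and the Pascal recursion carries this periodicity
along. -/
theorem gaussBinom_add (hω : IsPrimitiveRoot ω l) (n : ℕ) {i : ℕ} (hi : i < l) :
    gaussBinom ω (n + l) i = gaussBinom ω n i := by
  induction n generalizing i with
  | zero =>
    rcases Nat.eq_zero_or_pos i with rfl | h0
    · rw [gaussBinom_zero, gaussBinom_zero]
    · rw [zero_add, gaussBinom_root hω h0 hi, gaussBinom_of_lt ω h0]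
  | succ n ih =>
    cases i with
    | zero => rw [gaussBinom_zero, gaussBinom_zero]
    | succ i =>
      rw [show n + 1 + l = n + l + 1 by omega, gaussBinom_succ, gaussBinom_succ, ih hi,
        ih (by omega)]

theorem gaussBinom_mod (hω : IsPrimitiveRoot ω l) (n : ℕ) {i : ℕ} (hi : i < l) :
    gaussBinom ω n i = gaussBinom ω (n % l) i := by
  have h : ∀ k m, gaussBinom ω (m + k * l) i = gaussBinom ω m i := by
    intro k
    induction k with
    | zero => intro m; simp
    | succ k ih => intro m; rw [Nat.succ_mul, ← add_assoc, gaussBinom_add hω _ hi, ih]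
  conv_lhs => rw [← Nat.mod_add_div' n l]
  exact h _ _

/-- In column `l` the factor of the Pascal recursion is `ω ^ l = 1`, and the other summand is
periodic by `gaussBinom_add`. -/
theorem gaussBinom_add_self (hω : IsPrimitiveRoot ω l) (hl : 0 < l) (n : ℕ) :
    gaussBinom ω (n + l) l = gaussBinom ω n l + 1 := by
  induction n with
  | zero => rw [zero_add, gaussBinom_self, gaussBinom_of_lt ω hl, zero_add]
  | succ n ih =>
    obtain ⟨i, rfl⟩ := Nat.exists_eq_succ_of_ne_zero hl.ne'
    rw [show n + 1 + (i + 1) = n + (i + 1) + 1 by omega, Nat.succ_eq_add_one, gaussBinom_succ,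
      gaussBinom_succ, ih, gaussBinom_add hω n (Nat.lt_succ_self i), mul_add,
      show ω ^ (i + 1) = 1 from hω.pow_eq_one]
    ring

theorem gaussBinom_mod_self (hω : IsPrimitiveRoot ω l) (hl : 0 < l) (n : ℕ) :
    gaussBinom ω n (n % l) = 1 := by
  rw [gaussBinom_mod hω n (Nat.mod_lt n hl), gaussBinom_self]

theorem gaussBinom_one_ne_zero (hω : IsPrimitiveRoot ω l) (hl : 2 ≤ l) {n : ℕ} (hn : n % l ≠ 0) :
    gaussBinom ω n 1 ≠ 0 := by
  rw [gaussBinom_mod hω n (by omega)]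
  obtain ⟨m, hm⟩ := Nat.exists_eq_succ_of_ne_zero hn
  have hlt := Nat.mod_lt n (show l > 0 by omega)
  rw [hm] at hlt ⊢
  intro h
  have h' := gaussBinom_absorb ω m 0
  rw [Nat.succ_eq_add_one, zero_add] at *
  rw [h, mul_zero, gaussBinom_zero, mul_one] at h'
  exact hω.pow_ne_one_of_pos_of_lt (by omega) hlt (sub_eq_zero.1 h'.symm)

/-- The coefficient is the integer quotient `n / l`, nonzero in characteristic zero. This and the
two preceding lemmas are the nonvanishing facts that exclude trivial subquotients in
`trivialBound_step`. -/
theorem gaussBinom_self_ne_zero (hω : IsPrimitiveRoot ω l) (hl : 0 < l) {n : ℕ} (hn : l ≤ n) :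
    gaussBinom ω n l ≠ 0 := by
  have h : ∀ k m, gaussBinom ω (m + k * l) l = gaussBinom ω m l + k := by
    intro k
    induction k with
    | zero => intro m; simp
    | succ k ih =>
      intro m
      rw [Nat.succ_mul, ← add_assoc, gaussBinom_add_self hω hl, ih]
      push_cast
      ring
  rw [← Nat.mod_add_div' n l, h, gaussBinom_of_lt ω (Nat.mod_lt n hl), zero_add]
  have := Nat.div_pos hn hl
  exact_mod_cast this.ne'

/-! ### Symmetric tensors -/

/-- The symmetric tensor of a given weight. -/
noncomputable def symTensor (ρ : ℂ) : (n i : ℕ) → Tensor n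
  | 0, 0 => fun _ => 1
  | 0, _ + 1 => 0
  | n + 1, 0 => fun s => if s 0 then 0 else symTensor ρ n 0 (Fin.tail s)
  | n + 1, i + 1 => fun s =>
    if s 0 then symTensor ρ n i (Fin.tail s) else ρ ^ (i + 1) * symTensor ρ n (i + 1) (Fin.tail s)

theorem symTensor_false (ρ : ℂ) (n i : ℕ) (s : Fin n → Bool) :
    symTensor ρ (n + 1) i (Fin.cons false s) = ρ ^ i * symTensor ρ n i s := by
  cases i <;> simp [symTensor]

theorem symTensor_true (ρ : ℂ) (n i : ℕ) (s : Fin n → Bool) :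
    symTensor ρ (n + 1) (i + 1) (Fin.cons true s) = symTensor ρ n i s := by
  simp [symTensor]

theorem symTensor_true_zero (ρ : ℂ) (n : ℕ) (s : Fin n → Bool) :
    symTensor ρ (n + 1) 0 (Fin.cons true s) = 0 := by
  simp [symTensor]

/-- Splitting off the first index squares the factor `ρ ^ i` and gives the Pascal recursion for `ρ ^
2`. -/
theorem symTensor_dotProduct (ρ : ℂ) (n i : ℕ) :
    symTensor ρ n i ⬝ᵥ symTensor ρ n i = gaussBinom (ρ ^ 2) n i := by
  induction n generalizing i with
  | zero => cases i <;> simp [symTensor, dotProduct, gaussBinom]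
  | succ n ih =>
    rw [dotProduct_cons]
    have h : ∀ i, (fun s => symTensor ρ (n + 1) i (Fin.cons false s))
        = ρ ^ i • symTensor ρ n i := fun i => funext fun s => symTensor_false ρ n i s
    rw [h, smul_dotProduct, dotProduct_smul, ih]
    cases i with
    | zero =>
      simp only [symTensor_true_zero]
      simp [gaussBinom_zero, dotProduct]
    | succ i =>
      simp only [symTensor_true]
      rw [ih, gaussBinom_succ]
      simp only [smul_eq_mul]
      ring

theorem symTensor_ne_zero (ρ : ℂ) {n i : ℕ} (h : i ≤ n) : symTensor ρ n i ≠ 0 := by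
  induction n generalizing i with
  | zero =>
    obtain rfl : i = 0 := by omega
    intro h
    have := congrFun h Fin.elim0
    simp [symTensor] at this
  | succ n ih =>
    intro h0
    cases i with
    | zero =>
      refine ih (Nat.zero_le n) (funext fun s => ?_)
      have := congrFun h0 (Fin.cons false s)
      rwa [symTensor_false, pow_zero, one_mul] at this
    | succ i =>
      refine ih (show i ≤ n by omega) (funext fun s => ?_)
      have := congrFun h0 (Fin.cons true s)
      rwa [symTensor_true] at this

theorem symTensor_of_lt (ρ : ℂ) {n i : ℕ} (h : n < i) : symTensor ρ n i = 0 := by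
  induction n generalizing i with
  | zero =>
    cases i with
    | zero => omega
    | succ i => rw [symTensor]
  | succ n ih =>
    obtain ⟨i, rfl⟩ := Nat.exists_eq_succ_of_ne_zero (show i ≠ 0 by omega)
    refine tensor_ext fun b s => ?_
    cases b
    · rw [symTensor_false, ih (by omega)]; simp
    · rw [symTensor_true, ih (by omega)]; simp

/-- The tensors of weight `p`. -/
def HasWeight {n : ℕ} (p : ℕ) (y : Tensor n) : Prop :=
  ∀ s, y s ≠ 0 → (Finset.univ.filter fun x => s x = true).card = p

/-- Where the tensor does not vanish, each cup has exactly one end labelled `true` and each through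
strand is labelled `false`. -/
theorem linkTensor_hasWeight (q : ℂ) {n p : ℕ} (w : LinkState n p) :
    HasWeight p (linkTensor q w.mate) := by
  intro s hs
  have hf : ∀ x, linkFactor q w.mate s x ≠ 0 := fun x h => hs (linkTensor_eq_zero q x h)
  have hm := w.mate_mate
  have h1 : ∀ x, w.mate x = x → s x = false := by
    intro x hx
    have := hf x
    rw [linkFactor_self q s hx] at this
    simpa using this
  have h2 : ∀ x, x < w.mate x → s x ≠ s (w.mate x) := by
    intro x hx h
    have := hf x
    rw [linkFactor_lt q s hx, if_pos h] at this
    exact this rfl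
  have h3 : ∀ x, w.mate x ≠ x → s (w.mate x) = !s x := by
    intro x hx
    rcases lt_or_gt_of_ne hx with h | h
    · have := h2 (w.mate x) (by rwa [hm])
      rw [hm] at this
      revert this
      cases s x <;> cases s (w.mate x) <;> simp
    · have := h2 x h
      revert this
      cases s x <;> cases s (w.mate x) <;> simp
  have hc := w.card_through
  set A := Finset.univ.filter fun x => s x = true
  set T := Finset.univ.filter fun x => w.mate x = x
  have hB : (A.image w.mate).card = A.card :=
    Finset.card_image_of_injective _ (Function.LeftInverse.injective hm)
  have hAB : Disjoint A (A.image w.mate) := by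
    rw [Finset.disjoint_left]
    intro x hx hx'
    obtain ⟨y, hy, rfl⟩ := Finset.mem_image.1 hx'
    simp only [A, Finset.mem_filter, Finset.mem_univ, true_and] at hx hy
    by_cases h : w.mate y = y
    · have := h1 y h; simp_all
    · have := h3 y h; simp_all
  have hT : Disjoint (A ∪ A.image w.mate) T := by
    rw [Finset.disjoint_left]
    intro x hx hx'
    simp only [T, Finset.mem_filter, Finset.mem_univ, true_and] at hx'
    rcases Finset.mem_union.1 hx with h | h
    · have := h1 x hx'
      rw [(Finset.mem_filter.1 h).2] at this
      simp at this
    · obtain ⟨y, hy, rfl⟩ := Finset.mem_image.1 h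
      rw [hm] at hx'
      have := h1 y hx'.symm
      rw [(Finset.mem_filter.1 hy).2] at this
      simp at this
  have hU : (A ∪ A.image w.mate) ∪ T = Finset.univ := by
    ext x
    simp only [Finset.mem_union, Finset.mem_univ, iff_true]
    by_cases h : w.mate x = x
    · right; simpa [T]
    · left
      cases hx : s x
      · right
        refine Finset.mem_image.2 ⟨w.mate x, ?_, hm x⟩
        simp [A, h3 x h, hx]
      · left
        simpa [A]
  have := congrArg Finset.card hU
  rw [Finset.card_union_of_disjoint hT, Finset.card_union_of_disjoint hAB, hB, Finset.card_univ,
    Fintype.card_fin] at this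
  omega

theorem toTensor_hasWeight (q : ℂ) {n p : ℕ} (v : Std (loop q) n p) :
    HasWeight p (toTensor q n p v) := by
  let N : Submodule ℂ (Std (loop q) n p) :=
    { carrier := {v | HasWeight p (toTensor q n p v)}
      zero_mem' := fun s hs => absurd (by rw [map_zero]; rfl) hs
      add_mem' := fun {a b} ha hb s hs => by
        rw [map_add, Pi.add_apply] at hs
        by_cases h : toTensor q n p a s = 0
        · rw [h, zero_add] at hs; exact hb s hs
        · exact ha s h
      smul_mem' := fun c a ha s hs => by
        rw [map_smul, Pi.smul_apply] at hs
        exact ha s fun h => hs (by rw [h, smul_zero]) }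
  exact Std.induction N (fun w => by
    change HasWeight p _
    rw [toTensor_ofLink]
    exact linkTensor_hasWeight q w) v

theorem HasWeight.tail_false {n p : ℕ} {y : Tensor (n + 1)} (h : HasWeight p y) :
    HasWeight p fun s => y (Fin.cons false s) := by
  intro s hs
  have := h _ hs
  rw [Fin.card_filter_univ_succ, if_neg (by simp)] at this
  exact this

theorem HasWeight.tail_true {n p : ℕ} {y : Tensor (n + 1)} (h : HasWeight (p + 1) y) :
    HasWeight p fun s => y (Fin.cons true s) := by
  intro s hs
  have := h _ hs
  rw [Fin.card_filter_univ_succ, if_pos (by simp)] at this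
  exact Nat.succ_injective this

theorem HasWeight.tail_true_zero {n : ℕ} {y : Tensor (n + 1)} (h : HasWeight 0 y) (s : Fin n → Bool) :
    y (Fin.cons true s) = 0 := by
  by_contra hs
  have := h _ hs
  rw [Fin.card_filter_univ_succ, if_pos (by simp)] at this
  omega

/-- Tensors that are killed by all generators are symmetric. -/
theorem exists_smul_symTensor (q : ℂ) (hq : q ≠ 0) (n p : ℕ) (y : Tensor n) (hy : HasWeight p y)
    (h : ∀ k (hk : k + 1 < n), tensorOp q ⟨k, Nat.lt_of_succ_lt hk⟩ ⟨k + 1, hk⟩ y = 0) :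
    ∃ c : ℂ, y = c • symTensor (-q⁻¹) n p := by
  induction n generalizing p with
  | zero =>
    cases p with
    | zero =>
      refine ⟨y Fin.elim0, funext fun s => ?_⟩
      rw [Pi.smul_apply, symTensor, smul_eq_mul, mul_one]
      exact congrArg y (Subsingleton.elim _ _)
    | succ p =>
      refine ⟨0, funext fun s => ?_⟩
      rw [zero_smul]
      by_contra hs
      have := hy s hs
      simp at this
  | succ n ih =>
    have hk : ∀ b k (hk : k + 1 < n), tensorOp q ⟨k, Nat.lt_of_succ_lt hk⟩ ⟨k + 1, hk⟩
        (fun s => y (Fin.cons b s)) = 0 := by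
      intro b k hk
      funext s
      exact (tensorOp_cons q ⟨k, Nat.lt_of_succ_lt hk⟩ ⟨k + 1, hk⟩ y b s).symm.trans
        (congrFun (h (k + 1) (Nat.succ_lt_succ hk)) _)
    obtain ⟨α, hα⟩ := ih p _ hy.tail_false (hk false)
    have hα' := fun s => congrFun hα s
    cases p with
    | zero =>
      refine ⟨α, tensor_ext fun b s => ?_⟩
      rw [Pi.smul_apply]
      cases b
      · rw [symTensor_false, pow_zero, one_mul]
        exact hα' s
      · rw [symTensor_true_zero, smul_zero, hy.tail_true_zero]
    | succ p =>
      obtain ⟨β, hβ⟩ := ih p _ hy.tail_true (hk true)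
      have hβ' := fun s => congrFun hβ s
      refine ⟨β, tensor_ext fun b s => ?_⟩
      rw [Pi.smul_apply]
      cases b
      · rw [symTensor_false]
        refine (hα' s).trans ?_
        -- The first generator relates the coefficients `α` and `β` of the two slices by comparison
        -- on the next index. For `p ≥ n` there is no symmetric tensor of weight `p + 1` in `n`
        -- factors, and `α` does not matter.
        by_cases hp : p < n
        · obtain ⟨m, rfl⟩ := Nat.exists_eq_succ_of_ne_zero (show n ≠ 0 by omega)
          have key : (β * (-q⁻¹) ^ p + q * α) • symTensor (-q⁻¹) m p = 0 := by
            funext t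
            have h1 := congrFun (h 0 (by omega)) (Fin.cons true (Fin.cons false t))
            have h2 := tensorOp_zero_one q y true false t
            rw [if_neg (by simp), if_pos rfl] at h2
            have h3 := h2.symm.trans h1
            have h4 := hα' (Fin.cons true t)
            have h5 := hβ' (Fin.cons false t)
            simp only [Pi.smul_apply, symTensor_true, symTensor_false, smul_eq_mul,
              Pi.zero_apply] at h3 h4 h5 ⊢
            rw [h4, h5] at h3
            have h6 : q * q⁻¹ = 1 := mul_inv_cancel₀ hq
            linear_combination q * h3 - β * (-q⁻¹) ^ p * symTensor (-q⁻¹) m p t * h6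
          have key' := (smul_eq_zero.1 key).resolve_right (symTensor_ne_zero _ (by omega))
          have : α = β * (-q⁻¹) ^ (p + 1) := by
            have h6 : q * q⁻¹ = 1 := mul_inv_cancel₀ hq
            rw [pow_succ]
            linear_combination q⁻¹ * key' - α * h6
          rw [this]
          simp only [Pi.smul_apply, smul_eq_mul]
          ring
        · rw [symTensor_of_lt _ (show n < p + 1 by omega)]
          simp
      · rw [symTensor_true]
        exact hβ' s

/-- The vector `v` is killed by all generators. -/
def Killed {δ : ℂ} {n p : ℕ} (v : Std δ n p) : Prop := ∀ k (hk : k + 1 < n), cc δ n k hk • v = 0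

theorem Killed.exists_symTensor {q : ℂ} (hq : q ≠ 0) {n p : ℕ} {v : Std (loop q) n p}
    (h : Killed v) : ∃ c : ℂ, toTensor q n p v = c • symTensor (-q⁻¹) n p :=
  exists_smul_symTensor q hq n p _ (toTensor_hasWeight q v) fun k hk => by
    rw [← toTensor_cc q hq, h, map_zero]

/-- The weight is fixed by `p`, so all killed vectors go to the line of one symmetric tensor. -/
theorem Killed.exists_smul {q : ℂ} (hq : q ≠ 0) {n p : ℕ} {v v' : Std (loop q) n p}
    (h : Killed v) (h' : Killed v') (h0 : v ≠ 0) : ∃ c : ℂ, v' = c • v := by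
  obtain ⟨c, hc⟩ := h.exists_symTensor hq
  obtain ⟨c', hc'⟩ := h'.exists_symTensor hq
  have hc0 : c ≠ 0 := by
    rintro rfl
    exact h0 (toTensor_eq_zero q n p v (by rw [hc, zero_smul]))
  refine ⟨c' / c, toTensor_injective q n p ?_⟩
  rw [map_smul, hc, hc', smul_smul, div_mul_cancel₀ _ hc0]

/-! ### Submodules of standard representations -/

/-- By `e (k+1) e k e (k+1) = e (k+1)`, all generators lie in the two-sided ideal generated by the
first one. -/
theorem cc_smul_mem_of_zero {δ : ℂ} {n : ℕ} {M : Type*} [AddCommGroup M] [Module (TL δ n) M]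
    (A B : Submodule (TL δ n) M) (hn : 0 + 1 < n)
    (h : ∀ v ∈ A, cc δ n 0 hn • v ∈ B) (k : ℕ) (hk : k + 1 < n) : ∀ v ∈ A, cc δ n k hk • v ∈ B := by
  induction k with
  | zero => exact h
  | succ k ih =>
    intro v hv
    have h1 := cc_zigzag δ n (k + 1) k hk (by omega) (by omega)
    rw [← h1, mul_smul, mul_smul]
    exact B.smul_mem _ (ih (by omega) _ (A.smul_mem _ hv))

theorem eq_top_of_cc_mem {δ : ℂ} {n p : ℕ} (hn : 1 ≤ n)
    (B : Submodule (TL δ (n + 2)) (Std δ (n + 2) (p + 1)))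
    (h : ∀ k hk v, cc δ (n + 2) k hk • v ∈ B) : B = ⊤ :=
  cup_induction B fun v => by
    rw [← cc_zero_one_addCup δ hn v]
    exact h _ _ _

/-- A killed vector is orthogonal to the images of the generators, and by the zigzag these span the
representation. -/
theorem Killed.mem_rad {q : ℂ} (hq : q ≠ 0) {n p : ℕ} (hn : 1 ≤ n)
    {v : Std (loop q) (n + 2) (p + 1)} (h : Killed v) : v ∈ rad q hq (n + 2) (p + 1) := by
  rw [TemperleyLieb.mem_rad]
  have hk : ∀ k hk v', form q (n + 2) (p + 1) v (cc (loop q) (n + 2) k hk • v') = 0 := by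
    intro k hk v'
    rw [← form_cc q hq, h, map_zero]
    rfl
  have := eq_top_of_cc_mem hn (ofStable (LinearMap.ker (form q (n + 2) (p + 1) v))
    fun i v' _ => hk i i.2 v') hk
  intro v'
  exact (this.symm ▸ Submodule.mem_top : v' ∈ ofStable _ _)

/-- A killed vector is isotropic, since it lies in the radical, while its square norm is a nonzero
multiple of the Gaussian coefficient. This is the arithmetic obstruction to trivial
subrepresentations. -/
theorem Killed.gaussBinom_eq_zero {q : ℂ} (hq : q ≠ 0) {n p : ℕ} (hn : 1 ≤ n)
    {v : Std (loop q) (n + 2) (p + 1)} (h : Killed v) (h0 : v ≠ 0) :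
    gaussBinom ((-q⁻¹) ^ 2) (n + 2) (p + 1) = 0 := by
  have h1 := TemperleyLieb.mem_rad.1 (h.mem_rad hq hn) v
  obtain ⟨c, hc⟩ := h.exists_symTensor hq
  have hc0 : c ≠ 0 := by
    rintro rfl
    exact h0 (toTensor_eq_zero q _ _ v (by rw [hc, zero_smul]))
  rw [form_apply, hc, smul_dotProduct, dotProduct_smul, symTensor_dotProduct] at h1
  simpa [hc0] using h1

/-- The vectors that addition of a cup moves into `N`. -/
noncomputable def comapCup (q : ℂ) (hq : q ≠ 0) {n p : ℕ}
    (N : Submodule (TL (loop q) (n + 2)) (Std (loop q) (n + 2) (p + 1))) :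
    Submodule (TL (loop q) n) (Std (loop q) n p) :=
  ofStable ((N.restrictScalars ℂ).comap (addCup (loop q) n p)) fun i v hv => by
    rw [Submodule.mem_comap, addCup_smul q hq]
    exact N.smul_mem _ hv

theorem mem_comapCup {q : ℂ} {hq : q ≠ 0} {n p : ℕ}
    {N : Submodule (TL (loop q) (n + 2)) (Std (loop q) (n + 2) (p + 1))} {v : Std (loop q) n p} :
    v ∈ comapCup q hq N ↔ addCup (loop q) n p v ∈ N := Iff.rfl

/-- The vectors that addition of a through strand moves into `N`. -/
noncomputable def comapStrand (q : ℂ) (hq : q ≠ 0) {n p : ℕ}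
    (N : Submodule (TL (loop q) (n + 1)) (Std (loop q) (n + 1) p)) :
    Submodule (TL (loop q) n) (Std (loop q) n p) :=
  ofStable ((N.restrictScalars ℂ).comap (addStrand (loop q) n p)) fun i v hv => by
    rw [Submodule.mem_comap, addStrand_smul q hq]
    exact N.smul_mem _ hv

theorem mem_comapStrand {q : ℂ} {hq : q ≠ 0} {n p : ℕ}
    {N : Submodule (TL (loop q) (n + 1)) (Std (loop q) (n + 1) p)} {v : Std (loop q) n p} :
    v ∈ comapStrand q hq N ↔ addStrand (loop q) n p v ∈ N := Iff.rfl

/-- The image under opening of the first cup. -/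
noncomputable def mapOpen (q : ℂ) (hq : q ≠ 0) {n p : ℕ}
    (N : Submodule (TL (loop q) (n + 1)) (Std (loop q) (n + 1) (p + 1))) :
    Submodule (TL (loop q) n) (Std (loop q) n p) :=
  ofStable ((N.restrictScalars ℂ).map (openCup (loop q) n p)) fun i v hv => by
    obtain ⟨u, hu, rfl⟩ := hv
    rw [← openCup_smul q hq]
    exact ⟨_, N.smul_mem _ hu, rfl⟩

/-- Every proper submodule is contained in the radical of the form. -/
theorem eq_top_of_not_le_rad {q : ℂ} (hq : q ≠ 0) {n p : ℕ}
    (N : Submodule (TL (loop q) n) (Std (loop q) n p)) (h : ¬ N ≤ rad q hq n p) : N = ⊤ := by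
  induction p generalizing n with
  | zero =>
    obtain ⟨v, hv, hr⟩ := SetLike.not_le_iff_exists.1 h
    obtain ⟨c, rfl⟩ := std_zero_eq _ _ v
    have hc : c ≠ 0 := by
      rintro rfl
      exact hr (by rw [zero_smul]; exact Submodule.zero_mem _)
    rw [eq_top_iff]
    intro u _
    obtain ⟨d, rfl⟩ := std_zero_eq _ _ u
    have := N.smul_mem (algebraMap ℂ _ (d / c)) hv
    rwa [algebraMap_smul, smul_smul, div_mul_cancel₀ _ hc] at this
  | succ p ih =>
    by_cases hn : n < 2 * (p + 1)
    · have := std_subsingleton (loop q) hn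
      exact Subsingleton.elim _ _
    obtain ⟨n, rfl⟩ : ∃ m, n = m + 2 := ⟨n - 2, by omega⟩
    -- The orthogonal complement of `N` is proper, so by `cup_induction` it misses a vector with a
    -- cup in front.
    let K : Submodule (TL (loop q) (n + 2)) (Std (loop q) (n + 2) (p + 1)) :=
      ofStable
        { carrier := {y | ∀ v ∈ N, form q _ _ v y = 0}
          zero_mem' := fun v _ => map_zero _
          add_mem' := fun ha hb v hv => by rw [map_add, ha v hv, hb v hv, add_zero]
          smul_mem' := fun c a ha v hv => by rw [map_smul, ha v hv, smul_zero] }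
        fun i y hy v hv => by
          have := form_cc q hq i.2 v y
          rw [cc] at this
          rw [← this]
          exact hy _ (N.smul_mem _ hv)
    have hK : K ≠ ⊤ := by
      intro hK
      refine h fun v hv => ?_
      rw [mem_rad]
      intro y
      exact (hK.symm ▸ Submodule.mem_top : y ∈ K) v hv
    have : ∃ y, addCup (loop q) n p y ∉ K := by
      by_contra! h'
      exact hK (cup_induction K h')
    obtain ⟨y, hy⟩ := this
    have : ∃ v ∈ N, form q _ _ v (addCup (loop q) n p y) ≠ 0 := by
      by_contra! h'
      exact hy h'
    obtain ⟨v, hv, hvy⟩ := this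
    -- By adjunction of cup and cap, `cap v` pairs nontrivially with `y`, so the pullback of `N` is
    -- not in the radical and the induction hypothesis applies to it.
    have hM : comapCup q hq N = ⊤ := by
      refine ih _ fun hle => hvy ?_
      have hc : cap (loop q) n p v ∈ comapCup q hq N := by
        rw [mem_comapCup, addCup_cap]
        exact N.smul_mem _ hv
      rw [form_comm, form_addCup q hq, form_comm, mem_rad.1 (hle hc), mul_zero]
    refine cup_induction N fun u => ?_
    exact mem_comapCup.1 (hM.symm ▸ Submodule.mem_top : u ∈ comapCup q hq N)

theorem addCup_mem_rad {q : ℂ} {hq : q ≠ 0} {n p : ℕ} {v : Std (loop q) n p}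
    (h : v ∈ rad q hq n p) : addCup (loop q) n p v ∈ rad q hq (n + 2) (p + 1) := by
  rw [mem_rad] at h ⊢
  intro y
  rw [form_addCup q hq, h, mul_zero]

theorem mem_rad_of_addCup {q : ℂ} {hq : q ≠ 0} {n p : ℕ} (hn : 1 ≤ n) {v : Std (loop q) n p}
    (h : addCup (loop q) n p v ∈ rad q hq (n + 2) (p + 1)) : v ∈ rad q hq n p := by
  rw [mem_rad] at h ⊢
  intro y
  -- The cap of `e 1` applied to a cup is the identity, whereas the cap of the cup itself would only
  -- give a factor `δ`.
  have := h (cc (loop q) (n + 2) 1 (by omega) • addCup (loop q) n p y)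
  rw [form_addCup_cc_one q hq hn] at this
  exact (mul_eq_zero.1 this).resolve_left hq

theorem cap_mem_rad {q : ℂ} {hq : q ≠ 0} {n p : ℕ} (hn : 1 ≤ n) {v : Std (loop q) (n + 2) (p + 1)}
    (h : v ∈ rad q hq (n + 2) (p + 1)) : cap (loop q) n p v ∈ rad q hq n p :=
  mem_rad_of_addCup hn (by rw [addCup_cap]; exact Submodule.smul_mem _ _ h)

theorem mem_rad_of_addStrand {q : ℂ} {hq : q ≠ 0} {n p : ℕ} {v : Std (loop q) n p}
    (h : addStrand (loop q) n p v ∈ rad q hq (n + 1) p) : v ∈ rad q hq n p := by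
  rw [mem_rad] at h ⊢
  intro y
  rw [← form_addStrand, h]

theorem rad_zero {q : ℂ} (hq : q ≠ 0) (n : ℕ) : rad q hq n 0 = ⊥ := by
  rw [eq_bot_iff]
  intro v hv
  obtain ⟨c, rfl⟩ := std_zero_eq _ _ v
  have := mem_rad.1 hv (Std.ofLink _ (LinkState.idle n))
  rw [map_smul, LinearMap.smul_apply, form_idle, smul_eq_mul, mul_one] at this
  rw [this, zero_smul]
  exact Submodule.zero_mem _

/-- If the radical of `V_{n,p}` vanishes, then the radical of `V_{n+2,p+1}` is killed by the
generators. -/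
theorem killed_of_rad_eq_bot {q : ℂ} {hq : q ≠ 0} {n p : ℕ} (hn : 1 ≤ n) (h : rad q hq n p = ⊥)
    {v : Std (loop q) (n + 2) (p + 1)} (hv : v ∈ rad q hq (n + 2) (p + 1)) : Killed v := by
  intro k hk
  refine (Submodule.mem_bot (TL (loop q) (n + 2))).1 (cc_smul_mem_of_zero (rad q hq (n + 2) (p + 1))
    ⊥ (by omega) (fun v hv => ?_) k hk v hv)
  have := cap_mem_rad hn hv
  rw [h, Submodule.mem_bot] at this
  rw [Submodule.mem_bot, ← addCup_cap, this, map_zero]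

/-- `V_{n,p}` has a subquotient on which all generators vanish. -/
def HasTrivial (δ : ℂ) (n p : ℕ) : Prop :=
  ∃ A B : Submodule (TL δ n) (Std δ n p), (∃ a ∈ A, a ∉ B) ∧ ∀ k hk, ∀ v ∈ A, cc δ n k hk • v ∈ B

theorem hasTrivial_of_killed {δ : ℂ} {n p : ℕ} {v : Std δ n p} (h : Killed v) (h0 : v ≠ 0) :
    HasTrivial δ n p := by
  have hs : ∀ k hk, ∀ u ∈ Submodule.span ℂ {v}, cc δ n k hk • u = 0 := by
    intro k hk u hu
    obtain ⟨c, rfl⟩ := Submodule.mem_span_singleton.1 hu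
    rw [smul_comm, h, smul_zero]
  refine ⟨ofStable (Submodule.span ℂ {v}) fun i u hu => ?_, ⊥, ⟨v, ?_, ?_⟩, fun k hk u hu => ?_⟩
  · have := hs i i.2 u hu
    rw [cc] at this
    rw [this]
    exact Submodule.zero_mem _
  · exact Submodule.mem_span_singleton_self v
  · rwa [Submodule.mem_bot]
  · rw [Submodule.mem_bot]
    exact hs k hk u hu

/-! ### Chains of generators -/

section Chain

variable {M : Type*} [AddCommGroup M] [Module ℂ M]

/-- The vectors `E k ⋯ E 1 y`. -/
def chain (E : ℕ → Module.End ℂ M) (y : M) : ℕ → M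
  | 0 => y
  | k + 1 => E (k + 1) (chain E y k)

variable {E : ℕ → Module.End ℂ M} {y : M} {δ : ℂ} {N : ℕ}

theorem chain_self (hsq : ∀ k ≤ N, ∀ v, E k (E k v) = δ • E k v) (h0 : E 0 y = δ • y) {k : ℕ}
    (hk : k ≤ N) : E k (chain E y k) = δ • chain E y k := by
  cases k with
  | zero => exact h0
  | succ k => exact hsq _ hk _

theorem chain_pred (hz : ∀ k, k + 1 ≤ N → ∀ v, E k (E (k + 1) (E k v)) = E k v)
    (h1 : 1 ≤ N → E 0 (E 1 y) = y) {k : ℕ} (hk : k + 1 ≤ N) :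
    E k (chain E y (k + 1)) = chain E y k := by
  cases k with
  | zero => exact h1 hk
  | succ k => exact hz _ hk _

theorem chain_high (hc : ∀ j k, j ≤ N → k + 2 ≤ j → ∀ v, E j (E k v) = E k (E j v))
    (h2 : ∀ k, 2 ≤ k → k ≤ N → E k y = 0) {j k : ℕ} (hj : j ≤ N) (hjk : k + 2 ≤ j) :
    E j (chain E y k) = 0 := by
  induction k with
  | zero => exact h2 j hjk hj
  | succ k ih =>
    change E j (E (k + 1) (chain E y k)) = 0
    rw [hc _ _ hj hjk, ih (by omega), map_zero]

/-- `E j` commutes down the chain to the step `j + 2`. There it commutes past `E (j+2)` and shortens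
the chain to length `j`, which `E (j+2)` kills. -/
theorem chain_low (hz : ∀ k, k + 1 ≤ N → ∀ v, E k (E (k + 1) (E k v)) = E k v)
    (hc : ∀ j k, j ≤ N → k + 2 ≤ j → ∀ v, E j (E k v) = E k (E j v))
    (h1 : 1 ≤ N → E 0 (E 1 y) = y) (h2 : ∀ k, 2 ≤ k → k ≤ N → E k y = 0) {j k : ℕ}
    (hk : j + 2 + k ≤ N) : E j (chain E y (j + 2 + k)) = 0 := by
  induction k with
  | zero =>
    change E j (E (j + 2) (chain E y (j + 1))) = 0
    rw [← hc _ _ (by omega) le_rfl, chain_pred hz h1 (by omega), chain_high hc h2 (by omega) le_rfl]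
  | succ k ih =>
    change E j (E (j + 2 + k + 1) (chain E y (j + 2 + k))) = 0
    rw [← hc _ _ (by omega) (by omega), ih (by omega), map_zero]

/-- The alternating combination of the chain that is killed by all `E j` with `0 < j`. -/
noncomputable def chainSum (E : ℕ → Module.End ℂ M) (y : M) (q : ℂ) (N : ℕ) : M :=
  ∑ k ∈ Finset.range (N + 1), ((-1) ^ k * qint q (N + 1 - k)) • chain E y k

/-- Only the terms `k = j - 1`, `j`, `j + 1` contribute, each a multiple of `chain E y j`, and they
cancel by the recursion of quantum integers. For `j = 0` the left neighbour is absent and `[N + 2]`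
is left over. -/
theorem chainSum_apply {q : ℂ} (hsq : ∀ k ≤ N, ∀ v, E k (E k v) = loop q • E k v)
    (hz : ∀ k, k + 1 ≤ N → ∀ v, E k (E (k + 1) (E k v)) = E k v)
    (hc : ∀ j k, j ≤ N → k + 2 ≤ j → ∀ v, E j (E k v) = E k (E j v))
    (h0 : E 0 y = loop q • y) (h1 : 1 ≤ N → E 0 (E 1 y) = y)
    (h2 : ∀ k, 2 ≤ k → k ≤ N → E k y = 0) {j : ℕ} (hj : j ≤ N) :
    E j (chainSum E y q N) = (if j = 0 then qint q (N + 2) else 0) • chain E y j := by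
  have key : ∀ k ∈ Finset.range (N + 1), E j (((-1) ^ k * qint q (N + 1 - k)) • chain E y k)
      = ((if k = j then (-1) ^ j * qint q (N + 1 - j) * loop q else 0)
        + (if k + 1 = j then (-1) ^ (j + 1) * qint q (N + 2 - j) else 0)
        + (if k = j + 1 then (-1) ^ (j + 1) * qint q (N - j) else 0)) • chain E y j := by
    intro k hk
    have hk' : k ≤ N := by simpa [Nat.lt_succ_iff] using hk
    rw [map_smul]
    rcases lt_trichotomy k j with h | rfl | h
    · rw [if_neg h.ne, if_neg (show ¬ k = j + 1 by omega)]
      by_cases hkj : k + 1 = j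
      · subst hkj
        rw [if_pos rfl, show N + 2 - (k + 1) = N + 1 - k by omega, pow_add, pow_add]
        simp only [chain]
        congr 1
        ring
      · rw [if_neg hkj, chain_high hc h2 hj (by omega)]
        simp
    · rw [if_pos rfl, if_neg (by omega), if_neg (by omega), chain_self hsq h0 hj, smul_smul]
      congr 1
      ring
    · rw [if_neg h.ne', if_neg (show ¬ k + 1 = j by omega)]
      by_cases hkj : k = j + 1
      · subst hkj
        rw [if_pos rfl, show N + 1 - (j + 1) = N - j by omega, chain_pred hz h1 hk']
        congr 1
        ring
      · obtain ⟨m, rfl⟩ : ∃ m, k = j + 2 + m := ⟨k - (j + 2), by omega⟩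
        rw [if_neg hkj, chain_low hz hc h1 h2 hk']
        simp
  rw [chainSum, map_sum, Finset.sum_congr rfl key, ← Finset.sum_smul]
  congr 1
  rw [Finset.sum_add_distrib, Finset.sum_add_distrib, Finset.sum_ite_eq',
    if_pos (Finset.mem_range.2 (Nat.lt_succ_of_le hj)), Finset.sum_ite_eq']
  -- For `j = N` the right neighbour is absent, but its coefficient would be `[0] = 0`.
  have h3 : (if j + 1 ∈ Finset.range (N + 1) then (-1) ^ (j + 1) * qint q (N - j) else 0)
      = (-1) ^ (j + 1) * qint q (N - j) := by
    split_ifs with h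
    · rfl
    · rw [Finset.mem_range] at h
      rw [show N - j = 0 by omega]
      simp [qint]
  have h4 : qint q (N - j + 2) = (q + q⁻¹) * qint q (N - j + 1) - qint q (N - j) := by rw [qint]
  rw [h3, show N + 1 - j = N - j + 1 by omega, show N + 2 - j = N - j + 2 by omega, h4]
  cases j with
  | zero =>
    rw [if_pos rfl, Finset.sum_eq_zero (fun k _ => if_neg (Nat.succ_ne_zero k)), Nat.sub_zero]
    rw [Nat.sub_zero] at h4
    rw [h4]
    simp only [pow_zero, zero_add, pow_one]
    ring
  | succ j =>
    rw [if_neg (Nat.succ_ne_zero j)]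
    simp only [Nat.succ_inj]
    rw [Finset.sum_ite_eq', if_pos (Finset.mem_range.2 (by omega))]
    ring

end Chain

/-! ### The radicals at a root of unity -/

theorem qint_eq (q : ℂ) (n : ℕ) (hq : q ≠ 0) : (q ^ 2 - 1) * (qint q n * q ^ n) = q * (q ^ (2 * n) - 1) := by
  have key : ∀ n, (q ^ 2 - 1) * (qint q n * q ^ n) = q * (q ^ (2 * n) - 1) ∧
      (q ^ 2 - 1) * (qint q (n + 1) * q ^ (n + 1)) = q * (q ^ (2 * (n + 1)) - 1) := by
    intro n
    induction n with
    | zero => constructor <;> simp [qint]; ring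
    | succ n ih =>
      refine ⟨ih.2, ?_⟩
      have h : qint q (n + 1 + 1) = (q + q⁻¹) * qint q (n + 1) - qint q n := by rw [qint]
      have h6 : q * q⁻¹ = 1 := mul_inv_cancel₀ hq
      rw [h]
      linear_combination (q ^ 2 + 1) * ih.2 - q ^ 2 * ih.1
        + (q ^ 2 - 1) * qint q (n + 1) * q ^ (n + 1) * h6
  exact (key n).1

theorem qint_eq_zero_iff {q : ℂ} {l : ℕ} (hω : IsPrimitiveRoot (q ^ 2) l) (hl : 2 ≤ l) (hq : q ≠ 0)
    (n : ℕ) : qint q n = 0 ↔ n % l = 0 := by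
  have h1 : q ^ 2 - 1 ≠ 0 := sub_ne_zero.2 (hω.ne_one (by omega))
  have h := qint_eq q n hq
  rw [← Nat.dvd_iff_mod_eq_zero, ← hω.pow_eq_one_iff_dvd, ← pow_mul]
  constructor
  · intro h0
    rw [h0, zero_mul, mul_zero] at h
    exact sub_eq_zero.1 ((mul_eq_zero.1 h.symm).resolve_left hq)
  · intro h0
    rw [h0, sub_self, mul_zero] at h
    simpa [h1, hq] using h

theorem loop_eq_zero_iff {q : ℂ} {l : ℕ} (hω : IsPrimitiveRoot (q ^ 2) l) (hl : 2 ≤ l) (hq : q ≠ 0) :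
    loop q = 0 ↔ l = 2 := by
  have h : qint q 2 = loop q := by simp [qint]
  rw [← h, qint_eq_zero_iff hω hl hq]
  constructor
  · intro h
    have := Nat.le_of_dvd (by omega) (Nat.dvd_of_mod_eq_zero h)
    omega
  · rintro rfl
    rfl

/-- The distance from a noncritical number `m` of through strands to its reflection. -/
def gap (l m : ℕ) : ℕ := l - 1 - m % l

/-- The gap is the distance from `m + 1` up to the next multiple of `l`, which is zero exactly at
critical values. -/
theorem gap_eq_iff {l m r : ℕ} (hl : 0 < l) (hr : r < l) : gap l m = r ↔ (m + 1 + r) % l = 0 := by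
  have h := Nat.mod_lt m hl
  have e : (m + 1 + r) % l = (m % l + (1 + r)) % l := by rw [Nat.add_assoc, Nat.mod_add_mod]
  rw [gap, e]
  constructor
  · rintro rfl
    rw [show m % l + (1 + (l - 1 - m % l)) = l by omega, Nat.mod_self]
  · intro h0
    obtain ⟨c, hc⟩ := Nat.dvd_of_mod_eq_zero h0
    match c, hc with
    | 0, hc => omega
    | 1, hc => omega
    | c + 2, hc =>
      have := Nat.mul_le_mul_left l (show 2 ≤ c + 2 by omega)
      omega

theorem gap_lt {l m : ℕ} (hl : 0 < l) : gap l m < l := by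
  rw [gap]; omega

/-- The generators as endomorphisms, indexed by all natural numbers. -/
noncomputable def genEnd (δ : ℂ) (n p k : ℕ) : Module.End ℂ (Std δ n p) :=
  if h : k + 1 < n then Algebra.lsmul ℂ ℂ (Std δ n p) (cc δ n k h) else 0

theorem genEnd_apply {δ : ℂ} {n p k : ℕ} (h : k + 1 < n) (v : Std δ n p) :
    genEnd δ n p k v = cc δ n k h • v := by
  rw [genEnd, dif_pos h]
  rfl

theorem genEnd_sq {δ : ℂ} {n p : ℕ} (k : ℕ) (hk : k ≤ n) (v : Std δ (n + 2) p) :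
    genEnd δ (n + 2) p k (genEnd δ (n + 2) p k v) = δ • genEnd δ (n + 2) p k v := by
  rw [genEnd_apply (by omega), genEnd_apply (by omega), ← mul_smul, cc_sq, smul_assoc]

theorem genEnd_zigzag {δ : ℂ} {n p : ℕ} (k : ℕ) (hk : k + 1 ≤ n) (v : Std δ (n + 2) p) :
    genEnd δ (n + 2) p k (genEnd δ (n + 2) p (k + 1) (genEnd δ (n + 2) p k v))
      = genEnd δ (n + 2) p k v := by
  rw [genEnd_apply (by omega), genEnd_apply (by omega), genEnd_apply (by omega), ← mul_smul,
    ← mul_smul, cc_zigzag _ _ _ _ _ _ (by omega)]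

theorem genEnd_comm {δ : ℂ} {n p : ℕ} (j k : ℕ) (hj : j ≤ n) (hk : k + 2 ≤ j) (v : Std δ (n + 2) p) :
    genEnd δ (n + 2) p j (genEnd δ (n + 2) p k v) = genEnd δ (n + 2) p k (genEnd δ (n + 2) p j v) := by
  rw [genEnd_apply (by omega), genEnd_apply (by omega), genEnd_apply (by omega),
    genEnd_apply (by omega), ← mul_smul, cc_comm _ _ _ _ _ _ (by omega), mul_smul]

/-- A vector that is killed by all generators but the first can be corrected by a vector in the
image of the generators, if a quantum integer does not vanish. -/
theorem exists_killed_of_shift {q : ℂ} {n p : ℕ} (h : qint q (n + 2) ≠ 0)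
    {A B : Submodule (TL (loop q) (n + 2)) (Std (loop q) (n + 2) p)} {a : Std (loop q) (n + 2) p}
    (ha : a ∈ A) (haB : a ∉ B) (hAB : ∀ k hk, ∀ v ∈ A, cc (loop q) (n + 2) k hk • v ∈ B)
    (hk : ∀ k (hk : k + 1 < n + 2), 0 < k → cc (loop q) (n + 2) k hk • a = 0) :
    ∃ v : Std (loop q) (n + 2) p, v ≠ 0 ∧ Killed v := by
  set E := genEnd (loop q) (n + 2) p
  set y := cc (loop q) (n + 2) 0 (by omega) • a with hy
  have hE0 : E 0 a = y := genEnd_apply _ _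
  have hchain : ∀ k ≤ n, chain E y k ∈ B := by
    intro k
    induction k with
    | zero => intro _; exact hAB _ _ _ ha
    | succ k ih =>
      intro hkn
      change E (k + 1) (chain E y k) ∈ B
      rw [genEnd_apply (by omega)]
      exact B.smul_mem _ (ih (by omega))
  have hsum : chainSum E y q n ∈ B := by
    refine B.sum_mem fun k hk => ?_
    rw [← algebraMap_smul (TL (loop q) (n + 2))]
    exact B.smul_mem _ (hchain k (by simpa [Nat.lt_succ_iff] using hk))
  have happ := fun (j : ℕ) (hj : j ≤ n) =>
    chainSum_apply (E := E) (y := y) (N := n) (q := q) genEnd_sq genEnd_zigzag genEnd_comm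
    (by rw [← hE0]; exact genEnd_sq 0 (by omega) a)
    (fun hn => by rw [← hE0]; exact genEnd_zigzag 0 hn a)
    (fun k h2 hkn => by
      rw [← hE0, genEnd_comm k 0 hkn h2, genEnd_apply (k := k) (by omega), hk k _ (by omega),
        map_zero]) hj
  -- On `chainSum` the first generator gives `[n + 2] • y` with `y = e 0 a`, and the others give
  -- zero. The correction lies in `B`, so the difference stays outside `B` and is nonzero.
  refine ⟨a - (qint q (n + 2))⁻¹ • chainSum E y q n, fun h0 => haB ?_, fun k hkn => ?_⟩
  · rw [sub_eq_zero.1 h0, ← algebraMap_smul (TL (loop q) (n + 2))]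
    exact B.smul_mem _ hsum
  · rw [← genEnd_apply (δ := loop q) (p := p) hkn, map_sub, map_smul, happ k (by omega)]
    cases k with
    | zero =>
      rw [if_pos rfl, smul_smul, inv_mul_cancel₀ h, one_smul]
      exact sub_eq_zero.2 hE0
    | succ k =>
      rw [if_neg (Nat.succ_ne_zero k), genEnd_apply hkn, hk _ _ (Nat.succ_pos k)]
      simp

section Radical

variable {q : ℂ} (hq : q ≠ 0) {l : ℕ}

/-- The trivial representation occurs in `V_{n,p}` only if `p = 0` or if `n` is the reflection of
`n - 2 p`. -/
def TrivialBound (q : ℂ) (l n : ℕ) : Prop :=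
  ∀ p, 2 * p ≤ n → HasTrivial (loop q) n p → p = 0 ∨ p = gap l (n - 2 * p)

/-- The radical vanishes if there is no reflection. -/
def RadZero (hq : q ≠ 0) (l n : ℕ) : Prop :=
  ∀ p, 2 * p ≤ n → (gap l (n - 2 * p) = 0 ∨ p < gap l (n - 2 * p)) → rad q hq n p = ⊥

/-- The radical is trivial if `n` is the reflection of `n - 2 p`. -/
def RadKilled (hq : q ≠ 0) (l n : ℕ) : Prop :=
  ∀ p, 2 * p ≤ n → 0 < p → p = gap l (n - 2 * p) → ∀ v ∈ rad q hq n p, Killed v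

/-- The radical contains a trivial vector if `n` is the reflection of `n - 2 p`. -/
def ExistsKilled (q : ℂ) (l n : ℕ) : Prop :=
  ∀ p, 2 * p ≤ n → 0 < p → p = gap l (n - 2 * p) → ∃ v : Std (loop q) n p, v ≠ 0 ∧ Killed v

/-- The radical is simple if there is a reflection. -/
def RadSimple (hq : q ≠ 0) (l n : ℕ) : Prop :=
  ∀ p, 2 * p ≤ n → 0 < gap l (n - 2 * p) → gap l (n - 2 * p) ≤ p →
    rad q hq n p ≠ ⊥ ∧ ∀ N ≤ rad q hq n p, N = ⊥ ∨ N = rad q hq n p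

variable {hq}

/-! ### Simultaneous induction on the number of strands -/

theorem isPrimitiveRoot_neg_inv (hω : IsPrimitiveRoot (q ^ 2) l) :
    IsPrimitiveRoot ((-q⁻¹) ^ 2) l := by
  rw [neg_sq, inv_pow]
  exact hω.inv

theorem gaussBinom_eq_zero_of_rad (hq : q ≠ 0) {n p : ℕ} (h : rad q hq (n + 1) p = ⊥)
    {v : Std (loop q) (n + 3) (p + 1)} (hv : v ∈ rad q hq (n + 3) (p + 1)) (h0 : v ≠ 0) :
    gaussBinom ((-q⁻¹) ^ 2) (n + 3) (p + 1) = 0 :=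
  (killed_of_rad_eq_bot (by omega) h hv).gaussBinom_eq_zero hq (by omega) h0

/-- Restricted to the last `n + 2` strands, `V_{n+3,p+1}` is an extension of `V_{n+2,p}` by
`V_{n+2,p+1}`, and the trivial subquotient survives in one of the two. The bound for `n + 2` leaves
few possibilities, and the unwanted ones are excluded by nonvanishing Gaussian coefficients. -/
theorem trivialBound_step (hω : IsPrimitiveRoot (q ^ 2) l) (hl : 2 ≤ l) {n : ℕ}
    (ht : TrivialBound q l (n + 2)) (hz : RadZero hq l (n + 1)) (hk : RadKilled hq l (n + 2)) :
    TrivialBound q l (n + 3) := by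
  intro p hp hT
  cases p with
  | zero => exact Or.inl rfl
  | succ p =>
  right
  have hω' := isPrimitiveRoot_neg_inv hω
  obtain ⟨A, B₀, ⟨a, haA, haB₀⟩, hAB₀⟩ := hT
  set B := A ⊓ B₀ with hB
  have haB : a ∉ B := fun h => haB₀ h.2
  have hAB : ∀ k hk, ∀ v ∈ A, cc (loop q) (n + 3) k hk • v ∈ B :=
    fun k hk v hv => ⟨A.smul_mem _ hv, hAB₀ k hk v hv⟩
  have hBA : B ≤ A := inf_le_left
  -- Otherwise `A` is everything, so `B` contains all images of generators, and these span the
  -- representation.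
  have hA : A ≤ rad q hq (n + 3) (p + 1) := by
    by_contra hA
    have hA' := eq_top_of_not_le_rad hq A hA
    have := eq_top_of_cc_mem (n := n + 1) (by omega) B fun k hk v =>
      hAB k hk v (hA'.symm ▸ Submodule.mem_top)
    exact haB (this.symm ▸ Submodule.mem_top)
  have ha0 : a ≠ 0 := fun h => haB (h ▸ B.zero_mem)
  -- Either the quotient of `A` by `B` is visible in the subspace of states with a through strand in
  -- front, or it persists after the first cup is opened.
  by_cases hu : ∃ u, addStrand (loop q) (n + 2) (p + 1) u ∈ A ∧ addStrand _ (n + 2) (p + 1) u ∉ B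
  · exfalso
    obtain ⟨u, huA, huB⟩ := hu
    have hn : 2 * (p + 1) ≤ n + 2 := by
      by_contra! hn
      have := std_subsingleton (loop q) hn
      rw [Subsingleton.elim u 0, map_zero] at huB
      exact huB B.zero_mem
    have hT : HasTrivial (loop q) (n + 2) (p + 1) := by
      refine ⟨comapStrand q hq A, comapStrand q hq B, ⟨u, huA, huB⟩, fun k hk v hv => ?_⟩
      rw [mem_comapStrand, addStrand_cc q hq]
      exact hAB _ _ _ hv
    have hg := (ht (p + 1) hn hT).resolve_left (Nat.succ_ne_zero p)
    have hlt : p + 1 < l := hg ▸ gap_lt (by omega)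
    have hmod : (n + 3) % l = p + 1 := by
      have := (gap_eq_iff (by omega) hlt).1 hg.symm
      have h2 := Nat.add_mod (n + 2 - 2 * (p + 1) + 1 + (p + 1)) (p + 1) l
      rw [this, zero_add, Nat.mod_mod, Nat.mod_eq_of_lt hlt] at h2
      rw [← h2]
      congr 1
      omega
    -- Since `n + 3 ≡ p + 1` modulo `l` with `0 < p + 1 < l`, the quantum integer `[n + 3]` is
    -- invertible and a killed vector can be built. But the Gaussian coefficient of `n + 3` over `(n
    -- + 3) % l = p + 1` is `1`.
    obtain ⟨v, hv0, hv⟩ := exists_killed_of_shift (n := n + 1) (by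
      rw [Ne, qint_eq_zero_iff hω hl hq, hmod]
      exact Nat.succ_ne_zero p) huA huB hAB (fun k hk0 hkpos => by
        obtain ⟨k, rfl⟩ := Nat.exists_eq_succ_of_ne_zero hkpos.ne'
        have := hk (p + 1) hn (by omega) hg u (mem_rad_of_addStrand (hA huA)) k (by omega)
        have h2 := addStrand_cc q hq (n + 2) (p + 1) k (by omega) u
        rw [this, map_zero] at h2
        exact h2.symm)
    have h1 := hv.gaussBinom_eq_zero hq (by omega) hv0
    rw [← hmod, gaussBinom_mod_self hω' (by omega)] at h1
    exact one_ne_zero h1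
  · have hT : HasTrivial (loop q) (n + 2) p := by
      refine ⟨mapOpen q hq A, mapOpen q hq B, ⟨openCup _ _ _ a, ⟨a, haA, rfl⟩, ?_⟩, ?_⟩
      · rintro ⟨b, hb, hba⟩
        obtain ⟨u, hu'⟩ := exists_addStrand_of_openCup (v := a - b) (by rw [map_sub, hba, sub_self])
        refine hu ⟨u, ?_, ?_⟩
        · rw [hu']; exact A.sub_mem haA (hBA hb)
        · rw [hu']
          intro h
          have := B.add_mem h hb
          rw [sub_add_cancel] at this
          exact haB this
      · rintro k hk _ ⟨v, hv, rfl⟩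
        exact ⟨_, hAB _ _ _ hv, openCup_cc q hq _ _ _ hk v⟩
    have hn3 : n + 3 - 2 * (p + 1) = n + 1 - 2 * p := by omega
    rw [hn3]
    rcases ht p (by omega) hT with rfl | hg
    · by_cases hm : (n + 3) % l = 0
      · symm
        rw [gap_eq_iff (by omega) (by omega)]
        exact hm
      · exact absurd (gaussBinom_eq_zero_of_rad hq (rad_zero hq (n + 1)) (hA haA) ha0)
          (gaussBinom_one_ne_zero hω' hl hm)
    · have hlt : p < l := hg ▸ gap_lt (by omega)
      have hmod := (gap_eq_iff (by omega) hlt).1 hg.symm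
      have e : n + 2 - 2 * p + 1 + p = n + 1 - 2 * p + 1 + (p + 1) := by omega
      rw [e] at hmod
      by_cases hpl : p + 1 < l
      · symm
        rwa [gap_eq_iff (by omega) hpl]
      · exfalso
        -- The congruence already gives `p + 1 = gap` if `p + 1 < l`. For `p + 1 = l` the pair is
        -- critical, the radical two strands below vanishes, and the coefficient in column `l` is
        -- the obstruction.
        obtain rfl : p + 1 = l := by omega
        have h0 : gap (p + 1) (n + 1 - 2 * p) = 0 := by
          rw [gap_eq_iff (by omega) (by omega), add_zero]
          rwa [Nat.add_mod_right] at hmod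
        refine gaussBinom_self_ne_zero hω' (by omega) (show p + 1 ≤ n + 3 by omega)
          (gaussBinom_eq_zero_of_rad hq (hz p (by omega) (Or.inl h0)) (hA haA) ha0)

/-- A vanishing radical two strands below makes the radical killed; a nonzero vector in it would be
a trivial subquotient that the bound forbids. -/
theorem radZero_step {n : ℕ} (ht : TrivialBound q l (n + 3)) (hz : RadZero hq l (n + 1)) :
    RadZero hq l (n + 3) := by
  intro p hp hg
  cases p with
  | zero => exact rad_zero hq _
  | succ p =>
  have hn3 : n + 3 - 2 * (p + 1) = n + 1 - 2 * p := by omega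
  rw [eq_bot_iff]
  intro v hv
  by_contra h0
  have hT := hasTrivial_of_killed (killed_of_rad_eq_bot (by omega)
    (hz p (by omega) (by rw [hn3] at hg; omega)) hv) h0
  have := ht (p + 1) hp hT
  omega

theorem radKilled_step {n : ℕ} (hz : RadZero hq l (n + 1)) : RadKilled hq l (n + 3) := by
  intro p hp hp0 hg v hv
  cases p with
  | zero => omega
  | succ p =>
  have hn3 : n + 3 - 2 * (p + 1) = n + 1 - 2 * p := by omega
  exact killed_of_rad_eq_bot (by omega) (hz p (by omega) (by rw [hn3] at hg; omega)) hv

/-- A nondegenerate form on a finite-dimensional space represents every functional. -/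
theorem exists_form_eq (hq : q ≠ 0) {n p : ℕ} (h : rad q hq n p = ⊥) (f : Std (loop q) n p →ₗ[ℂ] ℂ) :
    ∃ u, form q n p u = f := by
  have hinj : Function.Injective (form q n p) := by
    rw [injective_iff_map_eq_zero]
    intro v hv
    have : v ∈ rad q hq n p := mem_rad.2 fun y => by rw [hv]; rfl
    rwa [h, Submodule.mem_bot] at this
  exact (LinearMap.injective_iff_surjective_of_finrank_eq_finrank
    (Subspace.dual_finrank_eq (K := ℂ)).symm).1 hinj f

/-- The chain that starts at the cup in front gives the vector: its only obstruction is `[n + 3]`,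
which vanishes here. -/
theorem existsKilled_one (hω : IsPrimitiveRoot (q ^ 2) l) (hl : 2 ≤ l) (hq : q ≠ 0) {n : ℕ}
    (hn : (n + 3) % l = 0) : ∃ v : Std (loop q) (n + 3) 1, v ≠ 0 ∧ Killed v := by
  set E := genEnd (loop q) (n + 3) 1
  set y := addCup (loop q) (n + 1) 0 (Std.ofLink _ (LinkState.idle (n + 1))) with hy
  refine ⟨chainSum E y q (n + 1), fun h0 => ?_, fun k hk => ?_⟩
  · have h1 : ∀ k ∈ Finset.range (n + 1), openCup (loop q) (n + 2) 0 (((-1) ^ (k + 1)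
        * qint q (n + 1 + 1 - (k + 1))) • chain E y (k + 1)) = 0 := by
      intro k hk
      have hk' : k < n + 1 := by simpa using hk
      rw [map_smul]
      change _ • openCup _ _ _ (E (k + 1) (chain E y k)) = 0
      rw [genEnd_apply (by omega), openCup_cc q hq _ _ k (by omega), cc_smul_idle, smul_zero]
    have h2 := congrArg (openCup (loop q) (n + 2) 0) h0
    rw [chainSum, Finset.sum_range_succ', map_add, map_sum, Finset.sum_eq_zero h1, zero_add, map_zero,
      map_smul] at h2
    change _ • openCup _ _ _ y = 0 at h2
    rw [hy, openCup_addCup, smul_eq_zero] at h2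
    rcases h2 with h2 | h2
    · rw [pow_zero, one_mul, qint_eq_zero_iff hω hl hq] at h2
      have h3 := Nat.dvd_of_mod_eq_zero hn
      have h4 : l ∣ n + 2 := Nat.dvd_of_mod_eq_zero h2
      have h5 := (Nat.dvd_add_right h4).1 (show l ∣ n + 2 + 1 from h3)
      have := Nat.le_of_dvd one_pos h5
      omega
    · rw [addStrand_idle] at h2
      have := form_idle q (n + 2)
      rw [h2, map_zero] at this
      exact zero_ne_one this
  · rw [← genEnd_apply (δ := loop q) (p := 1) hk]
    have := chainSum_apply (E := E) (y := y) (N := n + 1) (q := q) genEnd_sq genEnd_zigzag genEnd_comm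
      (by rw [genEnd_apply (by omega)]; exact cc_zero_addCup _ _)
      (fun _ => by
        rw [genEnd_apply (by omega), genEnd_apply (by omega)]
        exact cc_zero_one_addCup _ (by omega) _)
      (fun k h2 hk => by
        obtain ⟨k, rfl⟩ : ∃ m, k = m + 2 := ⟨k - 2, by omega⟩
        rw [genEnd_apply (by omega), hy, ← addCup_cc q hq _ _ k (by omega), cc_smul_idle, map_zero])
      (show k ≤ n + 1 by omega)
    rw [this]
    have h0 : qint q (n + 1 + 2) = 0 := (qint_eq_zero_iff hω hl hq _).2 hn
    rw [h0, ite_self, zero_smul]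

/-- A killed vector of `V_{n+2,p}` is lifted along `openCup` and made orthogonal to the states with
a through strand in front; this lift is killed by every generator. -/
theorem existsKilled_step (hω : IsPrimitiveRoot (q ^ 2) l) (hl : 2 ≤ l) {n : ℕ}
    (he : ExistsKilled q l (n + 2)) (hz : RadZero hq l (n + 2)) (ht : TrivialBound q l (n + 1)) :
    ExistsKilled q l (n + 3) := by
  intro p hp hp0 hg
  obtain ⟨p, rfl⟩ := Nat.exists_eq_succ_of_ne_zero hp0.ne'
  have hn3 : n + 3 - 2 * (p + 1) = n + 1 - 2 * p := by omega
  rw [Nat.succ_eq_add_one, hn3] at hg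
  have hlt : p + 1 < l := hg ▸ gap_lt (by omega)
  have hmod := (gap_eq_iff (by omega) hlt).1 hg.symm
  rcases Nat.eq_zero_or_pos p with rfl | hp1
  · exact existsKilled_one hω hl hq hmod
  obtain ⟨x₀, hx₀, hx₀k⟩ := he p (by omega) hp1 (by
    symm
    rw [gap_eq_iff (by omega) (by omega), ← hmod]
    congr 1
    omega)
  -- A gap `g` with `0 < g ≤ p + 1` here would force `l` to divide `p + 2 - g`, a positive number
  -- below `l`.
  have hr : rad q hq (n + 2) (p + 1) = ⊥ := by
    by_cases hn : 2 * (p + 1) ≤ n + 2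
    · refine hz (p + 1) hn ?_
      by_contra! hcon
      have hlt' := gap_lt (l := l) (m := n + 2 - 2 * (p + 1)) (by omega)
      have h1 := (gap_eq_iff (l := l) (m := n + 2 - 2 * (p + 1)) (by omega) hlt').1 rfl
      set g := gap l (n + 2 - 2 * (p + 1))
      have h2 : (n + 1 - 2 * p + 1 + (p + 1)) = n + 2 - 2 * (p + 1) + 1 + g + (p + 2 - g) := by omega
      rw [h2, Nat.add_mod, h1, zero_add, Nat.mod_mod] at hmod
      have := Nat.le_of_dvd (by omega) (Nat.dvd_of_mod_eq_zero hmod)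
      omega
    · have := std_subsingleton (loop q) (not_le.1 hn)
      exact Subsingleton.elim _ _
  set x₁ := closeStrand (loop q) (n + 2) p x₀
  -- Orthogonal projection of the lift `x₁`, possible because the form on the added strands is
  -- nondegenerate.
  obtain ⟨u, hu⟩ := exists_form_eq hq hr
    (form q (n + 3) (p + 1) x₁ ∘ₗ addStrand (loop q) (n + 2) (p + 1))
  set x := x₁ - addStrand (loop q) (n + 2) (p + 1) u with hx
  have hox : openCup (loop q) (n + 2) p x = x₀ := by
    rw [hx, map_sub, openCup_addStrand, sub_zero, openCup_closeStrand _ _ _ (by omega)]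
  have hxf : ∀ y, form q (n + 3) (p + 1) x (addStrand (loop q) (n + 2) (p + 1) y) = 0 := by
    intro y
    rw [hx, map_sub, LinearMap.sub_apply, form_addStrand, hu]
    exact sub_self _
  have hxk : ∀ k (hk : k + 1 < n + 2),
      cc (loop q) (n + 3) (k + 1) (by omega) • x = 0 := by
    intro k hk
    obtain ⟨z, hz'⟩ := exists_addStrand_of_openCup
      (v := cc (loop q) (n + 3) (k + 1) (by omega) • x)
      (by rw [openCup_cc q hq (n + 2) p k hk, hox, hx₀k])
    have : z ∈ rad q hq (n + 2) (p + 1) := mem_rad.2 fun y => by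
      rw [← form_addStrand, hz', form_cc q hq,
        ← addStrand_cc q hq (n + 2) (p + 1) k hk, hxf]
    rw [hr, Submodule.mem_bot] at this
    rw [← hz', this, map_zero]
  refine ⟨x, fun h => hx₀ (by rw [← hox, h, map_zero]), fun k hk => ?_⟩
  cases k with
  | succ k => exact hxk k (by omega)
  | zero =>
    -- The last generator sends `x` to a cup over `z`. The generators `e (k+2)` commute with `e 0`
    -- and kill `x`, so `z` is killed; but `V_{n+1,p}` has gap `p + 1`, not `p`, and hence no
    -- trivial subquotient.
    set z := cap (loop q) (n + 1) p x with hzdef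
    have hzc : addCup (loop q) (n + 1) p z = cc (loop q) (n + 3) 0 hk • x := addCup_cap _ _
    have hzk : Killed z := by
      intro k hk'
      apply addCup_injective
      rw [addCup_cc q hq, hzc, ← mul_smul, cc_comm _ _ _ _ _ _ (by omega), mul_smul,
        hxk (k + 1) (by omega), smul_zero, map_zero]
    have hz0 : z = 0 := by
      by_contra h0
      have := ht p (by omega) (hasTrivial_of_killed hzk h0)
      omega
    rw [← hzc, hz0, map_zero]

theorem radSimple_of_killed {n p : ℕ} (hk : ∀ v ∈ rad q hq n p, Killed v)
    (he : ∃ v ∈ rad q hq n p, v ≠ 0) :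
    rad q hq n p ≠ ⊥ ∧ ∀ N ≤ rad q hq n p, N = ⊥ ∨ N = rad q hq n p := by
  obtain ⟨v, hv, hv0⟩ := he
  refine ⟨fun h => hv0 (by rwa [h, Submodule.mem_bot] at hv), fun N hN => ?_⟩
  rw [or_iff_not_imp_left]
  intro h
  obtain ⟨x, hx, hx0⟩ := N.exists_mem_ne_zero_of_ne_bot h
  refine le_antisymm hN fun y hy => ?_
  obtain ⟨c, rfl⟩ := (hk x (hN hx)).exists_smul hq (hk y hy) hx0
  rw [← algebraMap_smul (TL (loop q) n)]
  exact N.smul_mem _ hx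

/-- At equality of gap and index the radical is a line of killed vectors. Otherwise there are no
trivial subquotients, so a submodule of the radical is determined by its pullback along the cup,
which lies in a simple radical. -/
theorem radSimple_step {n : ℕ} (hs : RadSimple hq l (n + 1)) (ht : TrivialBound q l (n + 3))
    (he : ExistsKilled q l (n + 3)) (hk : RadKilled hq l (n + 3)) : RadSimple hq l (n + 3) := by
  intro p hp hg0 hgp
  obtain ⟨p, rfl⟩ : ∃ m, p = m + 1 := ⟨p - 1, by omega⟩
  by_cases hg : p + 1 = gap l (n + 3 - 2 * (p + 1))
  · refine radSimple_of_killed (hk _ hp (by omega) hg) ?_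
    obtain ⟨v, hv0, hv⟩ := he _ hp (by omega) hg
    exact ⟨v, hv.mem_rad hq (by omega), hv0⟩
  have hn3 : n + 3 - 2 * (p + 1) = n + 1 - 2 * p := by omega
  have hT : ¬ HasTrivial (loop q) (n + 3) (p + 1) := fun hT => by
    have := ht _ hp hT
    omega
  obtain ⟨hs0, hs1⟩ := hs p (by omega) (by rwa [← hn3]) (by rw [← hn3]; omega)
  refine ⟨fun h => hs0 ?_, fun N hN => ?_⟩
  · rw [eq_bot_iff]
    intro v hv
    have := addCup_mem_rad hv
    rw [h, Submodule.mem_bot] at this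
    rw [Submodule.mem_bot]
    exact addCup_injective _ _ _ (by rw [this, map_zero])
  · have hN' : comapCup q hq N ≤ rad q hq (n + 1) p := fun v hv => mem_rad_of_addCup (by omega) (hN hv)
    have hcap : ∀ v ∈ N, cap (loop q) (n + 1) p v ∈ comapCup q hq N := fun v hv => by
      rw [mem_comapCup, addCup_cap]
      exact N.smul_mem _ hv
    rcases hs1 _ hN' with h | h
    · left
      by_contra hN0
      obtain ⟨x, hx, hx0⟩ := N.exists_mem_ne_zero_of_ne_bot hN0
      refine hT ⟨N, ⊥, ⟨x, hx, by rwa [Submodule.mem_bot]⟩,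
        cc_smul_mem_of_zero N ⊥ (by omega) fun v hv => ?_⟩
      have := hcap v hv
      rw [h, Submodule.mem_bot] at this
      rw [Submodule.mem_bot, ← addCup_cap, this, map_zero]
    · right
      refine le_antisymm hN ?_
      by_contra hcon
      obtain ⟨x, hx, hxN⟩ := SetLike.not_le_iff_exists.1 hcon
      refine hT ⟨rad q hq (n + 3) (p + 1), N, ⟨x, hx, hxN⟩,
        cc_smul_mem_of_zero _ N (by omega) fun v hv => ?_⟩
      rw [← addCup_cap]
      have := cap_mem_rad (by omega) hv
      rw [← h] at this
      exact this

theorem exists_addCup_two (δ : ℂ) (v : Std δ 2 1) : ∃ u, addCup δ 0 0 u = v := by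
  refine Std.induction (LinearMap.range (addCup δ 0 0)) (fun w => ?_) v
  obtain ⟨i, j, hij, h⟩ := w.exists_adjacent
  have hi : i = 0 := Fin.ext (by simp only [Fin.val_zero]; omega)
  have hj : j = 1 := Fin.ext (by simp only [Fin.val_one]; omega)
  subst hi hj
  obtain ⟨u, rfl⟩ := w.exists_addCup h
  exact ⟨Std.ofLink δ u, addCup_ofLink δ u⟩

theorem killed_two {δ : ℂ} (hδ : δ = 0) (v : Std δ 2 1) : Killed v := by
  intro k hk
  obtain rfl : k = 0 := by omega
  obtain ⟨u, rfl⟩ := exists_addCup_two δ v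
  rw [cc_zero_addCup, hδ, zero_smul]

/-- With a cup the only case is `V_{2,1}`, a line on which `e 0` is the scalar `δ`; its gap is `l -
1`, and `δ = 0` exactly when `l = 2`. -/
theorem radical_small (hω : IsPrimitiveRoot (q ^ 2) l) (hl : 2 ≤ l) {n : ℕ} (hn : n ≤ 2) :
    TrivialBound q l n ∧ RadZero hq l n ∧ RadKilled hq l n ∧ ExistsKilled q l n ∧ RadSimple hq l n := by
  have hδ := loop_eq_zero_iff hω hl hq
  have hcase : ∀ p, 2 * p ≤ n → 0 < p → n = 2 ∧ p = 1 := by omega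
  have hg0 : gap l (2 - 2 * 1) = l - 1 := by simp [gap]
  have hw : addCup (loop q) 0 0 (Std.ofLink _ (LinkState.idle 0)) ≠ 0 := by
    intro h
    have h1 := addCup_injective _ _ _ (h.trans (map_zero _).symm)
    have := form_idle q 0
    rw [h1, map_zero] at this
    exact zero_ne_one this
  refine ⟨?_, ?_, ?_, ?_, ?_⟩
  · intro p hp hT
    rcases Nat.eq_zero_or_pos p with rfl | hp0
    · exact Or.inl rfl
    obtain ⟨rfl, rfl⟩ := hcase p hp hp0
    right
    obtain ⟨A, B, ⟨a, haA, haB⟩, hAB⟩ := hT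
    have : loop q = 0 := by
      by_contra h0
      have h1 := hAB 0 (by omega) a haA
      obtain ⟨u, rfl⟩ := exists_addCup_two _ a
      rw [cc_zero_addCup] at h1
      have h2 := B.smul_mem (algebraMap ℂ _ (loop q)⁻¹) h1
      rw [algebraMap_smul, smul_smul, inv_mul_cancel₀ h0, one_smul] at h2
      exact haB h2
    rw [hg0, hδ.1 this]
  · intro p hp hg
    rcases Nat.eq_zero_or_pos p with rfl | hp0
    · exact rad_zero hq n
    obtain ⟨rfl, rfl⟩ := hcase p hp hp0
    rw [hg0] at hg
    have h0 : loop q ≠ 0 := fun h => by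
      have := hδ.1 h
      omega
    rw [eq_bot_iff]
    intro v hv
    obtain ⟨u, rfl⟩ := exists_addCup_two _ v
    have hu : u ∈ rad q hq 0 0 := mem_rad.2 fun y => by
      have := mem_rad.1 hv (addCup _ 0 0 y)
      rw [form_addCup q hq, cap_addCup, map_smul, smul_eq_mul] at this
      simpa [hq, h0] using this
    rw [rad_zero, Submodule.mem_bot] at hu
    rw [hu, map_zero]
    exact Submodule.zero_mem _
  · intro p hp hp0 hg v _
    obtain ⟨rfl, rfl⟩ := hcase p hp hp0
    exact killed_two (hδ.2 (by omega)) v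
  · intro p hp hp0 hg
    obtain ⟨rfl, rfl⟩ := hcase p hp hp0
    exact ⟨_, hw, killed_two (hδ.2 (by omega)) _⟩
  · intro p hp hg0' hgp
    obtain ⟨rfl, rfl⟩ := hcase p hp (by omega)
    have h0 : loop q = 0 := hδ.2 (by omega)
    refine radSimple_of_killed (fun v _ => killed_two h0 v) ⟨_, mem_rad.2 fun y => ?_, hw⟩
    obtain ⟨u, rfl⟩ := exists_addCup_two _ y
    rw [form_addCup q hq, cap_addCup, smul_eq_zero_of_left h0, map_zero, mul_zero]

theorem radical_all (hω : IsPrimitiveRoot (q ^ 2) l) (hl : 2 ≤ l) (n : ℕ) :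
    TrivialBound q l n ∧ RadZero hq l n ∧ RadKilled hq l n ∧ ExistsKilled q l n ∧ RadSimple hq l n := by
  induction n using Nat.strong_induction_on with
  | _ n ih =>
    by_cases hn : n ≤ 2
    · exact radical_small hω hl hn
    obtain ⟨n, rfl⟩ : ∃ m, n = m + 3 := ⟨n - 3, by omega⟩
    obtain ⟨t1, z1, k1, e1, s1⟩ := ih (n + 1) (by omega)
    obtain ⟨t2, z2, k2, e2, s2⟩ := ih (n + 2) (by omega)
    have t3 := trivialBound_step hω hl t2 z1 k2
    have k3 : RadKilled hq l (n + 3) := radKilled_step z1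
    have e3 := existsKilled_step hω hl e2 z2 t1
    exact ⟨t3, radZero_step t3 z1, k3, e3, radSimple_step s1 t3 e3 k3⟩

end Radical

/-! ### The lowering operator -/

/-- The part of a tensor with a given first index. -/
noncomputable def slice {n : ℕ} (b : Bool) : Tensor (n + 1) →ₗ[ℂ] Tensor n :=
  LinearMap.funLeft ℂ ℂ fun s => (Fin.cons b s : Fin (n + 1) → Bool)

/-- The lowering operator of the quantum group that commutes with the Temperley–Lieb algebra. -/
noncomputable def lower (q : ℂ) : (n : ℕ) → Tensor n →ₗ[ℂ] Tensor n
  | 0 => 0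
  | n + 1 => LinearMap.pi fun s => LinearMap.proj (Fin.tail s) ∘ₗ
      if s 0 then (-q) • lower q n ∘ₗ slice true + slice false else (-q⁻¹) • lower q n ∘ₗ slice false

theorem slice_apply {n : ℕ} (b : Bool) (y : Tensor (n + 1)) (s : Fin n → Bool) :
    slice b y s = y (Fin.cons b s) := rfl

theorem slice_ext {n : ℕ} {y y' : Tensor (n + 1)} (h : ∀ b, slice b y = slice b y') : y = y' :=
  tensor_ext fun b s => congrFun (h b) s

theorem slice_true_lower (q : ℂ) {n : ℕ} (y : Tensor (n + 1)) :
    slice true (lower q (n + 1) y) = (-q) • lower q n (slice true y) + slice false y := by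
  funext s
  simp [slice_apply, lower]

theorem slice_false_lower (q : ℂ) {n : ℕ} (y : Tensor (n + 1)) :
    slice false (lower q (n + 1) y) = (-q⁻¹) • lower q n (slice false y) := by
  funext s
  simp [slice_apply, lower]

theorem slice_tensorOp_succ (q : ℂ) {n : ℕ} (i j : Fin n) (y : Tensor (n + 1)) (b : Bool) :
    slice b (tensorOp q i.succ j.succ y) = tensorOp q i j (slice b y) :=
  funext fun s => tensorOp_cons q i j y b s

theorem slice_slice_tensorOp (q : ℂ) {n : ℕ} (y : Tensor (n + 2)) (a b : Bool) :
    slice b (slice a (tensorOp q 0 1 y)) = if a = b then 0 else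
      (if a then q⁻¹ else q) • slice b (slice a y) + slice a (slice b y) := by
  funext s
  refine (tensorOp_zero_one q y a b s).trans ?_
  by_cases h : a = b
  · rw [if_pos h, if_pos h]; rfl
  · rw [if_neg h, if_neg h]; rfl

/-- The general position reduces to the first two points, since slicing off the first index turns
`lower` into combinations of `lower` and slices. At the first two points the identity is a finite
check of coordinates. -/
theorem lower_tensorOp (q : ℂ) (hq : q ≠ 0) {n : ℕ} (k : ℕ) (hk : k + 1 < n) (y : Tensor n) :
    lower q n (tensorOp q ⟨k, Nat.lt_of_succ_lt hk⟩ ⟨k + 1, hk⟩ y)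
      = tensorOp q ⟨k, Nat.lt_of_succ_lt hk⟩ ⟨k + 1, hk⟩ (lower q n y) := by
  induction k generalizing n with
  | zero =>
    obtain ⟨n, rfl⟩ : ∃ m, n = m + 2 := ⟨n - 2, by omega⟩
    change lower q (n + 2) (tensorOp q 0 1 y) = tensorOp q 0 1 (lower q (n + 2) y)
    refine slice_ext fun a => slice_ext fun b => ?_
    cases a <;> cases b <;>
      simp only [slice_slice_tensorOp, slice_true_lower, slice_false_lower, map_add, map_smul,
        smul_add, smul_smul, if_true, if_false, Bool.false_eq_true, Bool.true_eq_false,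
        map_zero, smul_zero, zero_add, add_zero]
    all_goals
      funext s
      simp only [Pi.add_apply, Pi.smul_apply, Pi.zero_apply, smul_eq_mul]
      field_simp
      try ring
  | succ k ih =>
    obtain ⟨n, rfl⟩ : ∃ m, n = m + 1 := ⟨n - 1, by omega⟩
    have h := fun (b : Bool) (y : Tensor (n + 1)) => slice_tensorOp_succ q ⟨k, by omega⟩ ⟨k + 1, by omega⟩ y b
    simp only [Fin.succ_mk] at h
    refine slice_ext fun b => ?_
    cases b
    · rw [slice_false_lower, h, h, slice_false_lower, ih, map_smul]
    · rw [slice_true_lower, h, h, h, slice_true_lower, ih, map_add, map_smul]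

theorem slice_slice_addCup (q : ℂ) {n p : ℕ} (v : Std (loop q) n p) (a b : Bool) :
    slice b (slice a (toTensor q (n + 2) (p + 1) (addCup _ n p v)))
      = (if a = b then 0 else if a then 1 else q) • toTensor q n p v := by
  funext s
  refine (toTensor_addCup q v a b s).trans ?_
  by_cases h : a = b <;> simp [h]

/-- The tensor with a cup in front. -/
def IsCup (q : ℂ) {n : ℕ} (z : Tensor (n + 2)) (y : Tensor n) : Prop :=
  ∀ a b, slice b (slice a z) = (if a = b then 0 else if a then 1 else q) • y

/-- The cup vector is invariant under the quantum group, so the operator passes to the remaining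
factors. -/
theorem IsCup.map_lower {q : ℂ} (hq : q ≠ 0) {n : ℕ} {z : Tensor (n + 2)} {y : Tensor n}
    (h : IsCup q z y) : IsCup q (lower q (n + 2) z) (lower q n y) := by
  intro a b
  have := h a b
  cases a <;> cases b <;>
    simp [slice_true_lower, slice_false_lower, h _ _, smul_smul, hq]

theorem IsCup.map_lower_pow {q : ℂ} (hq : q ≠ 0) {n : ℕ} {z : Tensor (n + 2)} {y : Tensor n}
    (h : IsCup q z y) (r : ℕ) : IsCup q ((lower q (n + 2) ^ r) z) ((lower q n ^ r) y) := by
  induction r with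
  | zero => exact h
  | succ r ih =>
    rw [pow_succ', pow_succ', Module.End.mul_apply, Module.End.mul_apply]
    exact ih.map_lower hq

theorem lower_pow_tensorOp (q : ℂ) (hq : q ≠ 0) {n : ℕ} (k : ℕ) (hk : k + 1 < n) (r : ℕ)
    (y : Tensor n) :
    (lower q n ^ r) (tensorOp q ⟨k, Nat.lt_of_succ_lt hk⟩ ⟨k + 1, hk⟩ y)
      = tensorOp q ⟨k, Nat.lt_of_succ_lt hk⟩ ⟨k + 1, hk⟩ ((lower q n ^ r) y) := by
  induction r with
  | zero => rfl
  | succ r ih => rw [pow_succ', Module.End.mul_apply, Module.End.mul_apply, ih, lower_tensorOp q hq]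

theorem qint_succ (q : ℂ) (hq : q ≠ 0) (i : ℕ) : qint q (i + 1) = q * qint q i + q⁻¹ ^ i := by
  induction i with
  | zero => simp [qint]
  | succ i ih =>
    rw [qint, pow_succ]
    have : q * q⁻¹ = 1 := mul_inv_cancel₀ hq
    linear_combination q⁻¹ * ih + qint q i * this

theorem lower_symTensor (q : ℂ) (hq : q ≠ 0) (n i : ℕ) :
    lower q n (symTensor (-q⁻¹) n i) = ((-1) ^ i * qint q (i + 1)) • symTensor (-q⁻¹) n (i + 1) := by
  have hf : ∀ n i, slice false (symTensor (-q⁻¹) (n + 1) i) = (-q⁻¹) ^ i • symTensor (-q⁻¹) n i :=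
    fun n i => funext fun s => symTensor_false _ _ _ s
  have ht : ∀ n i, slice true (symTensor (-q⁻¹) (n + 1) (i + 1)) = symTensor (-q⁻¹) n i :=
    fun n i => funext fun s => symTensor_true _ _ _ s
  have ht0 : ∀ n, slice true (symTensor (-q⁻¹) (n + 1) 0) = 0 :=
    fun n => funext fun s => symTensor_true_zero (-q⁻¹) _ s
  induction n generalizing i with
  | zero => simp [lower, symTensor]
  | succ n ih =>
    refine slice_ext fun b => ?_
    cases b
    · rw [slice_false_lower, map_smul, hf, hf, map_smul, ih, smul_smul, smul_smul, smul_smul]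
      congr 1
      ring
    · rw [slice_true_lower, map_smul, ht, hf]
      cases i with
      | zero => rw [ht0]; simp [qint]
      | succ i =>
        rw [ht, ih, smul_smul, ← add_smul]
        congr 1
        rw [qint_succ q hq (i + 1), neg_pow q⁻¹]
        ring

/-- The scalars that arise are signs times `[1], …, [r]`, all nonzero because `r < l`. -/
theorem lower_pow_symTensor {q : ℂ} {l : ℕ} (hω : IsPrimitiveRoot (q ^ 2) l) (hl : 2 ≤ l)
    (hq : q ≠ 0) (n : ℕ) {r : ℕ} (hr : r < l) :
    ∃ c : ℂ, c ≠ 0 ∧ (lower q n ^ r) (symTensor (-q⁻¹) n 0) = c • symTensor (-q⁻¹) n r := by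
  induction r with
  | zero => exact ⟨1, one_ne_zero, (one_smul ℂ _).symm⟩
  | succ r ih =>
    obtain ⟨c, hc, h⟩ := ih (by omega)
    refine ⟨c * ((-1) ^ r * qint q (r + 1)), ?_, ?_⟩
    · refine mul_ne_zero hc (mul_ne_zero (pow_ne_zero _ (by norm_num)) ?_)
      rw [Ne, qint_eq_zero_iff hω hl hq, Nat.mod_eq_of_lt hr]
      exact Nat.succ_ne_zero r
    · rw [pow_succ', Module.End.mul_apply, h, map_smul, lower_symTensor q hq, smul_smul]

theorem toTensor_idle (q : ℂ) (n : ℕ) :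
    toTensor q n 0 (Std.ofLink _ (LinkState.idle n)) = symTensor (-q⁻¹) n 0 := by
  induction n with
  | zero =>
    funext s
    rw [toTensor_ofLink, linkTensor_idle]
    simp [symTensor]
  | succ n ih =>
    refine tensor_ext fun b s => ?_
    rw [← addStrand_idle, toTensor_addStrand, ih]
    cases b
    · rw [symTensor_false]; simp
    · rw [symTensor_true_zero]; simp

/-! ### Homomorphisms between standard representations -/

section Hom

variable {q : ℂ} {hq : q ≠ 0} {l : ℕ}

theorem isCup_addCup (q : ℂ) {n p : ℕ} (v : Std (loop q) n p) :
    IsCup q (toTensor q (n + 2) (p + 1) (addCup _ n p v)) (toTensor q n p v) :=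
  slice_slice_addCup q v

theorem IsCup.ext {q : ℂ} {n : ℕ} {z z' : Tensor (n + 2)} {y : Tensor n} (h : IsCup q z y)
    (h' : IsCup q z' y) : z = z' :=
  slice_ext fun a => slice_ext fun b => (h a b).trans (h' a b).symm

/-- Cups in front pass through the operator, which reduces the claim to the state without cups and a
symmetric tensor of weight `r ≤ n`. -/
theorem exists_lower_pow_ne_zero (hω : IsPrimitiveRoot (q ^ 2) l) (hl : 2 ≤ l) (hq : q ≠ 0)
    {n k r : ℕ} (hr : r < l) (hn : 2 * k + r ≤ n) :
    ∃ v, (lower q n ^ r) (toTensor q n k v) ≠ 0 := by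
  induction k generalizing n with
  | zero =>
    obtain ⟨c, hc, h⟩ := lower_pow_symTensor hω hl hq n hr
    refine ⟨Std.ofLink _ (LinkState.idle n), ?_⟩
    rw [toTensor_idle, h]
    exact smul_ne_zero hc (symTensor_ne_zero _ (by omega))
  | succ k ih =>
    obtain ⟨n, rfl⟩ : ∃ m, n = m + 2 := ⟨n - 2, by omega⟩
    obtain ⟨v, hv⟩ := ih (n := n) (by omega)
    refine ⟨addCup _ n k v, fun h => hv ?_⟩
    have := (isCup_addCup q v).map_lower_pow hq r true false
    rw [h, if_neg (by simp), if_pos rfl, one_smul] at this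
    rw [← this, map_zero, map_zero]

/-- Without cups both sides lie on the line of the symmetric tensor: the radical is killed at `i =
r`. In general the vectors with this property form a submodule, which contains all cups in front by
induction; note that `gap` depends only on `n - 2 i`. -/
theorem lower_pow_mem (hω : IsPrimitiveRoot (q ^ 2) l) (hl : 2 ≤ l) (hq : q ≠ 0)
    {n k i r : ℕ} (hi : i = k + r) (hn : 2 * i ≤ n) (hr : 0 < r) (hg : gap l (n - 2 * i) = r)
    (v : Std (loop q) n k) :
    ∃ u ∈ rad q hq n i, toTensor q n i u = (lower q n ^ r) (toTensor q n k v) := by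
  induction k generalizing n i with
  | zero =>
    obtain rfl : i = r := by omega
    obtain ⟨c, rfl⟩ := std_zero_eq _ _ v
    obtain ⟨-, -, hk, -, hs⟩ := radical_all (hq := hq) hω hl n
    obtain ⟨u, hu, hu0⟩ := (rad q hq n i).exists_mem_ne_zero_of_ne_bot
      (hs i hn (by omega) hg.le).1
    obtain ⟨d, hd⟩ := (hk i hn hr hg.symm u hu).exists_symTensor hq
    obtain ⟨e, -, he⟩ := lower_pow_symTensor hω hl hq n (r := i) (hg ▸ gap_lt (by omega))
    have hd0 : d ≠ 0 := by
      rintro rfl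
      exact hu0 (toTensor_eq_zero q n i u (by rw [hd, zero_smul]))
    refine ⟨(c * e / d) • u, ?_, ?_⟩
    · rw [← algebraMap_smul (TL (loop q) n)]
      exact Submodule.smul_mem _ _ hu
    · rw [map_smul, map_smul, map_smul, toTensor_idle, he, hd, smul_smul, smul_smul,
        div_mul_cancel₀ _ hd0]
  | succ k ih =>
    obtain ⟨i, rfl⟩ : ∃ j, i = j + 1 := ⟨i - 1, by omega⟩
    obtain ⟨n, rfl⟩ : ∃ m, n = m + 2 := ⟨n - 2, by omega⟩
    have hop := fun k hk y => lower_pow_tensorOp q hq (n := n + 2) k hk r y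
    have hcup := fun u : Std (loop q) n k => (isCup_addCup q u).map_lower_pow hq r
    generalize lower q (n + 2) ^ r = F at hop hcup ⊢
    let N : Submodule ℂ (Std (loop q) (n + 2) (k + 1)) :=
      { carrier := {v | ∃ u ∈ rad q hq (n + 2) (i + 1),
          toTensor q (n + 2) (i + 1) u = F (toTensor q (n + 2) (k + 1) v)}
        zero_mem' := ⟨0, Submodule.zero_mem _, by simp only [map_zero]⟩
        add_mem' := by
          rintro v v' ⟨u, hu, h⟩ ⟨u', hu', h'⟩
          exact ⟨u + u', Submodule.add_mem _ hu hu', by simp only [map_add, h, h']⟩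
        smul_mem' := by
          rintro c v ⟨u, hu, h⟩
          refine ⟨c • u, ?_, by simp only [map_smul, h]⟩
          rw [← algebraMap_smul (TL (loop q) (n + 2))]
          exact Submodule.smul_mem _ _ hu }
    have hs : ∀ j, ∀ v ∈ N, gen (loop q) {i | i + 1 < n + 2} j • v ∈ N := by
      rintro j v ⟨u, hu, h⟩
      refine ⟨gen (loop q) {i | i + 1 < n + 2} j • u, Submodule.smul_mem _ _ hu, ?_⟩
      have h1 := toTensor_cc q hq (n + 2) (i + 1) j j.2 u
      have h2 := toTensor_cc q hq (n + 2) (k + 1) j j.2 v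
      rw [cc] at h1 h2
      rw [h1, h2, hop, h]
    have hN : ofStable N hs = ⊤ := by
      refine cup_induction _ fun v => ?_
      obtain ⟨u, hu, h⟩ := ih (n := n) (i := i) (by omega) (by omega)
        (by rw [← hg]; congr 1; omega) v
      refine ⟨addCup _ n i u, addCup_mem_rad hu, ?_⟩
      have h1 := isCup_addCup q u
      rw [h] at h1
      exact h1.ext (hcup v)
    exact (hN.symm ▸ Submodule.mem_top : v ∈ ofStable N hs)

/-- The radical of `V_{n,i}` is a nonzero homomorphic image of the standard representation at the
reflection. -/
theorem exists_hom (hω : IsPrimitiveRoot (q ^ 2) l) (hl : 2 ≤ l) (hq : q ≠ 0)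
    {n k i r : ℕ} (hi : i = k + r) (hn : 2 * i ≤ n) (hr : 0 < r) (hg : gap l (n - 2 * i) = r) :
    ∃ θ : Std (loop q) n k →ₗ[TL (loop q) n] Std (loop q) n i, LinearMap.range θ = rad q hq n i := by
  -- A linear left inverse of the embedding transports the operator back. It need not be
  -- equivariant; equivariance of the composite follows from injectivity of `toTensor`.
  obtain ⟨h, hh⟩ := LinearMap.exists_leftInverse_of_injective (toTensor q n i)
    (LinearMap.ker_eq_bot.2 (toTensor_injective q n i))
  let θ₀ : Std (loop q) n k →ₗ[ℂ] Std (loop q) n i := h ∘ₗ (lower q n ^ r) ∘ₗ toTensor q n k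
  have h0 : ∀ v, toTensor q n i (θ₀ v) = (lower q n ^ r) (toTensor q n k v) ∧
      θ₀ v ∈ rad q hq n i := by
    intro v
    obtain ⟨u, hu, e⟩ := lower_pow_mem hω hl hq hi hn hr hg v
    have : θ₀ v = u := by
      change h ((lower q n ^ r) (toTensor q n k v)) = u
      rw [← e]
      exact LinearMap.congr_fun hh u
    rw [this]
    exact ⟨e, hu⟩
  have hθ : ∀ j v, θ₀ (gen (loop q) {i | i + 1 < n} j • v)
      = gen (loop q) {i | i + 1 < n} j • θ₀ v := by
    intro j v
    apply toTensor_injective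
    have h1 := toTensor_cc q hq n i j j.2 (θ₀ v)
    have h2 := toTensor_cc q hq n k j j.2 v
    rw [cc] at h1 h2
    rw [(h0 _).1, h1, h2, lower_pow_tensorOp q hq, (h0 _).1]
  let θ : Std (loop q) n k →ₗ[TL (loop q) n] Std (loop q) n i :=
    { toFun := θ₀
      map_add' := map_add θ₀
      map_smul' := intertwine (AlgHom.id ℂ _) θ₀ hθ }
  refine ⟨θ, ?_⟩
  have hle : LinearMap.range θ ≤ rad q hq n i := by
    rintro _ ⟨v, rfl⟩
    exact (h0 v).2
  refine (((radical_all (hq := hq) hω hl n).2.2.2.2 i hn (by omega) (by omega)).2 _ hle).resolve_left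
    fun hb => ?_
  obtain ⟨v, hv⟩ := exists_lower_pow_ne_zero hω hl hq (n := n) (k := k) (r := r)
    (hg ▸ gap_lt (by omega)) (by omega)
  have : θ v ∈ (⊥ : Submodule (TL (loop q) n) (Std (loop q) n i)) := hb ▸ LinearMap.mem_range_self θ v
  rw [Submodule.mem_bot] at this
  refine hv ?_
  rw [← (h0 v).1]
  exact (congrArg _ this).trans (map_zero _)

/-! ### The irreducible quotients -/

/-- Cups are removed one at a time down to the state without cups, of norm `1`. Only at `n = 2 i`
does the last removal cost a factor `δ`. -/
theorem rad_ne_top (hq : q ≠ 0) {n i : ℕ} (h : IsIrrLabel (loop q) n i) : rad q hq n i ≠ ⊤ := by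
  induction i generalizing n with
  | zero =>
    intro h0
    rw [rad_zero] at h0
    have : Std.ofLink (loop q) (LinkState.idle n) ∈ (⊥ : Submodule (TL (loop q) n) _) :=
      h0 ▸ Submodule.mem_top
    rw [Submodule.mem_bot] at this
    have h1 := form_idle q n
    rw [this, map_zero] at h1
    exact zero_ne_one h1
  | succ i ih =>
    obtain ⟨h1, h2⟩ := h
    obtain ⟨n, rfl⟩ : ∃ m, n = m + 2 := ⟨n - 2, by omega⟩
    intro h0
    refine ih (n := n) ⟨by omega, fun h => by have := h2 h; omega⟩ (eq_top_iff.2 fun v _ => ?_)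
    have hv : addCup (loop q) n i v ∈ rad q hq (n + 2) (i + 1) := h0 ▸ Submodule.mem_top
    by_cases hn : 1 ≤ n
    · exact mem_rad_of_addCup hn hv
    · have hδ : loop q ≠ 0 := fun h => h2 h (by omega)
      rw [mem_rad] at hv ⊢
      intro y
      have := hv (addCup _ n i y)
      rw [form_addCup q hq, cap_addCup, map_smul, smul_eq_mul] at this
      exact (mul_eq_zero.1 ((mul_eq_zero.1 this).resolve_left hq)).resolve_left hδ

theorem rad_eq_top (hq : q ≠ 0) (h : loop q = 0) (i : ℕ) :
    rad q hq (2 * (i + 1)) (i + 1) = ⊤ := by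
  induction i with
  | zero =>
    refine eq_top_iff.2 fun v _ => mem_rad.2 fun y => ?_
    obtain ⟨u, rfl⟩ := exists_addCup_two _ v
    obtain ⟨z, rfl⟩ := exists_addCup_two _ y
    rw [form_addCup q hq, cap_addCup, smul_eq_zero_of_left h, map_zero, mul_zero]
  | succ i ih =>
    exact cup_induction (n := 2 * (i + 1)) _ fun v => addCup_mem_rad (ih.symm ▸ Submodule.mem_top)

/-- A proper radical of the form contains every proper submodule, so it is the unique maximal one.
-/
theorem jacobson_eq_rad (hq : q ≠ 0) {n i : ℕ} (h : IsIrrLabel (loop q) n i) :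
    Module.jacobson (TL (loop q) n) (Std (loop q) n i) = rad q hq n i := by
  have hr := rad_ne_top hq h
  refine le_antisymm (sInf_le ⟨hr, fun N hN => eq_top_of_not_le_rad hq N (not_le_of_gt hN)⟩)
    (le_sInf fun N hN => ?_)
  by_contra hcon
  have hle : N ≤ rad q hq n i := by
    by_contra h'
    exact hN.1 (eq_top_of_not_le_rad hq N h')
  exact hr (hN.2 _ (lt_of_le_not_ge hle hcon))

/-- The radical of a standard representation is irreducible or zero; if it is not zero, then it is
the irreducible representation at the reflection. -/
theorem exists_equiv_rad (hω : IsPrimitiveRoot (q ^ 2) l) (hl : 2 ≤ l) (hq : q ≠ 0)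
    {n k i r : ℕ} (hi : i = k + r) (hn : 2 * i ≤ n) (hr : 0 < r) (hg : gap l (n - 2 * i) = r) :
    Nonempty (Irr (loop q) n k ≃ₗ[TL (loop q) n] rad q hq n i) := by
  obtain ⟨θ, hθ⟩ := exists_hom hω hl hq hi hn hr hg
  have hs := (radical_all (hq := hq) hω hl n).2.2.2.2 i hn (by omega) (by omega)
  have hk : IsIrrLabel (loop q) n k := ⟨by omega, fun _ => by omega⟩
  have hrt := rad_ne_top hq hk
  have hle : LinearMap.ker θ ≤ rad q hq n k := by
    by_contra h
    have := eq_top_of_not_le_rad hq _ h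
    rw [LinearMap.ker_eq_top] at this
    refine hs.1 ?_
    rw [← hθ, this, LinearMap.range_zero]
  have hker : LinearMap.ker θ = Module.jacobson (TL (loop q) n) (Std (loop q) n k) := by
    rw [jacobson_eq_rad hq hk]
    refine le_antisymm hle ?_
    -- If the radical of `V_{n,k}` mapped onto the range of `θ`, it would together with `ker θ` span
    -- `V_{n,k}`; but it contains `ker θ` and is proper.
    rcases hs.2 ((rad q hq n k).map θ) (by rw [← hθ]; exact LinearMap.map_le_range) with h | h
    · intro v hv
      have : θ v ∈ (rad q hq n k).map θ := Submodule.mem_map_of_mem hv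
      rwa [h, Submodule.mem_bot] at this
    · refine absurd (eq_top_iff.2 fun v _ => ?_) hrt
      have : θ v ∈ (rad q hq n k).map θ := by rw [h, ← hθ]; exact LinearMap.mem_range_self θ v
      obtain ⟨u, hu, huv⟩ := this
      have h2 : v - u ∈ rad q hq n k := hle (by rw [LinearMap.mem_ker, map_sub, huv, sub_self])
      have := Submodule.add_mem _ h2 hu
      rwa [sub_add_cancel] at this
  exact ⟨(Submodule.quotEquivOfEq _ _ hker.symm).trans
    (θ.quotKerEquivRange.trans (LinearEquiv.ofEq _ _ hθ))⟩

end Hom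

/-! ### Traces of representations -/

section RepTrace

variable {A M N : Type} [Ring A] [Algebra ℂ A] [AddCommGroup M] [Module ℂ M]
  [Module A M] [IsScalarTower ℂ A M] [AddCommGroup N] [Module ℂ N] [Module A N] [IsScalarTower ℂ A N]

theorem repTrace_apply (a : A) : repTrace A M a = LinearMap.trace ℂ M (Algebra.lsmul ℂ ℂ M a) := rfl

theorem repTrace_congr (e : M ≃ₗ[A] N) : repTrace A M = repTrace A N := by
  ext a
  rw [repTrace_apply, repTrace_apply, ← LinearMap.trace_conj' _ (e.restrictScalars ℂ)]
  congr 1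
  ext v
  simp [LinearEquiv.conj_apply]

theorem repTrace_of_subsingleton [Subsingleton M] : repTrace A M = 0 := by
  ext a
  rw [repTrace_apply, show Algebra.lsmul ℂ ℂ M a = 0 from Subsingleton.elim _ _, map_zero]
  rfl

/-- A `ℂ`-linear splitting `ι ρ + σ π = 1` and the cyclicity of the trace isolate the two diagonal
blocks; no splitting as modules is needed. -/
theorem repTrace_eq_add [Module.Finite ℂ M] (K : Submodule A M) :
    repTrace A M = repTrace A K + repTrace A (M ⧸ K) := by
  ext a
  let ι : K →ₗ[ℂ] M := K.subtype.restrictScalars ℂ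
  let π : M →ₗ[ℂ] M ⧸ K := K.mkQ.restrictScalars ℂ
  have hι : Function.Injective ι := K.injective_subtype
  have hπ : Function.Surjective π := K.mkQ_surjective
  have : Module.Finite ℂ K := Module.Finite.of_injective ι hι
  have : Module.Finite ℂ (M ⧸ K) := Module.Finite.of_surjective π hπ
  obtain ⟨σ, hσ⟩ := LinearMap.exists_rightInverse_of_surjective π (LinearMap.range_eq_top.2 hπ)
  obtain ⟨τ, hτ⟩ := LinearMap.exists_leftInverse_of_injective ι (LinearMap.ker_eq_bot.2 hι)
  let ρ : M →ₗ[ℂ] K := τ ∘ₗ (LinearMap.id - σ ∘ₗ π)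
  have hid : ι ∘ₗ ρ + σ ∘ₗ π = LinearMap.id := by
    ext v
    have hv : π (v - σ (π v)) = 0 := by
      rw [map_sub, sub_eq_zero]
      exact (LinearMap.congr_fun hσ (π v)).symm
    have hv' : v - σ (π v) ∈ K := (Submodule.Quotient.mk_eq_zero K).1 hv
    have h1 : ι (ρ v) = v - σ (π v) := by
      change ι (τ (ι ⟨v - σ (π v), hv'⟩)) = ι ⟨_, hv'⟩
      exact congrArg ι (LinearMap.congr_fun hτ _)
    change ι (ρ v) + σ (π v) = v
    rw [h1, sub_add_cancel]
  have hρι : ρ ∘ₗ ι = LinearMap.id := by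
    ext v
    have h0 : π (ι v) = 0 := (Submodule.Quotient.mk_eq_zero K).2 v.2
    have : ρ (ι v) = v := by
      change τ (ι v - σ (π (ι v))) = v
      rw [h0, map_zero, sub_zero]
      exact LinearMap.congr_fun hτ v
    exact congrArg _ this
  set f := Algebra.lsmul ℂ ℂ M a with hf
  have e : f = (f ∘ₗ ι) ∘ₗ ρ + (f ∘ₗ σ) ∘ₗ π := by
    rw [LinearMap.comp_assoc, LinearMap.comp_assoc, ← LinearMap.comp_add, hid, LinearMap.comp_id]
  have e1 : ρ ∘ₗ f ∘ₗ ι = Algebra.lsmul ℂ ℂ K a := by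
    have : f ∘ₗ ι = ι ∘ₗ Algebra.lsmul ℂ ℂ K a := rfl
    rw [this, ← LinearMap.comp_assoc, hρι, LinearMap.id_comp]
  have e2 : π ∘ₗ f ∘ₗ σ = Algebra.lsmul ℂ ℂ (M ⧸ K) a := by
    have : π ∘ₗ f = Algebra.lsmul ℂ ℂ (M ⧸ K) a ∘ₗ π := rfl
    rw [← LinearMap.comp_assoc, this, LinearMap.comp_assoc, hσ, LinearMap.comp_id]
  rw [repTrace_apply, ← hf, e, map_add, ← LinearMap.trace_comp_comm' (f ∘ₗ ι) ρ, e1,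
    ← LinearMap.trace_comp_comm' (f ∘ₗ σ) π, e2]
  rfl

end RepTrace

/-! ### The traces of the standard and irreducible representations -/

section Traces

variable {q : ℂ} {l : ℕ}

theorem cc_zero_comm_shiftTwo (δ : ℂ) (n : ℕ) (a : TL δ n) :
    cc δ (n + 2) 0 (by omega) * shiftTwo δ n a = shiftTwo δ n a * cc δ (n + 2) 0 (by omega) := by
  induction a using alg_induction with
  | halg c => rw [AlgHom.commutes, Algebra.commutes]
  | hgen i => rw [← cc, shiftTwo_cc, cc_comm _ _ _ _ _ _ (by omega)]
  | hmul a b ha hb => rw [map_mul, ← mul_assoc, ha, mul_assoc, hb, mul_assoc]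
  | hadd a b ha hb => rw [map_add, mul_add, add_mul, ha, hb]

theorem cap_shiftTwo_smul (hq : q ≠ 0) {n p : ℕ} (a : TL (loop q) n)
    (v : Std (loop q) (n + 2) (p + 1)) :
    cap (loop q) n p (shiftTwo (loop q) n a • v) = a • cap (loop q) n p v := by
  apply addCup_injective
  rw [addCup_cap, addCup_smul q hq, addCup_cap, ← mul_smul, ← mul_smul, cc_zero_comm_shiftTwo]

/-- The first generator factors as cup after cap, and cyclicity of the trace moves the computation
to `V_{n,p}`. -/
theorem repTrace_cc_zero_mul {δ : ℂ} {n p : ℕ} (b : TL δ (n + 2)) :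
    repTrace (TL δ (n + 2)) (Std δ (n + 2) (p + 1)) (cc δ (n + 2) 0 (by omega) * b)
      = LinearMap.trace ℂ _ (cap δ n p ∘ₗ Algebra.lsmul ℂ ℂ _ b ∘ₗ addCup δ n p) := by
  have : Algebra.lsmul ℂ ℂ (Std δ (n + 2) (p + 1)) (cc δ (n + 2) 0 (by omega) * b)
      = addCup δ n p ∘ₗ (cap δ n p ∘ₗ Algebra.lsmul ℂ ℂ _ b) := by
    ext v
    rw [LinearMap.comp_apply, LinearMap.comp_apply, addCup_cap]
    exact mul_smul _ _ _
  rw [repTrace_apply, this, ← LinearMap.trace_comp_comm', LinearMap.comp_assoc]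

theorem repTrace_cc_zero_mul_eq {δ : ℂ} {n p : ℕ} {b : TL δ (n + 2)} {z : ℂ} {a : TL δ n}
    (h : ∀ v, cap δ n p (b • addCup δ n p v) = z • a • v) :
    repTrace (TL δ (n + 2)) (Std δ (n + 2) (p + 1)) (cc δ (n + 2) 0 (by omega) * b)
      = z * repTrace (TL δ n) (Std δ n p) a := by
  have : cap δ n p ∘ₗ Algebra.lsmul ℂ ℂ _ b ∘ₗ addCup δ n p = z • Algebra.lsmul ℂ ℂ _ a :=
    LinearMap.ext h
  rw [repTrace_cc_zero_mul, this, map_smul, smul_eq_mul, repTrace_apply]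

theorem repTrace_cc_mul_shiftTwo_mul_cc (hq : q ≠ 0) {n : ℕ} (hn : 1 ≤ n) (p : ℕ)
    (a : TL (loop q) n) :
    repTrace (TL (loop q) (n + 2)) (Std (loop q) (n + 2) (p + 1))
      (cc (loop q) (n + 2) 0 (by omega) * (shiftTwo (loop q) n a * cc (loop q) (n + 2) 1 (by omega)))
      = repTrace (TL (loop q) n) (Std (loop q) n p) a := by
  rw [repTrace_cc_zero_mul_eq (z := 1) (a := a), one_mul]
  intro v
  rw [mul_smul, cap_shiftTwo_smul hq, cap_cc_one_addCup _ hn, one_smul]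

theorem repTrace_cc_mul_shiftTwo (hq : q ≠ 0) (n p : ℕ) (a : TL (loop q) n) :
    repTrace (TL (loop q) (n + 2)) (Std (loop q) (n + 2) (p + 1))
      (cc (loop q) (n + 2) 0 (by omega) * shiftTwo (loop q) n a)
      = loop q * repTrace (TL (loop q) n) (Std (loop q) n p) a :=
  repTrace_cc_zero_mul_eq fun v => by rw [cap_shiftTwo_smul hq, cap_addCup, smul_comm]

theorem repTrace_cc_mul_zero {δ : ℂ} {n k : ℕ} (hk : k + 1 < n) (b : TL δ n) :
    repTrace (TL δ n) (Std δ n 0) (cc δ n k hk * b) = 0 := by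
  rw [repTrace_apply]
  convert map_zero (LinearMap.trace ℂ (Std δ n 0))
  ext v
  change (_ * b) • v = 0
  rw [mul_smul, cc_smul_idle]

theorem repTrace_std_zero_one (δ : ℂ) (n : ℕ) : repTrace (TL δ n) (Std δ n 0) 1 = 1 := by
  have : Unique (LinkState n 0) := ⟨⟨LinkState.idle n⟩, fun w => w.eq_idle⟩
  rw [repTrace_apply, map_one, LinearMap.trace_one]
  have : Module.finrank ℂ (Std δ n 0) = 1 := by
    change Module.finrank ℂ (LinkState n 0 →₀ ℂ) = 1
    rw [Module.finrank_finsupp_self, Fintype.card_unique]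
  rw [this, Nat.cast_one]

/-- The traces of the standard representations are linearly independent. -/
theorem exists_test (hq : q ≠ 0) {n k : ℕ} (h : IsIrrLabel (loop q) n k) :
    ∃ x : TL (loop q) n, repTrace (TL (loop q) n) (Std (loop q) n k) x = 1 ∧
      ∀ i < k, repTrace (TL (loop q) n) (Std (loop q) n i) x = 0 := by
  induction k generalizing n with
  | zero => exact ⟨1, repTrace_std_zero_one _ n, fun i hi => absurd hi (Nat.not_lt_zero i)⟩
  | succ k ih =>
    obtain ⟨h1, h2⟩ := h
    obtain ⟨n, rfl⟩ : ∃ m, n = m + 2 := ⟨n - 2, by omega⟩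
    obtain ⟨x, hx, hx0⟩ := ih (n := n) ⟨by omega, fun h => by have := h2 h; omega⟩
    -- With a third strand, multiplication by `e 0` and `e 1` transports the traces exactly. On two
    -- strands only `e 0` exists, and its factor `δ` is nonzero by the label condition.
    by_cases hn : 1 ≤ n
    · refine ⟨_, (repTrace_cc_mul_shiftTwo_mul_cc hq hn k x).trans hx, fun i hi => ?_⟩
      cases i with
      | zero => exact repTrace_cc_mul_zero _ _
      | succ i => exact (repTrace_cc_mul_shiftTwo_mul_cc hq hn i x).trans (hx0 i (by omega))
    · have hδ : loop q ≠ 0 := fun h => h2 h (by omega)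
      refine ⟨(loop q)⁻¹ • (cc (loop q) (n + 2) 0 (by omega) * shiftTwo (loop q) n x), ?_,
        fun i hi => ?_⟩
      · rw [map_smul, repTrace_cc_mul_shiftTwo hq, hx, mul_one, smul_eq_mul, inv_mul_cancel₀ hδ]
      · rw [map_smul]
        cases i with
        | zero => rw [repTrace_cc_mul_zero, smul_zero]
        | succ i =>
          rw [repTrace_cc_mul_shiftTwo hq, hx0 i (by omega), mul_zero, smul_zero]

open Classical in
/-- A standard representation has at most two irreducible subquotients. -/
theorem repTrace_std_eq (hω : IsPrimitiveRoot (q ^ 2) l) (hl : 2 ≤ l) (hq : q ≠ 0) {n i : ℕ}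
    (hi : 2 * i ≤ n) (hn : loop q = 0 → n ≠ 0) :
    repTrace (TL (loop q) n) (Std (loop q) n i)
      = (if IsIrrLabel (loop q) n i then repTrace (TL (loop q) n) (Irr (loop q) n i) else 0)
        + (if 0 < gap l (n - 2 * i) ∧ gap l (n - 2 * i) ≤ i then
          repTrace (TL (loop q) n) (Irr (loop q) n (i - gap l (n - 2 * i))) else 0) := by
  rw [repTrace_eq_add (rad q hq n i), add_comm]
  congr 1
  · split_ifs with h
    · exact repTrace_congr (Submodule.quotEquivOfEq _ _ (jacobson_eq_rad hq h).symm)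
    · have h0 : loop q = 0 ∧ 2 * i = n := by
        unfold IsIrrLabel at h
        tauto
      have : rad q hq n i = ⊤ := by
        obtain ⟨h0, rfl⟩ := h0
        obtain ⟨i, rfl⟩ : ∃ j, i = j + 1 := ⟨i - 1, by have := hn h0; omega⟩
        exact rad_eq_top hq h0 i
      have := Submodule.Quotient.subsingleton_iff.2 this
      exact repTrace_of_subsingleton
  · split_ifs with h
    · obtain ⟨e⟩ := exists_equiv_rad hω hl hq (k := i - gap l (n - 2 * i)) (i := i)
        (by omega) hi h.1 rfl
      exact (repTrace_congr e).symm
    · have : rad q hq n i = ⊥ := (radical_all hω hl n).2.1 i hi (by omega)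
      have := (Submodule.subsingleton_iff_eq_bot).2 this
      exact repTrace_of_subsingleton

/-- The other constituent of `V_{n,k}` has a smaller index, where the trace of `x` vanishes by
induction. So the test elements for standard traces also serve for irreducible ones. -/
theorem repTrace_irr_test (hω : IsPrimitiveRoot (q ^ 2) l) (hl : 2 ≤ l) (hq : q ≠ 0) {n k : ℕ}
    (h : IsIrrLabel (loop q) n k) {x : TL (loop q) n}
    (hx : ∀ i < k, repTrace (TL (loop q) n) (Std (loop q) n i) x = 0) :
    repTrace (TL (loop q) n) (Irr (loop q) n k) x = repTrace (TL (loop q) n) (Std (loop q) n k) x := by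
  induction k using Nat.strong_induction_on with
  | _ k ih =>
    have hn : loop q = 0 → n ≠ 0 := fun h0 => by have := h.2 h0; have := h.1; omega
    have h1 := h.1
    rw [repTrace_std_eq hω hl hq h1 hn, if_pos h]
    by_cases hg : 0 < gap l (n - 2 * k) ∧ gap l (n - 2 * k) ≤ k
    · rw [if_pos hg, LinearMap.add_apply, ih (k - gap l (n - 2 * k)) (by omega) ⟨by omega, fun _ => by omega⟩
        (fun i hi => hx i (by omega)), hx _ (by omega), add_zero]
    · rw [if_neg hg, add_zero]

theorem triangular {A : Type*} {f : ℕ → A → ℂ} {d : ℕ → ℂ} {K : ℕ}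
    (h : ∀ k < K, d k ≠ 0 → ∃ x, f k x ≠ 0 ∧ ∀ i < k, f i x = 0)
    (h0 : ∀ x, ∑ i ∈ Finset.range K, d i * f i x = 0) : ∀ k < K, d k = 0 := by
  induction K with
  | zero => exact fun k hk => absurd hk (Nat.not_lt_zero k)
  | succ K ih =>
    have hK : d K = 0 := by
      by_contra hd
      obtain ⟨x, hx, hx0⟩ := h K (Nat.lt_succ_self K) hd
      have := h0 x
      rw [Finset.sum_range_succ, Finset.sum_eq_zero (fun i hi => by
        rw [hx0 i (Finset.mem_range.1 hi), mul_zero]), zero_add] at this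
      exact (mul_ne_zero hd hx) this
    intro k hk
    rcases Nat.lt_succ_iff_lt_or_eq.1 hk with hk | rfl
    · refine ih (fun k hk => h k (by omega)) (fun x => ?_) k hk
      have := h0 x
      rwa [Finset.sum_range_succ, hK, zero_mul, add_zero] at this
    · exact hK

theorem isStdCoeffs_unique (hq : q ≠ 0) {χ : TLInf (loop q) →ₗ[ℂ] ℂ} {c c' : ℕ → ℕ → ℂ}
    (h : IsStdCoeffs χ c) (h' : IsStdCoeffs χ c') : c' = c := by
  obtain ⟨h1, h2, h3⟩ := h
  obtain ⟨h1', h2', h3'⟩ := h'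
  have key : ∀ n, (loop q = 0 → n % 2 = 1) → ∀ i, c' n i = c n i := by
    intro n hn i
    by_cases hi : n < 2 * i
    · rw [h1 n i hi, h1' n i hi]
    refine sub_eq_zero.1 (triangular (d := fun i => c' n i - c n i) (K := n / 2 + 1)
      (f := fun i x => repTrace (TL (loop q) n) (Std (loop q) n i) x)
      (fun k hk _ => ?_) (fun x => ?_) i (by omega))
    · obtain ⟨x, hx, hx0⟩ := exists_test hq (n := n) (k := k)
        ⟨by omega, fun h => by have := hn h; omega⟩
      exact ⟨x, by rw [hx]; exact one_ne_zero, hx0⟩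
    · simp only [sub_mul, Finset.sum_sub_distrib]
      rw [← h3, ← h3', sub_self]
  funext n i
  by_cases hn : loop q = 0 → n % 2 = 1
  · exact key n hn i
  · by_cases hi : n < 2 * i
    · rw [h1 n i hi, h1' n i hi]
    · have hn' : loop q = 0 → (n + 1) % 2 = 1 := by
        intro _
        omega
      rw [h2 n i (by omega), h2' n i (by omega), key _ hn', key _ hn']

theorem isIrrCoeffs_unique (hω : IsPrimitiveRoot (q ^ 2) l) (hl : 2 ≤ l) (hq : q ≠ 0)
    {χ : TLInf (loop q) →ₗ[ℂ] ℂ} {lam lam' : ℕ → ℕ → ℂ}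
    (h : IsIrrCoeffs χ lam) (h' : IsIrrCoeffs χ lam') : lam' = lam := by
  funext n i
  by_cases hi : IsIrrLabel (loop q) n i
  · have hn : loop q = 0 → n ≠ 0 := fun h0 => by have := hi.2 h0; have := hi.1; omega
    refine sub_eq_zero.1 (triangular (d := fun i => lam' n i - lam n i) (K := n / 2 + 1)
      (f := fun i x => repTrace (TL (loop q) n) (Irr (loop q) n i) x)
      (fun k hk hd => ?_) (fun x => ?_) i (by have := hi.1; omega))
    · have hk' : IsIrrLabel (loop q) n k := by
        by_contra hk'
        refine hd ?_
        rw [h.1 n k hk', h'.1 n k hk', sub_zero]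
      obtain ⟨x, hx, hx0⟩ := exists_test hq hk'
      refine ⟨x, ?_, fun i hi => ?_⟩
      · rw [repTrace_irr_test hω hl hq hk' hx0, hx]
        exact one_ne_zero
      · rw [repTrace_irr_test hω hl hq ⟨by have := hk'.1; omega, fun _ => by have := hk'.1; omega⟩
          (fun j hj => hx0 j (by omega)), hx0 i hi]
    · simp only [sub_mul, Finset.sum_sub_distrib]
      rw [← h.2 n hn, ← h'.2 n hn, sub_self]
  · rw [h.1 n i hi, h'.1 n i hi]

/-- Passes from the gap of the larger index `i` to a residue at the smaller index `k`, with `N = n -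
2 k` and `p = i - k`. So for given `k` there is at most one `i > k` whose radical is `L_{n,k}`. -/
theorem gap_eq_iff_mod (hl : 2 ≤ l) {N p : ℕ} (hp : 2 * p ≤ N) :
    gap l (N - 2 * p) = p ↔ (N + 1) % l = p := by
  constructor
  · intro h
    have hlt : p < l := h ▸ gap_lt (by omega)
    have := (gap_eq_iff (by omega) hlt).1 h
    have e : N + 1 = (N - 2 * p + 1 + p) + p := by omega
    rw [e, Nat.add_mod, this, zero_add, Nat.mod_mod, Nat.mod_eq_of_lt hlt]
  · intro h
    rw [gap_eq_iff (by omega) (h ▸ Nat.mod_lt _ (by omega))]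
    have h1 := Nat.div_add_mod (N + 1) l
    rw [h] at h1
    have e : N - 2 * p + 1 + p = l * ((N + 1) / l) := by omega
    rw [e, Nat.mul_mod_right]

open Classical in
/-- The coefficients of a trace with respect to the irreducible traces. -/
noncomputable def irrCoeff (δ : ℂ) (l : ℕ) (c : ℕ → ℕ → ℂ) (n k : ℕ) : ℂ :=
  if IsIrrLabel δ n k then
    c n k + if 0 < (n - 2 * k + 1) % l ∧ 2 * ((n - 2 * k + 1) % l) ≤ n - 2 * k then
      c n (k + (n - 2 * k + 1) % l) else 0
  else 0

/-- Each standard trace is replaced by its at most two irreducible traces, and the double sum is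
regrouped by the irreducible label. -/
theorem isIrrCoeffs_irrCoeff (hω : IsPrimitiveRoot (q ^ 2) l) (hl : 2 ≤ l) (hq : q ≠ 0)
    {χ : TLInf (loop q) →ₗ[ℂ] ℂ} {c : ℕ → ℕ → ℂ} (h : IsStdCoeffs χ c) :
    IsIrrCoeffs χ (irrCoeff (loop q) l c) := by
  classical
  refine ⟨fun n i hi => if_neg hi, fun n hn a => ?_⟩
  set L := fun k => repTrace (TL (loop q) n) (Irr (loop q) n k) a
  set J := fun k => (n - 2 * k + 1) % l
  have hB : ∀ i ∈ Finset.range (n / 2 + 1), repTrace (TL (loop q) n) (Std (loop q) n i) a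
      = (if IsIrrLabel (loop q) n i then L i else 0)
        + ∑ k ∈ Finset.range (n / 2 + 1), if i = k + J k ∧ 0 < J k then L k else 0 := by
    intro i hi
    have hi' : 2 * i ≤ n := by have := Finset.mem_range.1 hi; omega
    rw [repTrace_std_eq hω hl hq hi' hn, LinearMap.add_apply]
    congr 1
    · split_ifs <;> rfl
    · have hJ : ∀ k ∈ Finset.range (n / 2 + 1), (i = k + J k ∧ 0 < J k) ↔
          (0 < gap l (n - 2 * i) ∧ k + gap l (n - 2 * i) = i) := by
        intro k hk
        by_cases hki : k < i
        · have := gap_eq_iff_mod hl (N := n - 2 * k) (p := i - k) (by omega)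
          rw [show n - 2 * k - 2 * (i - k) = n - 2 * i by omega] at this
          change (i = k + (n - 2 * k + 1) % l ∧ 0 < (n - 2 * k + 1) % l) ↔ _
          omega
        · omega
      rw [Finset.sum_congr rfl fun k hk => if_congr (hJ k hk) rfl rfl]
      split_ifs with hg
      · rw [Finset.sum_eq_single_of_mem (i - gap l (n - 2 * i)) (by
          rw [Finset.mem_range] at hi ⊢; omega) (fun k _ hk => if_neg (by omega)), if_pos (by omega)]
      · rw [Finset.sum_eq_zero fun k _ => if_neg (by omega)]
        rfl
  rw [h.2.2, Finset.sum_congr rfl fun i hi => by rw [hB i hi, mul_add, Finset.mul_sum],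
    Finset.sum_add_distrib, Finset.sum_comm, ← Finset.sum_add_distrib]
  refine Finset.sum_congr rfl fun k hk => ?_
  have hk' : 2 * k ≤ n := by have := Finset.mem_range.1 hk; omega
  have hS : ∑ i ∈ Finset.range (n / 2 + 1), c n i * (if i = k + J k ∧ 0 < J k then L k else 0)
      = (if 0 < J k ∧ 2 * J k ≤ n - 2 * k then c n (k + J k) else 0) * L k := by
    split_ifs with hJ
    · rw [Finset.sum_eq_single_of_mem (k + J k) (by rw [Finset.mem_range]; omega)
        (fun i _ hi => by rw [if_neg (fun h => hi h.1), mul_zero]), if_pos ⟨rfl, hJ.1⟩]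
    · rw [zero_mul]
      refine Finset.sum_eq_zero fun i hi => ?_
      rw [Finset.mem_range] at hi
      rw [if_neg (by omega), mul_zero]
  rw [hS, irrCoeff]
  split_ifs with h1 h2 h2
  · rw [add_mul]
  · rw [add_zero, zero_mul, add_zero]
  · have : n ≠ 2 * k := by
      have := h2.1
      have := h2.2
      omega
    exact absurd ⟨hk', fun _ h => this h.symm⟩ h1
  · simp

end Traces

/-! ### Traces on the infinite algebra -/

section Infinite

variable {δ : ℂ}

theorem toInf_cc (δ : ℂ) (n k : ℕ) (hk : k + 1 < n) :
    toInf δ n (cc δ n k hk) = gen δ Set.univ ⟨k, trivial⟩ := liftHom_gen _ _ _ _ _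

theorem exists_toInf (a : TLInf δ) : ∃ N, ∀ n, N ≤ n → ∃ b : TL δ n, toInf δ n b = a := by
  induction a using alg_induction with
  | halg c => exact ⟨0, fun n _ => ⟨algebraMap ℂ _ c, AlgHom.commutes _ c⟩⟩
  | hgen i => exact ⟨i + 2, fun n hn => ⟨cc δ n i (by omega), toInf_cc δ n i _⟩⟩
  | hmul a b ha hb =>
    obtain ⟨N, hN⟩ := ha
    obtain ⟨N', hN'⟩ := hb
    refine ⟨max N N', fun n hn => ?_⟩
    obtain ⟨x, rfl⟩ := hN n (le_of_max_le_left hn)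
    obtain ⟨y, rfl⟩ := hN' n (le_of_max_le_right hn)
    exact ⟨x * y, map_mul _ x y⟩
  | hadd a b ha hb =>
    obtain ⟨N, hN⟩ := ha
    obtain ⟨N', hN'⟩ := hb
    refine ⟨max N N', fun n hn => ?_⟩
    obtain ⟨x, rfl⟩ := hN n (le_of_max_le_left hn)
    obtain ⟨y, rfl⟩ := hN' n (le_of_max_le_right hn)
    exact ⟨x + y, map_add _ x y⟩

theorem repTrace_mul_comm {A M : Type} [Ring A] [Algebra ℂ A] [AddCommGroup M] [Module ℂ M]
    [Module A M] [IsScalarTower ℂ A M] (a b : A) : repTrace A M (a * b) = repTrace A M (b * a) := by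
  rw [repTrace_apply, repTrace_apply, map_mul (Algebra.lsmul ℂ ℂ M),
    map_mul (Algebra.lsmul ℂ ℂ M), LinearMap.trace_mul_comm]

variable {χ χ' : TLInf δ →ₗ[ℂ] ℂ} {c c' : ℕ → ℕ → ℂ}

theorem IsStdCoeffs.mul_comm (h : IsStdCoeffs χ c) (a b : TLInf δ) : χ (a * b) = χ (b * a) := by
  obtain ⟨N, hN⟩ := exists_toInf a
  obtain ⟨N', hN'⟩ := exists_toInf b
  obtain ⟨x, rfl⟩ := hN (max N N') (le_max_left _ _)
  obtain ⟨y, rfl⟩ := hN' (max N N') (le_max_right _ _)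
  rw [← map_mul, ← map_mul, h.2.2, h.2.2]
  exact Finset.sum_congr rfl fun i _ => by rw [repTrace_mul_comm]

theorem IsStdCoeffs.map_one (h : IsStdCoeffs χ c) : χ 1 = c 0 0 := by
  have := h.2.2 0 1
  rwa [_root_.map_one, Nat.zero_div, zero_add, Finset.sum_range_one, repTrace_std_zero_one,
    mul_one] at this

theorem IsStdCoeffs.smul (h : IsStdCoeffs χ c) (z : ℂ) : IsStdCoeffs (z • χ) fun n i => z * c n i := by
  refine ⟨fun n i hi => ?_, fun n i hi => ?_, fun n a => ?_⟩
  · change z * c n i = 0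
    rw [h.1 n i hi, mul_zero]
  · change z * c n i = z * c (n + 1) i + z * c (n + 1) (i + 1)
    rw [h.2.1 n i hi, mul_add]
  · rw [LinearMap.smul_apply, h.2.2, smul_eq_mul, Finset.mul_sum]
    exact Finset.sum_congr rfl fun i _ => (mul_assoc _ _ _).symm

theorem IsStdCoeffs.sub (h : IsStdCoeffs χ c) (h' : IsStdCoeffs χ' c') :
    IsStdCoeffs (χ - χ') fun n i => c n i - c' n i := by
  refine ⟨fun n i hi => ?_, fun n i hi => ?_, fun n a => ?_⟩
  · change c n i - c' n i = 0
    rw [h.1 n i hi, h'.1 n i hi, sub_zero]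
  · change c n i - c' n i = c (n + 1) i - c' (n + 1) i + (c (n + 1) (i + 1) - c' (n + 1) (i + 1))
    rw [h.2.1 n i hi, h'.2.1 n i hi]
    ring
  · rw [LinearMap.sub_apply, h.2.2, h'.2.2, ← Finset.sum_sub_distrib]
    exact Finset.sum_congr rfl fun i _ => (sub_mul _ _ _).symm

/-- The embedding `e k ↦ e (k + 2)` of `TL_∞` into itself. -/
noncomputable def shiftTwoInf (δ : ℂ) : TLInf δ →ₐ[ℂ] TLInf δ :=
  liftHom (fun i => gen δ Set.univ ⟨i + 2, trivial⟩)
    (fun _ => gen_sq _ _ _) (fun _ _ h => gen_zigzag _ _ _ _ (by simp only; omega))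
    (fun _ _ h => gen_comm _ _ _ _ (by simp only; omega))

theorem shiftTwoInf_gen (δ : ℂ) (k : ℕ) :
    shiftTwoInf δ (gen δ Set.univ ⟨k, trivial⟩) = gen δ Set.univ ⟨k + 2, trivial⟩ :=
  liftHom_gen _ _ _ _ _

theorem toInf_shiftTwo (δ : ℂ) (n : ℕ) (a : TL δ n) :
    toInf δ (n + 2) (shiftTwo δ n a) = shiftTwoInf δ (toInf δ n a) := by
  induction a using alg_induction with
  | halg c => simp only [AlgHom.commutes]
  | hgen i =>
    rw [← cc, shiftTwo_cc, toInf_cc, toInf_cc, shiftTwoInf_gen]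
  | hmul a b ha hb => simp only [map_mul, ha, hb]
  | hadd a b ha hb => simp only [map_add, ha, hb]

/-- The functional `x ↦ χ (e 0 * x' * e 1)`, where `x'` is `x` moved by two strands. -/
noncomputable def cupTrace (χ : TLInf δ →ₗ[ℂ] ℂ) : TLInf δ →ₗ[ℂ] ℂ :=
  χ ∘ₗ LinearMap.mulLeft ℂ (gen δ Set.univ ⟨0, trivial⟩)
    ∘ₗ LinearMap.mulRight ℂ (gen δ Set.univ ⟨1, trivial⟩) ∘ₗ (shiftTwoInf δ).toLinearMap

theorem cupTrace_toInf (χ : TLInf δ →ₗ[ℂ] ℂ) {n : ℕ} (hn : 1 ≤ n) (a : TL δ n) :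
    cupTrace χ (toInf δ n a) = χ (toInf δ (n + 2)
      (cc δ (n + 2) 0 (by omega) * (shiftTwo δ n a * cc δ (n + 2) 1 (by omega)))) := by
  rw [map_mul (toInf δ (n + 2)), map_mul (toInf δ (n + 2)), toInf_shiftTwo, toInf_cc, toInf_cc]
  rfl

theorem exists_algebraMap_of_zero (a : TL δ 0) : ∃ z : ℂ, a = algebraMap ℂ _ z := by
  induction a using alg_induction with
  | halg c => exact ⟨c, rfl⟩
  | hgen i => exact absurd i.2 (Nat.not_lt_zero _)
  | hmul a b ha hb =>
    obtain ⟨z, rfl⟩ := ha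
    obtain ⟨w, rfl⟩ := hb
    exact ⟨z * w, (map_mul _ _ _).symm⟩
  | hadd a b ha hb =>
    obtain ⟨z, rfl⟩ := ha
    obtain ⟨w, rfl⟩ := hb
    exact ⟨z + w, (map_add _ _ _).symm⟩

theorem repTrace_std_zero_algebraMap (δ : ℂ) (n : ℕ) (z : ℂ) :
    repTrace (TL δ n) (Std δ n 0) (algebraMap ℂ _ z) = z := by
  rw [Algebra.algebraMap_eq_smul_one, map_smul, repTrace_std_zero_one, smul_eq_mul, mul_one]

end Infinite

/-! ### Coefficients of extremal and multiplicative traces -/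

section Coefficients

variable {q : ℂ} {χ : TLInf (loop q) →ₗ[ℂ] ℂ} {c : ℕ → ℕ → ℂ}

theorem IsStdCoeffs.cupTrace (hq : q ≠ 0) (h : IsStdCoeffs χ c) :
    IsStdCoeffs (cupTrace χ) fun n i => c (n + 2) (i + 1) := by
  have key : ∀ n, 1 ≤ n → ∀ a : TL (loop q) n, TemperleyLieb.cupTrace χ (toInf (loop q) n a) =
      ∑ i ∈ Finset.range (n / 2 + 1), c (n + 2) (i + 1) * repTrace (TL (loop q) n) (Std (loop q) n i) a := by
    intro n hn a
    rw [cupTrace_toInf χ hn, h.2.2, show (n + 2) / 2 + 1 = n / 2 + 1 + 1 by omega,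
      Finset.sum_range_succ', repTrace_cc_mul_zero, mul_zero, add_zero]
    exact Finset.sum_congr rfl fun i _ => by rw [repTrace_cc_mul_shiftTwo_mul_cc hq hn]
  refine ⟨fun n i hi => h.1 _ _ (by omega), fun n i hi => h.2.1 _ _ (by omega), fun n a => ?_⟩
  -- `TL_2` has no `e 1`, so for `n = 0` the value is taken from `n = 1`, where the coefficient is
  -- `c 3 1 = c 2 1 - c 3 2 = c 2 1`.
  rcases Nat.eq_zero_or_pos n with rfl | hn
  · obtain ⟨z, rfl⟩ := exists_algebraMap_of_zero a
    have h1 := key 1 le_rfl (algebraMap ℂ _ z)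
    rw [AlgHom.commutes, show 1 / 2 + 1 = 1 from rfl, Finset.sum_range_one,
      repTrace_std_zero_algebraMap] at h1
    rw [AlgHom.commutes, h1, Nat.zero_div, zero_add, Finset.sum_range_one,
      repTrace_std_zero_algebraMap]
    have h2 := h.2.1 2 1 le_rfl
    rw [h.1 3 2 (by omega), add_zero] at h2
    simp only [zero_add, h2]
  · exact key n hn a

theorem mem_positiveTraces {δ : ℂ} {χ : TLInf δ →ₗ[ℂ] ℂ} {c : ℕ → ℕ → ℝ}
    (h : IsStdCoeffs χ fun n i => (c n i : ℂ)) (h0 : c 0 0 = 1) (hc : ∀ n i, 0 ≤ c n i) :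
    χ ∈ positiveTraces δ :=
  ⟨⟨h.mul_comm, by rw [h.map_one, h0, Complex.ofReal_one]⟩, c, h, hc⟩

theorem IsExtremal.exists_coeffs (hq : q ≠ 0) (hχ : IsExtremal χ) : ∃ c : ℕ → ℕ → ℂ,
    IsStdCoeffs χ c ∧ c 0 0 = 1 ∧ ∀ n i, 2 * i ≤ n → c (n + 2) (i + 1) = c 2 1 * c n i := by
  obtain ⟨⟨⟨-, h1⟩, c, hc, hpos⟩, hext⟩ := hχ
  have hz : ∀ n i, n < 2 * i → c n i = 0 := fun n i hi => Complex.ofReal_eq_zero.1 (hc.1 n i hi)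
  have hs : ∀ n i, 2 * i ≤ n → c n i = c (n + 1) i + c (n + 1) (i + 1) :=
    fun n i hi =>
    Complex.ofReal_injective ((hc.2.1 n i hi).trans (Complex.ofReal_add _ _).symm)
  have h00 : c 0 0 = 1 := by
    rw [hc.map_one] at h1
    exact_mod_cast h1
  refine ⟨_, hc, by rw [h00, Complex.ofReal_one], ?_⟩
  set γ := c 2 1 with hγ
  have hcup := hc.cupTrace hq
  have hle : ∀ n i, 2 * i ≤ n → c (n + 2) (i + 1) ≤ c n i := by
    intro n i hi
    have e1 := hs n i hi
    have e2 := hs (n + 1) i (by omega)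
    have p1 := hpos (n + 1) (i + 1)
    have p2 := hpos (n + 2) i
    rw [e1, e2]
    linarith
  -- For `γ = 0` no normalization is possible, but positivity and the restriction rule propagate the
  -- zero to all coefficients with a cup.
  rcases (hpos 2 1).eq_or_lt with h0 | h0
  · have hzero : ∀ n i, c (n + 2) (i + 1) = 0 := by
      intro n
      induction n with
      | zero =>
        intro i
        cases i with
        | zero => exact h0.symm
        | succ i => exact hz _ _ (by omega)
      | succ n ih =>
        intro i
        by_cases hi : 2 * i ≤ n
        · have e := hs (n + 2) (i + 1) (by omega)
          rw [ih] at e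
          have p1 := hpos (n + 1 + 2) (i + 1)
          have p2 := hpos (n + 1 + 2) (i + 1 + 1)
          linarith
        · cases i with
          | zero => omega
          | succ i =>
            by_cases hi' : 2 * i ≤ n
            · have e := hs (n + 2) (i + 1) (by omega)
              rw [ih] at e
              have p1 := hpos (n + 1 + 2) (i + 1)
              have p2 := hpos (n + 1 + 2) (i + 1 + 1)
              linarith
            · exact hz _ _ (by omega)
    intro n i _
    rw [hzero, hγ, ← h0]
    simp
  -- The restriction rule up to three strands gives `1 = c 3 0 + 2 γ`.
  · have hlt : γ < 1 := by
      have e0 := hs 0 0 le_rfl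
      have e1 := hs 1 0 (by omega)
      have e2 := hs 2 0 (by omega)
      have e3 := hs 2 1 le_rfl
      have z1 := hz 1 1 (by omega)
      have z2 := hz 3 2 (by omega)
      have p := hpos 3 0
      norm_num at e0 e1 e2 e3
      linarith
    have h1γ : (0 : ℝ) < 1 - γ := sub_pos.2 hlt
    have m1 : (γ⁻¹ : ℂ) • TemperleyLieb.cupTrace χ ∈ positiveTraces (loop q) := by
      refine mem_positiveTraces (c := fun n i => γ⁻¹ * c (n + 2) (i + 1)) ?_
        (inv_mul_cancel₀ h0.ne') fun n i => mul_nonneg (inv_nonneg.2 h0.le) (hpos _ _)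
      simpa using hcup.smul (γ⁻¹ : ℂ)
    have m2 : ((1 - γ)⁻¹ : ℂ) • (χ - TemperleyLieb.cupTrace χ) ∈ positiveTraces (loop q) := by
      refine mem_positiveTraces (c := fun n i => (1 - γ)⁻¹ * (c n i - c (n + 2) (i + 1))) ?_
        ?_ fun n i => mul_nonneg (inv_nonneg.2 h1γ.le) ?_
      · simpa using (hc.sub hcup).smul ((1 - γ)⁻¹ : ℂ)
      · rw [h00]
        exact inv_mul_cancel₀ h1γ.ne'
      · by_cases hi : 2 * i ≤ n
        · exact sub_nonneg.2 (hle n i hi)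
        · rw [hz n i (by omega), hz (n + 2) (i + 1) (by omega), sub_zero]
    have hγ0 : (γ : ℂ) ≠ 0 := Complex.ofReal_ne_zero.2 h0.ne'
    have hγ1 : (1 - γ : ℂ) ≠ 0 := by exact_mod_cast h1γ.ne'
    -- `χ` is the combination, with weights `γ` and `1 - γ`, of the normalized cup trace and the
    -- normalized remainder; extremality identifies the former with `χ`.
    have := hext m1 m2 ⟨γ, 1 - γ, h0, h1γ, by ring, by
      rw [← Complex.coe_smul, ← Complex.coe_smul (1 - γ), smul_smul, smul_smul, Complex.ofReal_sub,
        Complex.ofReal_one, mul_inv_cancel₀ hγ0, mul_inv_cancel₀ hγ1, one_smul, one_smul]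
      abel⟩
    have h2 : TemperleyLieb.cupTrace χ = (γ : ℂ) • χ := by
      conv_rhs => rw [← this, smul_smul, mul_inv_cancel₀ hγ0, one_smul]
    rw [h2] at hcup
    intro n i _
    exact congrFun (congrFun (isStdCoeffs_unique hq (hc.smul γ) hcup) n) i

theorem IsMultiplicative.exists_coeffs {δ : ℂ} {χ : TLInf δ →ₗ[ℂ] ℂ} (hχ : IsMultiplicative χ) :
    ∃ c : ℕ → ℕ → ℂ, IsStdCoeffs χ c ∧ c 0 0 = 1 ∧
      ∀ n i, 2 * i ≤ n → c (n + 2) (i + 1) = c 2 1 * c n i := by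
  obtain ⟨⟨-, h1⟩, c, hc, hm⟩ := hχ
  refine ⟨c, hc, by rw [← hc.map_one, h1], fun n i hi => ?_⟩
  have := hm n i 2 1 hi le_rfl
  rw [show 2 - 2 * 1 = 0 from rfl, Nat.min_zero, zero_add, Finset.sum_range_one, add_zero] at this
  rw [mul_comm, this]

theorem coeff_eq_pow_mul {c : ℕ → ℕ → ℂ} {γ : ℂ}
    (h : ∀ n i, 2 * i ≤ n → c (n + 2) (i + 1) = γ * c n i) {n i : ℕ} (hi : 2 * i ≤ n) :
    c n i = γ ^ i * c (n - 2 * i) 0 := by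
  induction i generalizing n with
  | zero => simp
  | succ i ih =>
    obtain ⟨n, rfl⟩ : ∃ m, n = m + 2 := ⟨n - 2, by omega⟩
    rw [h n i (by omega), ih (by omega), show n + 2 - 2 * (i + 1) = n - 2 * i by omega, pow_succ']
    ring

theorem exists_add_inv_eq (s : ℂ) : ∃ r : ℂ, r ≠ 0 ∧ r + r⁻¹ = s := by
  obtain ⟨t, ht⟩ := IsAlgClosed.exists_pow_nat_eq (s ^ 2 - 4) (show 0 < 2 by norm_num)
  have h : (s + t) / 2 * ((s - t) / 2) = 1 := by linear_combination -(1 / 4) * ht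
  refine ⟨(s + t) / 2, left_ne_zero_of_mul_eq_one h, ?_⟩
  rw [inv_eq_of_mul_eq_one_right h]
  ring

/-- Any square root `s` of `γ⁻¹` serves: with `s = r + r⁻¹`, the rescaled sequence `s ^ n * a n`
satisfies the recursion of the quantum integers. -/
theorem exists_qint {a : ℕ → ℂ} {γ : ℂ} (h0 : a 0 = 1) (h1 : a 1 = 1)
    (h : ∀ n, a (n + 2) = a (n + 1) - γ * a n) :
    (γ = 0 ∧ ∀ n, a n = 1) ∨ ∃ r : ℂ, r ≠ 0 ∧ qint r 2 ≠ 0 ∧ γ = (qint r 2 ^ 2)⁻¹ ∧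
      ∀ n, a n = qint r (n + 1) / qint r 2 ^ n := by
  by_cases hγ : γ = 0
  · refine Or.inl ⟨hγ, fun n => ?_⟩
    induction n using Nat.twoStepInduction with
    | zero => exact h0
    | one => exact h1
    | more n _ ih => rw [h, ih, hγ, zero_mul, sub_zero]
  · right
    obtain ⟨s, hs⟩ := IsAlgClosed.exists_pow_nat_eq γ⁻¹ (show 0 < 2 by norm_num)
    obtain ⟨r, hr, rfl⟩ := exists_add_inv_eq s
    have h2 : qint r 2 = r + r⁻¹ := by simp [qint]
    have hs0 : r + r⁻¹ ≠ 0 := by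
      intro h
      rw [h] at hs
      exact inv_ne_zero hγ (by rw [← hs]; norm_num)
    have hγs : γ * (r + r⁻¹) ^ 2 = 1 := by rw [hs, mul_inv_cancel₀ hγ]
    refine ⟨r, hr, by rwa [h2], by rw [h2, hs, inv_inv], fun n => ?_⟩
    rw [h2]
    induction n using Nat.twoStepInduction with
    | zero => simp [h0, qint]
    | one => rw [h1, h2, pow_one, div_self hs0]
    | more n ih1 ih2 =>
      have h3 : qint r (n + 2 + 1) = (r + r⁻¹) * qint r (n + 1 + 1) - qint r (n + 1) := by rw [qint]
      rw [h, ih1, ih2, h3, eq_div_iff (pow_ne_zero _ hs0), sub_mul, pow_succ, pow_succ]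
      rw [pow_succ]
      generalize r + r⁻¹ = s at *
      field_simp
      linear_combination (-qint r (n + 1)) * hγs

end Coefficients

theorem isCritical_zero_iff {l n : ℕ} : IsCritical l n 0 ↔ (n + 1) % l = 0 := by
  rw [← Nat.dvd_iff_mod_eq_zero]
  constructor
  · rintro ⟨k, -, hk⟩
    refine ⟨k, ?_⟩
    rw [mul_comm]
    zify
    rw [← hk]
    simp
  · rintro ⟨k, hk⟩
    refine ⟨k, Nat.pos_of_ne_zero fun h => ?_, ?_⟩
    · rw [h] at hk
      omega
    · zify at hk
      rw [mul_comm (k : ℤ), ← hk]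
      simp

end TemperleyLieb

/-! ### The theorem -/

open TemperleyLieb in
theorem mainTheorem3 (q : ℂ) (l : ℕ) (hl : IsLeast {k : ℕ | 0 < k ∧ q ^ (2 * k) = 1} l)
    (hl2 : 2 ≤ l) (χ : TLInf (q + q⁻¹) →ₗ[ℂ] ℂ) (hχ : IsExtremal χ ∨ IsMultiplicative χ) :
    ∃ (c lam : ℕ → ℕ → ℂ) (γ : ℂ),
      -- the coefficients in the two bases, which exist and are unique
      (IsStdCoeffs χ c ∧ ∀ c', IsStdCoeffs χ c' → c' = c) ∧
      (IsIrrCoeffs χ lam ∧ ∀ lam', IsIrrCoeffs χ lam' → lam' = lam) ∧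
      -- the parameter and the generic coefficients
      γ = c 2 1 ∧
      ((γ = 0 ∧ ∀ n, c n 0 = 1) ∨
        ∃ r : ℂ, r ≠ 0 ∧ qint r 2 ≠ 0 ∧ γ = (qint r 2 ^ 2)⁻¹ ∧
          ∀ n, c n 0 = qint r (n + 1) / qint r 2 ^ n) ∧
      -- the coefficients in the basis of irreducible traces
      lam 0 0 = (if l = 2 then 0 else 1) ∧
      lam 1 0 = 1 ∧
      (∀ n i, 2 * i ≤ n → lam n i = γ ^ i * lam (n - 2 * i) 0) ∧
      (∀ n, 1 ≤ n → IsCritical l n 0 → lam n 0 = c n 0) ∧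
      (∀ n, 1 ≤ n → ¬ IsCritical l n 0 →
        lam n 0 = c n 0 + γ ^ ((n + 1) % l) *
          (if 2 * ((n + 1) % l) ≤ n then c (n - 2 * ((n + 1) % l)) 0 else 0)) := by
  have hl0 : 0 < l := hl.1.1
  have hq : q ≠ 0 := by
    rintro rfl
    have := hl.1.2
    rw [zero_pow (by omega)] at this
    exact zero_ne_one this
  have hω : IsPrimitiveRoot (q ^ 2) l := by
    refine IsPrimitiveRoot.mk_of_lt _ hl0 (by rw [← pow_mul]; exact hl.1.2) fun k hk hkl h => ?_
    rw [← pow_mul] at h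
    exact absurd (hl.2 ⟨hk, h⟩) (not_le.2 hkl)
  obtain ⟨c, hc, h00, hγ⟩ : ∃ c : ℕ → ℕ → ℂ, IsStdCoeffs χ c ∧ c 0 0 = 1 ∧
      ∀ n i, 2 * i ≤ n → c (n + 2) (i + 1) = c 2 1 * c n i :=
    hχ.elim (fun h => h.exists_coeffs hq) fun h => h.exists_coeffs
  have h10 : c 1 0 = 1 := by
    have := hc.2.1 0 0 le_rfl
    rw [h00, hc.1 (0 + 1) (0 + 1) (by omega), add_zero] at this
    exact this.symm
  -- The restriction rule at `(n + 1, 0)`, with `c (n + 2) 1 = γ * c n 0`.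
  have hrec : ∀ n, c (n + 2) 0 = c (n + 1) 0 - c 2 1 * c n 0 := by
    intro n
    rw [hc.2.1 (n + 1) 0 (by omega), ← hγ n 0 (by omega)]
    ring
  have hpow : ∀ n i, 2 * i ≤ n → c n i = c 2 1 ^ i * c (n - 2 * i) 0 :=
    fun n i hi => coeff_eq_pow_mul hγ hi
  have hlabel : ∀ n, 1 ≤ n → IsIrrLabel (q + q⁻¹) n 0 := fun n hn => ⟨by omega, fun _ => by omega⟩
  have hlam := isIrrCoeffs_irrCoeff hω hl2 hq hc
  refine ⟨c, irrCoeff (q + q⁻¹) l c, c 2 1, ⟨hc, fun c' h => isStdCoeffs_unique hq hc h⟩,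
    ⟨hlam, fun lam' h => isIrrCoeffs_unique hω hl2 hq hlam h⟩, rfl, exists_qint h00 h10 hrec,
    ?_, ?_, ?_, ?_, ?_⟩
  -- For `l = 2`, that is `δ = 0`, the label `(0, 0)` is absent. Otherwise the residue is `1`, too
  -- large for a second term.
  · have hδ := loop_eq_zero_iff hω hl2 hq
    by_cases h : l = 2
    · rw [if_pos h]
      exact hlam.1 0 0 fun h' => h'.2 (hδ.2 h) rfl
    · rw [if_neg h, irrCoeff, if_pos ⟨le_rfl, fun h' => absurd (hδ.1 h') h⟩, if_neg (by omega),
        add_zero, h00]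
  · rw [irrCoeff, if_pos (hlabel 1 le_rfl), if_neg, add_zero, h10]
    rintro ⟨h1, h2⟩
    omega
  -- The label condition and the residue depend only on `n - 2 i`, and both standard coefficients
  -- involved carry the factor `γ ^ i`.
  · intro n i hi
    have e : IsIrrLabel (q + q⁻¹) n i ↔ IsIrrLabel (q + q⁻¹) (n - 2 * i) 0 := by
      have : 2 * i = n ↔ 2 * 0 = n - 2 * i := by omega
      simp [IsIrrLabel, hi, this]
    rw [irrCoeff, irrCoeff]
    by_cases hL : IsIrrLabel (q + q⁻¹) n i
    · rw [if_pos hL, if_pos (e.1 hL), mul_add, hpow n i hi]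
      congr 1
      rw [show n - 2 * i - 2 * 0 = n - 2 * i by omega]
      generalize hj : (n - 2 * i + 1) % l = j
      split_ifs with h
      · rw [hpow n (i + j) (by omega), hpow (n - 2 * i) (0 + j) (by omega), zero_add, pow_add,
          show n - 2 * (i + j) = n - 2 * i - 2 * j by omega, mul_assoc]
      · rw [mul_zero]
    · rw [if_neg hL, if_neg (fun h => hL (e.2 h)), mul_zero]
  · intro n hn hcrit
    rw [isCritical_zero_iff] at hcrit
    rw [irrCoeff, if_pos (hlabel n hn), mul_zero, Nat.sub_zero, hcrit, if_neg (by omega), add_zero]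
  -- The second standard coefficient has `j` cups and equals `γ ^ j * c (n - 2 j) 0`; noncriticality
  -- means that `j` is positive.
  · intro n hn hcrit
    rw [isCritical_zero_iff] at hcrit
    rw [irrCoeff, if_pos (hlabel n hn), mul_zero, Nat.sub_zero, zero_add]
    generalize (n + 1) % l = j at hcrit ⊢
    congr 1
    by_cases h : 2 * j ≤ n
    · rw [if_pos ⟨Nat.pos_of_ne_zero hcrit, h⟩, if_pos h, hpow n j h]
    · rw [if_neg (fun h' => h h'.2), if_neg h, mul_zero]
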